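/- Work in the language of second-order arithmetic (numbers and sets of numbers, with $0,1,+,\cdot,<,=$ on numbers and membership). $\mathrm{RCA}_0$ is the theory consisting of $\mathrm{PA}^-$ (the axioms of discretely ordered commutative semirings with $1$), the $\Sigma^0_1$ induction scheme and the $\Delta^0_1$ comprehension scheme; $\mathrm{I}\Sigma^0_2$ is the $\Sigma^0_2$ induction scheme; in all schemes number and set parameters are allowed. A function $f\colon\mathbb N\to\mathbb N$ is identified with its graph. Let $\Phi^f_e(n)=m$ be the formula expressing that there is a coded sequence of configurations which is a halting computation, with input $n$ and output $m$, of the $e$-th oracle machine (for definiteness, an oracle register machine) with oracle $f$. A function $g\colon\mathbb N\to\mathbb N$ is $\mathrm{DNR}(k,f)$ if $g(n)<k$ for all $n$ and $g(e)\neq\Phi^f_e(e)$ for all $e$ (in particular, this holds at every $e$ with $\Phi^f_e(e)$ undefined). Write $\mathrm{DNR}(k,f)$ also for the formal statement "there is a $g$ that is $\mathrm{DNR}(k,f)$", and let $\mathrm{WKL}$ be the formal statement "every infinite subtree of $2^{<\mathbb N}$ has an infinite path". Here $k$ ranges over all numbers, including non-standard ones in a non-standard model, and $f$ over all functions from $\mathbb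 N$ to $\mathbb N$. **Theorem.** $\mathrm{RCA}_0+\mathrm{I}\Sigma^0_2+\forall f\,\exists k\,\mathrm{DNR}(k,f)\vdash\forall f\,\mathrm{DNR}(2,f)$. Moreover, $\mathrm{RCA}_0+\mathrm{I}\Sigma^0_2$ proves that the statements $\mathrm{WKL}$, $\exists k\,\forall f\,\mathrm{DNR}(k,f)$ and $\forall f\,\exists k\,\mathrm{DNR}(k,f)$ are pairwise equivalent. -/

import Mathlib

/-! Syntax of second-order arithmetic (two sorts: numbers and sets of numbers), a Hilbert calculus
for it, the systems `RCA₀` and `IΣ⁰ₙ`, and the sentences about weak König's lemma and diagonally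
non-recursive functions. -/

namespace SOA

/-- Number terms. Number variables are de Bruijn indices. -/
inductive Tm : Type
  | var : ℕ → Tm
  | zero : Tm
  | one : Tm
  | add : Tm → Tm → Tm
  | mul : Tm → Tm → Tm

instance : Zero Tm := ⟨Tm.zero⟩
instance : One Tm := ⟨Tm.one⟩
instance : Add Tm := ⟨Tm.add⟩
instance : Mul Tm := ⟨Tm.mul⟩

/-- The number variable with de Bruijn index `i`. -/
abbrev v (i : ℕ) : Tm := Tm.var i

/-- Formulas. The two sorts of variables are indexed separately: `allN` binds number variable `0`
(and shifts the other number variables only), `allS` binds set variable `0` (and shifts the other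
set variables only). `mem t X` is `t ∈ X`. -/
inductive Fm : Type
  | bot : Fm
  | eq : Tm → Tm → Fm
  | lt : Tm → Tm → Fm
  | mem : Tm → ℕ → Fm
  | imp : Fm → Fm → Fm
  | allN : Fm → Fm
  | allS : Fm → Fm

open Fm (allN allS)

infix:50 " ≐ " => SOA.Fm.eq
infix:50 " ≺ " => SOA.Fm.lt
infixr:25 " ⟹ " => SOA.Fm.imp

/-- Negation. -/
def neg (φ : Fm) : Fm := φ ⟹ Fm.bot
/-- Conjunction. -/
def conj (φ ψ : Fm) : Fm := neg (φ ⟹ neg ψ)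
/-- Disjunction. -/
def disj (φ ψ : Fm) : Fm := neg φ ⟹ ψ

infixr:35 " ⋏ " => SOA.conj
infixr:30 " ⋎ " => SOA.disj

/-- Biconditional. -/
def bicond (φ ψ : Fm) : Fm := (φ ⟹ ψ) ⋏ (ψ ⟹ φ)

infix:20 " ⟺ " => SOA.bicond

/-- `∃ n`, over numbers. -/
def exN (φ : Fm) : Fm := neg (allN (neg φ))
/-- `∃ X`, over sets. -/
def exS (φ : Fm) : Fm := neg (allS (neg φ))
/-- A block of `k` universal number quantifiers; the innermost one binds variable `0`. -/
def allNs (k : ℕ) (φ : Fm) : Fm := allN^[k] φ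
/-- A block of `k` existential number quantifiers; the innermost one binds variable `0`. -/
def exNs (k : ℕ) (φ : Fm) : Fm := exN^[k] φ

/-! ### Substitution -/

/-- Simultaneous substitution of terms for variables in a term. -/
def Tm.subst (σ : ℕ → Tm) : Tm → Tm
  | .var i => σ i
  | .zero => .zero
  | .one => .one
  | .add s t => .add (s.subst σ) (t.subst σ)
  | .mul s t => .mul (s.subst σ) (t.subst σ)

/-- Shift all variables of a term by `k`: the term as seen from inside `k` number quantifiers. -/
def Tm.lift (t : Tm) (k : ℕ) : Tm := t.subst (fun i => .var (i + k))

infix:100 " ⤒ " => SOA.Tm.lift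

/-- The substitution `σ` moved under a number quantifier. -/
def upN (σ : ℕ → Tm) : ℕ → Tm
  | 0 => v 0
  | i + 1 => σ i ⤒ 1

/-- The renaming `ρ` moved under a set quantifier. -/
def upS (ρ : ℕ → ℕ) : ℕ → ℕ
  | 0 => 0
  | i + 1 => ρ i + 1

/-- Simultaneous capture-avoiding substitution of terms `σ` for the free number variables and of set
variables `ρ` for the free set variables. -/
def Fm.subst : Fm → (ℕ → Tm) → (ℕ → ℕ) → Fm
  | .bot, _, _ => .bot
  | .eq s t, σ, _ => .eq (s.subst σ) (t.subst σ)
  | .lt s t, σ, _ => .lt (s.subst σ) (t.subst σ)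
  | .mem t X, σ, ρ => .mem (t.subst σ) (ρ X)
  | .imp φ ψ, σ, ρ => .imp (φ.subst σ ρ) (ψ.subst σ ρ)
  | .allN φ, σ, ρ => .allN (φ.subst (upN σ) ρ)
  | .allS φ, σ, ρ => .allS (φ.subst σ (upS ρ))

/-- The instance `φ(t)` of the body `φ` of a number quantifier. -/
def Fm.instN (φ : Fm) (t : Tm) : Fm :=
  φ.subst (fun i => Nat.casesOn i t Tm.var) id

/-- The instance `φ(Y)` of the body `φ` of a set quantifier. -/
def Fm.instS (φ : Fm) (Y : ℕ) : Fm :=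
  φ.subst Tm.var (fun i => Nat.casesOn i Y id)

/-- `φ` as seen from inside one further number quantifier. -/
def Fm.liftN (φ : Fm) : Fm := φ.subst (fun i => .var (i + 1)) id

/-- `φ` as seen from inside one further set quantifier. -/
def Fm.liftS (φ : Fm) : Fm := φ.subst Tm.var (fun i => i + 1)

/-! ### Provability -/

/-- `T ⊢ φ` in classical two-sorted first-order logic with equality for numbers. The generalization
rules apply to the axioms too, so an axiom with free variables stands for its universal closure. -/
inductive Provable (T : Set Fm) : Fm → Prop
  | ax {φ} : φ ∈ T → Provable T φ
  | mp {φ ψ} : Provable T (φ ⟹ ψ) → Provable T φ → Provable T ψ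
  | genN {φ} : Provable T φ → Provable T (allN φ)
  | genS {φ} : Provable T φ → Provable T (allS φ)
  | implyK (φ ψ) : Provable T (φ ⟹ ψ ⟹ φ)
  | implyS (φ ψ χ) : Provable T ((φ ⟹ ψ ⟹ χ) ⟹ (φ ⟹ ψ) ⟹ φ ⟹ χ)
  | dne (φ) : Provable T (neg (neg φ) ⟹ φ)
  | allN_elim (φ : Fm) (t : Tm) : Provable T (allN φ ⟹ φ.instN t)
  | allS_elim (φ : Fm) (Y : ℕ) : Provable T (allS φ ⟹ φ.instS Y)
  | allN_intro (φ ψ : Fm) : Provable T (allN (φ.liftN ⟹ ψ) ⟹ φ ⟹ allN ψ)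
  | allS_intro (φ ψ : Fm) : Provable T (allS (φ.liftS ⟹ ψ) ⟹ φ ⟹ allS ψ)
  | eq_refl (t) : Provable T (t ≐ t)
  | eq_subst (φ : Fm) (s t : Tm) : Provable T (s ≐ t ⟹ φ.instN s ⟹ φ.instN t)

/-! ### The arithmetical hierarchy and the axiom systems -/

/-- `∀ n < t, φ`. -/
def ball (t : Tm) (φ : Fm) : Fm := allN (v 0 ≺ t ⤒ 1 ⟹ φ)

/-- Formulas all of whose quantifiers are bounded number quantifiers (set parameters allowed);
`∃ n < t, φ` is available as `neg (ball t (neg φ))`. -/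
inductive IsBounded : Fm → Prop
  | bot : IsBounded Fm.bot
  | eq (s t) : IsBounded (s ≐ t)
  | lt (s t) : IsBounded (s ≺ t)
  | mem (t X) : IsBounded (Fm.mem t X)
  | imp {φ ψ} : IsBounded φ → IsBounded ψ → IsBounded (φ ⟹ ψ)
  | ball (t) {φ} : IsBounded φ → IsBounded (ball t φ)

/-- `Hier true n` is the class of `Σ⁰ₙ` formulas and `Hier false n` the class of `Π⁰ₙ` formulas:
`n` alternating number quantifiers in front of a bounded formula. -/
def Hier : Bool → ℕ → Fm → Prop
  | _, 0, φ => IsBounded φ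
  | true, n + 1, φ => ∃ ψ, Hier false n ψ ∧ φ = exN ψ
  | false, n + 1, φ => ∃ ψ, Hier true n ψ ∧ φ = allN ψ

/-- `φ` is `Σ⁰ₙ`. -/
def IsSigma (n : ℕ) (φ : Fm) : Prop := Hier true n φ
/-- `φ` is `Π⁰ₙ`. -/
def IsPi (n : ℕ) (φ : Fm) : Prop := Hier false n φ

/-- Discretely ordered commutative semirings with `1` (and with differences `y - x` for `x < y`). -/
def PAminus : Set Fm :=
  { (v 0 + v 1) + v 2 ≐ v 0 + (v 1 + v 2),
    v 0 + v 1 ≐ v 1 + v 0,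
    (v 0 * v 1) * v 2 ≐ v 0 * (v 1 * v 2),
    v 0 * v 1 ≐ v 1 * v 0,
    v 0 * (v 1 + v 2) ≐ v 0 * v 1 + v 0 * v 2,
    v 0 + 0 ≐ v 0,
    v 0 * 0 ≐ 0,
    v 0 * 1 ≐ v 0,
    (v 0 ≺ v 1 ⋏ v 1 ≺ v 2) ⟹ v 0 ≺ v 2,
    neg (v 0 ≺ v 0),
    v 0 ≺ v 1 ⋎ v 0 ≐ v 1 ⋎ v 1 ≺ v 0,
    v 0 ≺ v 1 ⟹ v 0 + v 2 ≺ v 1 + v 2,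
    (0 ≺ v 2 ⋏ v 0 ≺ v 1) ⟹ v 0 * v 2 ≺ v 1 * v 2,
    v 0 ≺ v 1 ⟹ exN (v 1 + v 0 ≐ v 2),
    0 ≺ 1,
    0 ≺ v 0 ⟹ (1 ≐ v 0 ⋎ 1 ≺ v 0),
    0 ≐ v 0 ⋎ 0 ≺ v 0 }

/-- The induction axiom for `φ` with respect to the number variable `0`. -/
def inductionAx (φ : Fm) : Fm :=
  (φ.instN 0 ⋏ allN (φ ⟹ φ.subst (fun i => Nat.casesOn i (v 0 + 1) (fun j => v (j + 1))) id)) ⟹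
    allN φ

/-- The `Σ⁰ₙ` induction scheme, with number and set parameters. -/
def ISigma (n : ℕ) : Set Fm := {χ | ∃ φ, IsSigma n φ ∧ χ = inductionAx φ}

/-- The `Δ⁰₁` comprehension scheme, with number and set parameters. -/
def Delta1CA : Set Fm :=
  {χ | ∃ φ ψ, IsSigma 1 φ ∧ IsPi 1 ψ ∧
    χ = (allN (φ ⟺ ψ) ⟹ exS (allN (Fm.mem (v 0) 0 ⟺ φ.liftS)))}

/-- The system `RCA₀`. -/
def RCA0 : Set Fm := PAminus ∪ ISigma 1 ∪ Delta1CA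

/-! ### Coding of pairs, functions and finite sequences -/

/-- The pair `⟨a, b⟩`. -/
def pair (a b : Tm) : Tm := (a + b) * (a + b) + a

/-- `⟨a, b⟩ ∈ X`; for (the graph of) a function `X` this says `X(a) = b`. -/
def app (X : ℕ) (a b : Tm) : Fm := Fm.mem (pair a b) X

/-- `X` is (the graph of) a function from `ℕ` to `ℕ`. -/
def isFun (X : ℕ) : Fm :=
  allN (Fm.mem (v 0) X ⟹ exNs 2 (v 2 ≐ pair (v 1) (v 0))) ⋏
  allN (exN (app X (v 1) (v 0))) ⋏
  allNs 3 (app X (v 2) (v 1) ⟹ app X (v 2) (v 0) ⟹ v 1 ≐ v 0)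

/-- Gödel's function: `x` is the remainder of `c` modulo `1 + (i + 1) d`. -/
def beta (c d i x : Tm) : Fm :=
  exN (c ⤒ 1 ≐ v 0 * (1 + (i ⤒ 1 + 1) * d ⤒ 1) + x ⤒ 1) ⋏ x ≺ 1 + (i + 1) * d

/-- `s` codes a finite sequence of length `l`: it has the form `⟨l, ⟨c, d⟩⟩`. -/
def isLen (s l : Tm) : Fm := exNs 2 (s ⤒ 2 ≐ pair (l ⤒ 2) (pair (v 1) (v 0)))

/-- `s` codes a finite sequence of length greater than `i` whose `i`-th entry is `x`. -/
def entry (s i x : Tm) : Fm :=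
  exNs 3 (s ⤒ 3 ≐ pair (v 2) (pair (v 1) (v 0)) ⋏ i ⤒ 3 ≺ v 2 ⋏
    beta (v 1) (v 0) (i ⤒ 3) (x ⤒ 3))

/-! ### Oracle machines

A program is a code of a finite sequence of instructions. The machine has a program counter and
registers `R₀, R₁, …` that hold numbers. The instructions are

* `⟨0, ⟨a, b⟩⟩`: `R_a := b`;
* `⟨1, ⟨a, ⟨b, c⟩⟩⟩`: `R_a := R_b + R_c`;
* `⟨2, ⟨a, ⟨b, c⟩⟩⟩`: `R_a := R_b * R_c`;
* `⟨3, ⟨a, b⟩⟩`: `R_a := f(R_b)`, where `f` is the oracle;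
* `⟨4, ⟨a, ⟨b, c⟩⟩⟩`: if `R_a < R_b`, continue with instruction number `c`;

and, except after a jump, the machine continues with the next instruction. It starts at instruction
`0` with the input in `R₀` and `0` in the other registers, and it halts, with output `R₀`, when the
program counter is at least the length of the program. A configuration is a pair `⟨p, R⟩` of the
program counter `p` and a code `R` of a finite sequence of register contents, long enough for the
computation in question. -/

/-- `R'` arises from the finite sequence `R` by replacing the entry number `a` by `x`. -/
def update (R a x R' : Tm) : Fm :=
  exN (isLen (R ⤒ 1) (v 0) ⋏ isLen (R' ⤒ 1) (v 0) ⋏ a ⤒ 1 ≺ v 0) ⋏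
  allNs 2 (entry (R' ⤒ 2) (v 1) (v 0) ⟺
    ((v 1 ≐ a ⤒ 2 ⋏ v 0 ≐ x ⤒ 2) ⋎ (neg (v 1 ≐ a ⤒ 2) ⋏ entry (R ⤒ 2) (v 1) (v 0))))

/-- The instruction `i` leads with oracle `f` from the configuration `⟨p, R⟩` to `⟨p', R'⟩`. -/
def exec (f : ℕ) (i p R p' R' : Tm) : Fm :=
  -- here `a = v 1`, `b = v 0`
  exNs 2 (i ⤒ 2 ≐ pair 0 (pair (v 1) (v 0)) ⋏
    update (R ⤒ 2) (v 1) (v 0) (R' ⤒ 2) ⋏ p' ⤒ 2 ≐ p ⤒ 2 + 1) ⋎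
  -- here and below `a = v 4`, `b = v 3`, `c = v 2`
  exNs 5 (i ⤒ 5 ≐ pair 1 (pair (v 4) (pair (v 3) (v 2))) ⋏
    entry (R ⤒ 5) (v 3) (v 1) ⋏ entry (R ⤒ 5) (v 2) (v 0) ⋏
    update (R ⤒ 5) (v 4) (v 1 + v 0) (R' ⤒ 5) ⋏ p' ⤒ 5 ≐ p ⤒ 5 + 1) ⋎
  exNs 5 (i ⤒ 5 ≐ pair (1 + 1) (pair (v 4) (pair (v 3) (v 2))) ⋏
    entry (R ⤒ 5) (v 3) (v 1) ⋏ entry (R ⤒ 5) (v 2) (v 0) ⋏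
    update (R ⤒ 5) (v 4) (v 1 * v 0) (R' ⤒ 5) ⋏ p' ⤒ 5 ≐ p ⤒ 5 + 1) ⋎
  -- here `a = v 3`, `b = v 2`
  exNs 4 (i ⤒ 4 ≐ pair (1 + 1 + 1) (pair (v 3) (v 2)) ⋏
    entry (R ⤒ 4) (v 2) (v 1) ⋏ app f (v 1) (v 0) ⋏
    update (R ⤒ 4) (v 3) (v 0) (R' ⤒ 4) ⋏ p' ⤒ 4 ≐ p ⤒ 4 + 1) ⋎
  exNs 5 (i ⤒ 5 ≐ pair (1 + 1 + 1 + 1) (pair (v 4) (pair (v 3) (v 2))) ⋏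
    entry (R ⤒ 5) (v 4) (v 1) ⋏ entry (R ⤒ 5) (v 3) (v 0) ⋏ R' ⤒ 5 ≐ R ⤒ 5 ⋏
    ((v 1 ≺ v 0 ⋏ p' ⤒ 5 ≐ v 2) ⋎ (neg (v 1 ≺ v 0) ⋏ p' ⤒ 5 ≐ p ⤒ 5 + 1)))

/-- The program `e` leads with oracle `f` in one step from the configuration `C` to `C'`. -/
def step (f : ℕ) (e C C' : Tm) : Fm :=
  -- the instruction is `v 4`, `C = ⟨v 3, v 2⟩` and `C' = ⟨v 1, v 0⟩`
  exNs 5 (C ⤒ 5 ≐ pair (v 3) (v 2) ⋏ C' ⤒ 5 ≐ pair (v 1) (v 0) ⋏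
    entry (e ⤒ 5) (v 3) (v 4) ⋏ exec f (v 4) (v 3) (v 2) (v 1) (v 0))

/-- `C` is an initial configuration for input `n`. -/
def initial (C n : Tm) : Fm :=
  exN (C ⤒ 1 ≐ pair 0 (v 0) ⋏ entry (v 0) 0 (n ⤒ 1) ⋏
    allNs 2 (entry (v 2) (v 1) (v 0) ⟹ neg (v 1 ≐ 0) ⟹ v 0 ≐ 0))

/-- `C` is a halting configuration of the program `e`, with output `m`. -/
def halting (e C m : Tm) : Fm :=
  -- `C = ⟨v 2, v 1⟩` and the program has length `v 0`
  exNs 3 (C ⤒ 3 ≐ pair (v 2) (v 1) ⋏ isLen (e ⤒ 3) (v 0) ⋏ neg (v 2 ≺ v 0) ⋏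
    entry (v 1) 0 (m ⤒ 3))

/-- `Φ_e^f(n) = m`: there is a coded sequence of configurations (`v 1`, of length `v 0 + 1`) that is
a halting computation of the program `e` with oracle `f` from input `n` to output `m`. -/
def phi (f : ℕ) (e n m : Tm) : Fm :=
  exNs 2 (isLen (v 1) (v 0 + 1) ⋏
    exN (entry (v 2) 0 (v 0) ⋏ initial (v 0) (n ⤒ 3)) ⋏
    ball (v 0) (exNs 2 (entry (v 4) (v 2) (v 1) ⋏ entry (v 4) (v 2 + 1) (v 0) ⋏
      step f (e ⤒ 5) (v 1) (v 0))) ⋏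
    exN (entry (v 2) (v 1) (v 0) ⋏ halting (e ⤒ 3) (v 0) (m ⤒ 3)))

/-! ### Diagonally non-recursive functions -/

/-- The function `g` is `k`-bounded. -/
def isBddBy (g : ℕ) (k : Tm) : Fm := allNs 2 (app g (v 1) (v 0) ⟹ v 0 ≺ k ⤒ 2)

/-- The function `g` is diagonally non-recursive relative to `f`: for all `e`, `g(e) ≠ Φ_e^f(e)`. -/
def isDNR (g f : ℕ) : Fm := allNs 2 (app g (v 1) (v 0) ⟹ neg (phi f (v 1) (v 1) (v 0)))

/-- `DNR(k, f)`: there is a `k`-bounded function that is diagonally non-recursive relative to `f`. -/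
def DNR (k : Tm) (f : ℕ) : Fm := exS (isFun 0 ⋏ isBddBy 0 k ⋏ isDNR 0 (f + 1))

/-- `∀ f, DNR(2, f)`. -/
def allDNR2 : Fm := allS (isFun 0 ⟹ DNR (1 + 1) 0)

/-- `∀ f ∃ k, DNR(k, f)`. -/
def allExDNR : Fm := allS (isFun 0 ⟹ exN (DNR (v 0) 0))

/-- `∃ k ∀ f, DNR(k, f)`. -/
def exAllDNR : Fm := exN (allS (isFun 0 ⟹ DNR (v 0) 0))

/-! ### Weak König's lemma -/

/-- The codes `s` and `t` code the same finite sequence. -/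
def sameSeq (s t : Tm) : Fm :=
  exN (isLen (s ⤒ 1) (v 0) ⋏ isLen (t ⤒ 1) (v 0)) ⋏
  allNs 2 (entry (s ⤒ 2) (v 1) (v 0) ⟺ entry (t ⤒ 2) (v 1) (v 0))

/-- `s` is a string, an element of `ℕ^{<ℕ}`: strings are identified with their least codes. -/
def isString (s : Tm) : Fm :=
  exN (isLen (s ⤒ 1) (v 0)) ⋏ ball s (neg (sameSeq (v 0) (s ⤒ 1)))

/-- `s` is an element of `2^{<ℕ}`. -/
def isBinString (s : Tm) : Fm :=
  isString s ⋏ allNs 2 (entry (s ⤒ 2) (v 1) (v 0) ⟹ v 0 ≺ 1 + 1)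

/-- The string `s` is an initial segment of the string `t`. -/
def isPrefix (s t : Tm) : Fm :=
  exNs 2 (isLen (s ⤒ 2) (v 1) ⋏ isLen (t ⤒ 2) (v 0) ⋏ neg (v 0 ≺ v 1)) ⋏
  allNs 2 (entry (s ⤒ 2) (v 1) (v 0) ⟹ entry (t ⤒ 2) (v 1) (v 0))

/-- The set `T` is a subtree of `2^{<ℕ}`. -/
def isBinTree (T : ℕ) : Fm :=
  allN (Fm.mem (v 0) T ⟹ isBinString (v 0)) ⋏
  allNs 2 (Fm.mem (v 1) T ⟹ isString (v 0) ⟹ isPrefix (v 0) (v 1) ⟹ Fm.mem (v 0) T)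

/-- The set `T` is infinite. -/
def isInfinite (T : ℕ) : Fm := allN (exN (v 1 ≺ v 0 ⋏ Fm.mem (v 0) T))

/-- The function `f` is a path through `T`: for all `n`, the string `f ↾ n` is in `T`. -/
def isPath (f T : ℕ) : Fm :=
  allN (exN (Fm.mem (v 0) T ⋏ isLen (v 0) (v 1) ⋏
    allNs 2 (entry (v 2) (v 1) (v 0) ⟹ app f (v 1) (v 0))))

/-- Weak König's lemma: every infinite subtree of `2^{<ℕ}` has an infinite path. -/
def WKL : Fm := allS ((isBinTree 0 ⋏ isInfinite 0) ⟹ exS (isFun 0 ⋏ isPath 0 1))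

end SOA

/-!
By the completeness theorem for the calculus (`Provable.complete`, a Henkin construction in which
the numbers of the model are terms modulo provable equality and its sets are the set variables),
it suffices to argue in an arbitrary, possibly non-standard, model of `RCA₀` and `Σ⁰₂` induction.
There the statements are shown to be equivalent to `Σ⁰₁` separation (`Separation`): any two
disjoint `Σ⁰₁` predicates are separated by a `Δ⁰₁` predicate.

Two of the steps are classical and need `RCA₀` only. Separation and weak König's lemma are
equivalent (`separation_of_WKL`, `WKL_of_separation`). Separation yields a two-valued diagonally
non-recursive function for every oracle: separate the programs with output `0` on themselves from
those with output `1`, which are disjoint since the machines are deterministic (`Phi.det`,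
`DNR_two_of_separation`).

The main step, `separation_of_DNR`, derives separation from `∀ f ∃ k, DNR(k, f)`, with `k`
possibly non-standard and depending on `f`. Given disjoint `Σ⁰₁` predicates `A` and `B`, the
oracle `f` carries out the steps of the search, for a sequence `s` of any length, for a place `x`
such that `A` holds at the entry `x` of `s` and `B` at all the others; there is at most one such
`x`, and a program `e` that depends on `s` only through two constants searches for it (`IsProg`,
`IsProg.phi`). Let `g` be diagonally non-recursive relative to `f` and bounded by `k`. For `s` of
length `k`, the value `y = g(e) < k` is thus wrong as a guess for `x`: some entry of `s` fails to
satisfy what the guess says of it, `A` for the entry `y` and `B` for the other ones. Say that a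
sequence `t` of length `j` forces a late error if for all its extensions to length `k` there is
such an error at a place `≥ j`. The empty sequence does, and no sequence of length `k` does. The
existence of a `t` of length `j` that does is a `Σ⁰₂` property of `j`, so by `Σ⁰₂` induction it
holds for some `j < k` and fails for `j + 1`. Fix such a `t`. Given a number `p`, as `t` followed
by `p` does not force a late error, one finds computably an extension of it with witnesses that
there are no errors after the place `j`. So the error is at the place `j`: the guess is wrong
about `p`. It says that `A p` if `y = j`, and that `B p` if not; so `p ↦ (y ≠ j)` is a separation.

In the models, definability is handled by the classes `Sig`, `PiD`, `Del` and `Fn` of `Σ⁰₁`, `Π⁰₁`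
and `Δ⁰₁` predicates and of functions with `Σ⁰₁` graph, for which instance search applies the
usual closure properties.
-/

set_option linter.unusedSectionVars false

namespace SOA

open Fm (allN allS)

/-! ### Structures and satisfaction -/

/-- A two-sorted structure for the language of second-order arithmetic, with an arbitrary domain of
sets and an arbitrary membership relation (Henkin semantics). -/
structure Str where
  /-- the numbers -/
  N : Type
  /-- the sets -/
  S : Type
  zero : N
  one : N
  add : N → N → N
  mul : N → N → N
  lt : N → N → Prop
  mem : N → S → Prop

/-- Prepend a value to an assignment: the assignment seen from inside a quantifier. -/
def econs {α : Type} (x : α) (e : ℕ → α) : ℕ → α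
  | 0 => x
  | i + 1 => e i

@[simp] theorem econs_zero {α : Type} (x : α) (e : ℕ → α) : econs x e 0 = x := rfl
@[simp] theorem econs_succ {α : Type} (x : α) (e : ℕ → α) (i : ℕ) : econs x e (i + 1) = e i := rfl
theorem econs_eta {α : Type} (e : ℕ → α) : econs (e 0) (fun i => e (i + 1)) = e := by
  funext i; cases i <;> rfl

/-- The value of a term. -/
def Tm.ev (M : Str) (e : ℕ → M.N) : Tm → M.N
  | .var i => e i
  | .zero => M.zero
  | .one => M.one
  | .add s t => M.add (s.ev M e) (t.ev M e)
  | .mul s t => M.mul (s.ev M e) (t.ev M e)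

/-- Satisfaction of a formula under an assignment `e` of numbers and `r` of sets. -/
def Fm.eval (M : Str) : Fm → (ℕ → M.N) → (ℕ → M.S) → Prop
  | .bot, _, _ => False
  | .eq s t, e, _ => s.ev M e = t.ev M e
  | .lt s t, e, _ => M.lt (s.ev M e) (t.ev M e)
  | .mem t X, e, r => M.mem (t.ev M e) (r X)
  | .imp φ ψ, e, r => φ.eval M e r → ψ.eval M e r
  | .allN φ, e, r => ∀ x, φ.eval M (econs x e) r
  | .allS φ, e, r => ∀ X, φ.eval M e (econs X r)

theorem Tm.ev_subst (M : Str) (e : ℕ → M.N) (σ : ℕ → Tm) (t : Tm) :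
    (t.subst σ).ev M e = t.ev M (fun i => (σ i).ev M e) := by
  induction t <;> simp_all [Tm.subst, Tm.ev]

theorem Fm.eval_subst (M : Str) (φ : Fm) : ∀ (σ : ℕ → Tm) (ρ : ℕ → ℕ) (e : ℕ → M.N) (r : ℕ → M.S),
    (φ.subst σ ρ).eval M e r ↔ φ.eval M (fun i => (σ i).ev M e) (fun i => r (ρ i)) := by
  induction φ with
  | bot => intros; rfl
  | eq s t => intros; simp [Fm.subst, Fm.eval, Tm.ev_subst]
  | lt s t => intros; simp [Fm.subst, Fm.eval, Tm.ev_subst]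
  | mem t X => intros; simp [Fm.subst, Fm.eval, Tm.ev_subst]
  | imp φ ψ h1 h2 => intros; simp only [Fm.subst, Fm.eval, h1, h2]
  | allN φ h =>
    intro σ ρ e r
    simp only [Fm.subst, Fm.eval, h]
    refine forall_congr' fun x => ?_
    have : (fun i => (upN σ i).ev M (econs x e)) = econs x (fun i => (σ i).ev M e) := by
      funext i; cases i
      · rfl
      · simp only [upN, Tm.lift, Tm.ev_subst, econs_succ]; rfl
    rw [this]
  | allS φ h =>
    intro σ ρ e r
    simp only [Fm.subst, Fm.eval, h]
    refine forall_congr' fun x => ?_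
    have : (fun i => econs x r (upS ρ i)) = econs x (fun i => r (ρ i)) := by
      funext i; cases i <;> rfl
    rw [this]

/-! ### Syntactic substitution -/

/-- A bound for the number variables of a term. -/
def Tm.bd : Tm → ℕ
  | .var i => i + 1
  | .zero => 0
  | .one => 0
  | .add s t => max s.bd t.bd
  | .mul s t => max s.bd t.bd

/-- A bound for the free number variables of a formula. -/
def Fm.bdN : Fm → ℕ
  | .bot => 0
  | .eq s t => max s.bd t.bd
  | .lt s t => max s.bd t.bd
  | .mem t _ => t.bd
  | .imp φ ψ => max φ.bdN ψ.bdN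
  | .allN φ => φ.bdN - 1
  | .allS φ => φ.bdN

/-- A bound for the free set variables of a formula. -/
def Fm.bdS : Fm → ℕ
  | .bot => 0
  | .eq _ _ => 0
  | .lt _ _ => 0
  | .mem _ X => X + 1
  | .imp φ ψ => max φ.bdS ψ.bdS
  | .allN φ => φ.bdS
  | .allS φ => φ.bdS - 1

theorem Tm.subst_congr {σ τ : ℕ → Tm} {t : Tm} (h : ∀ i < t.bd, σ i = τ i) :
    t.subst σ = t.subst τ := by
  induction t with
  | var i => exact h i (Nat.lt_succ_self i)
  | zero => rfl
  | one => rfl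
  | add s t h1 h2 =>
    simp only [Tm.bd, lt_max_iff] at h
    simp [Tm.subst, h1 fun i hi => h i (.inl hi), h2 fun i hi => h i (.inr hi)]
  | mul s t h1 h2 =>
    simp only [Tm.bd, lt_max_iff] at h
    simp [Tm.subst, h1 fun i hi => h i (.inl hi), h2 fun i hi => h i (.inr hi)]

theorem Fm.subst_congr {φ : Fm} : ∀ {σ τ : ℕ → Tm} {ρ π : ℕ → ℕ}, (∀ i < φ.bdN, σ i = τ i) →
    (∀ i < φ.bdS, ρ i = π i) → φ.subst σ ρ = φ.subst τ π := by
  induction φ with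
  | bot => intros; rfl
  | eq s t =>
    intro σ τ ρ π h _
    simp only [Fm.bdN, lt_max_iff] at h
    simp [Fm.subst, Tm.subst_congr fun i hi => h i (.inl hi),
      Tm.subst_congr fun i hi => h i (.inr hi)]
  | lt s t =>
    intro σ τ ρ π h _
    simp only [Fm.bdN, lt_max_iff] at h
    simp [Fm.subst, Tm.subst_congr fun i hi => h i (.inl hi),
      Tm.subst_congr fun i hi => h i (.inr hi)]
  | mem t X =>
    intro σ τ ρ π h h'
    simp [Fm.subst, Tm.subst_congr h, h' X (Nat.lt_succ_self X)]
  | imp φ ψ h1 h2 =>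
    intro σ τ ρ π h h'
    simp only [Fm.bdN, Fm.bdS, lt_max_iff] at h h'
    simp only [Fm.subst, h1 (fun i hi => h i (.inl hi)) (fun i hi => h' i (.inl hi)),
      h2 (fun i hi => h i (.inr hi)) (fun i hi => h' i (.inr hi))]
  | allN φ ih =>
    intro σ τ ρ π h h'
    simp only [Fm.subst]
    rw [ih (τ := upN τ) (π := π) _ h']
    intro i hi
    cases i with
    | zero => rfl
    | succ i => simp only [upN]; rw [h i (by simp only [Fm.bdN]; omega)]
  | allS φ ih =>
    intro σ τ ρ π h h'
    simp only [Fm.subst]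
    rw [ih (τ := τ) (π := upS π) h]
    intro i hi
    cases i with
    | zero => rfl
    | succ i => simp only [upS]; rw [h' i (by simp only [Fm.bdS]; omega)]

theorem Tm.subst_subst (σ τ : ℕ → Tm) (t : Tm) :
    (t.subst σ).subst τ = t.subst (fun i => (σ i).subst τ) := by
  induction t <;> simp_all [Tm.subst]

theorem Fm.subst_subst (φ : Fm) : ∀ (σ τ : ℕ → Tm) (ρ π : ℕ → ℕ),
    (φ.subst σ ρ).subst τ π = φ.subst (fun i => (σ i).subst τ) (fun i => π (ρ i)) := by
  induction φ with
  | bot => intros; rfl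
  | eq s t => intros; simp [Fm.subst, Tm.subst_subst]
  | lt s t => intros; simp [Fm.subst, Tm.subst_subst]
  | mem t X => intros; simp [Fm.subst, Tm.subst_subst]
  | imp φ ψ h1 h2 => intros; simp only [Fm.subst, h1, h2]
  | allN φ ih =>
    intro σ τ ρ π
    simp only [Fm.subst, ih]
    congr 2
    funext i
    cases i with
    | zero => rfl
    | succ i => simp only [upN, Tm.lift, Tm.subst_subst]; rfl
  | allS φ ih =>
    intro σ τ ρ π
    simp only [Fm.subst, ih]
    congr 2
    funext i
    cases i <;> rfl

theorem Tm.subst_var (t : Tm) : t.subst Tm.var = t := by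
  induction t <;> simp_all [Tm.subst]

theorem Fm.subst_var (φ : Fm) : φ.subst Tm.var id = φ := by
  have h1 : upN Tm.var = Tm.var := by funext i; cases i <;> rfl
  have h2 : upS id = id := by funext i; cases i <;> rfl
  induction φ <;> simp_all [Fm.subst, Tm.subst_var]

theorem Fm.eval_congr (M : Str) (φ : Fm) {e e' : ℕ → M.N} {r r' : ℕ → M.S}
    (h : ∀ i < φ.bdN, e i = e' i) (h' : ∀ i < φ.bdS, r i = r' i) :
    φ.eval M e r ↔ φ.eval M e' r' := by
  have tm : ∀ (t : Tm) {e e' : ℕ → M.N}, (∀ i < t.bd, e i = e' i) → t.ev M e = t.ev M e' := by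
    intro t e e' h
    induction t with
    | var i => exact h i (Nat.lt_succ_self i)
    | zero => rfl
    | one => rfl
    | add s t h1 h2 =>
      simp only [Tm.bd, lt_max_iff] at h
      simp [Tm.ev, h1 fun i hi => h i (.inl hi), h2 fun i hi => h i (.inr hi)]
    | mul s t h1 h2 =>
      simp only [Tm.bd, lt_max_iff] at h
      simp [Tm.ev, h1 fun i hi => h i (.inl hi), h2 fun i hi => h i (.inr hi)]
  induction φ generalizing e e' r r' with
  | bot => rfl
  | eq s t =>
    simp only [Fm.bdN, lt_max_iff] at h
    simp [Fm.eval, tm s fun i hi => h i (.inl hi), tm t fun i hi => h i (.inr hi)]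
  | lt s t =>
    simp only [Fm.bdN, lt_max_iff] at h
    simp [Fm.eval, tm s fun i hi => h i (.inl hi), tm t fun i hi => h i (.inr hi)]
  | mem t X => simp [Fm.eval, tm t h, h' X (Nat.lt_succ_self X)]
  | imp φ ψ h1 h2 =>
    simp only [Fm.bdN, Fm.bdS, lt_max_iff] at h h'
    simp only [Fm.eval, h1 (fun i hi => h i (.inl hi)) (fun i hi => h' i (.inl hi)),
      h2 (fun i hi => h i (.inr hi)) (fun i hi => h' i (.inr hi))]
  | allN φ ih =>
    refine forall_congr' fun x => ih ?_ h'
    intro i hi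
    cases i with
    | zero => rfl
    | succ i => exact h i (by simp only [Fm.bdN]; omega)
  | allS φ ih =>
    refine forall_congr' fun x => ih h ?_
    intro i hi
    cases i with
    | zero => rfl
    | succ i => exact h' i (by simp only [Fm.bdS]; omega)

/-! ### Derived rules of the calculus -/

section Calculus

variable {T : Set Fm}

namespace Provable

theorem lift {α φ : Fm} (h : Provable T φ) : Provable T (α ⟹ φ) := mp (implyK _ _) h

theorem app {α φ ψ : Fm} (h : Provable T (α ⟹ φ ⟹ ψ)) (h' : Provable T (α ⟹ φ)) :
    Provable T (α ⟹ ψ) := mp (mp (implyS _ _ _) h) h'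

theorem refl (φ : Fm) : Provable T (φ ⟹ φ) :=
  app (implyK φ (φ ⟹ φ)) (implyK φ φ)

theorem trans {φ ψ χ : Fm} (h : Provable T (φ ⟹ ψ)) (h' : Provable T (ψ ⟹ χ)) :
    Provable T (φ ⟹ χ) := app (lift h') h

theorem swap {φ ψ χ : Fm} (h : Provable T (φ ⟹ ψ ⟹ χ)) : Provable T (ψ ⟹ φ ⟹ χ) :=
  trans (implyK ψ φ) (mp (implyS _ _ _) h)

theorem app2 {α β φ ψ : Fm} (h : Provable T (α ⟹ β ⟹ φ ⟹ ψ)) (h' : Provable T (α ⟹ β ⟹ φ)) :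
    Provable T (α ⟹ β ⟹ ψ) := app (app (lift (implyS _ _ _)) h) h'

theorem exfalso (φ : Fm) : Provable T (Fm.bot ⟹ φ) :=
  trans (implyK Fm.bot (neg φ)) (dne φ)

/-- Classical reductio. -/
theorem byContra {α φ : Fm} (h : Provable T (α ⟹ neg φ ⟹ Fm.bot)) : Provable T (α ⟹ φ) :=
  trans h (dne φ)

theorem absurd {α φ : Fm} (ψ : Fm) (h : Provable T (α ⟹ neg φ)) : Provable T (α ⟹ φ ⟹ ψ) :=
  app2 (lift (lift (exfalso ψ))) h

theorem conjLeft (φ ψ : Fm) : Provable T (φ ⋏ ψ ⟹ φ) := by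
  refine byContra ?_
  -- from `¬φ` follows `φ → ¬ψ`
  have h : Provable T (neg φ ⟹ φ ⟹ neg ψ) := absurd _ (refl _)
  exact app2 (implyK _ _) (lift h)

theorem conjRight (φ ψ : Fm) : Provable T (φ ⋏ ψ ⟹ ψ) := by
  refine byContra ?_
  have h : Provable T (neg ψ ⟹ φ ⟹ neg ψ) := implyK _ _
  exact app2 (implyK _ _) (lift h)

theorem swapping (φ ψ χ : Fm) : Provable T ((φ ⟹ ψ ⟹ χ) ⟹ ψ ⟹ φ ⟹ χ) :=
  app2 (trans (implyS _ _ _) (implyK _ ψ)) (lift (implyK _ _))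

theorem curry {φ ψ χ : Fm} (h : Provable T (φ ⋏ ψ ⟹ χ)) : Provable T (φ ⟹ ψ ⟹ χ) := by
  have h1 : Provable T (φ ⟹ (φ ⟹ neg ψ) ⟹ ψ ⟹ Fm.bot) := swap (refl _)
  have h2 : Provable T (φ ⟹ ψ ⟹ (φ ⟹ neg ψ) ⟹ Fm.bot) := trans h1 (swapping _ _ _)
  exact app2 (lift (lift h)) h2

end Provable

theorem instN_upN (φ : Fm) (σ : ℕ → Tm) (ρ : ℕ → ℕ) (t : Tm) :
    (φ.subst (upN σ) ρ).instN t = φ.subst (econs t σ) ρ := by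
  rw [Fm.instN, Fm.subst_subst]
  congr 1
  funext i
  cases i with
  | zero => rfl
  | succ i =>
    simp only [upN, Tm.lift, Tm.subst_subst, econs_succ]
    exact Tm.subst_var _

theorem instS_upS (φ : Fm) (σ : ℕ → Tm) (ρ : ℕ → ℕ) (Y : ℕ) :
    (φ.subst σ (upS ρ)).instS Y = φ.subst σ (econs Y ρ) := by
  rw [Fm.instS, Fm.subst_subst]
  congr 1
  · funext i; exact Tm.subst_var _
  · funext i; cases i <;> rfl

namespace Provable

theorem genNs {φ : Fm} (h : Provable T φ) (k : ℕ) : Provable T (allN^[k] φ) := by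
  induction k with
  | zero => exact h
  | succ k ih => rw [Function.iterate_succ_apply']; exact genN ih

theorem genSs {φ : Fm} (h : Provable T φ) (k : ℕ) : Provable T (allS^[k] φ) := by
  induction k with
  | zero => exact h
  | succ k ih => rw [Function.iterate_succ_apply']; exact genS ih

theorem inst_allNs (k : ℕ) : ∀ (φ : Fm) (σ : ℕ → Tm), (∀ i, σ (i + k) = Tm.var i) →
    Provable T (allN^[k] φ) → Provable T (φ.subst σ id) := by
  induction k with
  | zero =>
    intro φ σ h hp
    rw [show σ = Tm.var from funext h, Fm.subst_var]; exact hp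
  | succ k ih =>
    intro φ σ h hp
    have h1 := ih (allN φ) (fun i => σ (i + 1)) (fun i => h i) hp
    have h2 := mp (allN_elim _ (σ 0)) h1
    rwa [instN_upN, econs_eta] at h2

theorem inst_allSs (k : ℕ) : ∀ (φ : Fm) (ρ : ℕ → ℕ), (∀ i, ρ (i + k) = i) →
    Provable T (allS^[k] φ) → Provable T (φ.subst Tm.var ρ) := by
  induction k with
  | zero =>
    intro φ ρ h hp
    rw [show ρ = id from funext h, Fm.subst_var]; exact hp
  | succ k ih =>
    intro φ ρ h hp
    have h1 := ih (allS φ) (fun i => ρ (i + 1)) (fun i => h i) hp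
    have h2 := mp (allS_elim _ (ρ 0)) h1
    rwa [instS_upS, econs_eta] at h2

/-- Provability is closed under substitution for number variables: generalize over all the free
variables, then instantiate one by one. -/
theorem substN {φ : Fm} (h : Provable T φ) (σ : ℕ → Tm) : Provable T (φ.subst σ id) := by
  have := inst_allNs φ.bdN φ (fun i => if i < φ.bdN then σ i else Tm.var (i - φ.bdN))
    (fun i => by simp) (genNs h _)
  rwa [Fm.subst_congr (τ := σ) (π := id) (fun i hi => by simp [hi]) (fun _ _ => rfl)] at this

theorem substS {φ : Fm} (h : Provable T φ) (ρ : ℕ → ℕ) : Provable T (φ.subst Tm.var ρ) := by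
  have := inst_allSs φ.bdS φ (fun i => if i < φ.bdS then ρ i else i - φ.bdS)
    (fun i => by simp) (genSs h _)
  rwa [Fm.subst_congr (τ := Tm.var) (π := ρ) (fun _ _ => rfl) (fun i hi => by simp [hi])] at this

/-- If `θ` implies the instance of `χ` at a fresh variable, it implies `∀ χ`. -/
theorem fresh_allN {θ χ : Fm} {c : ℕ} (hθ : θ.bdN ≤ c) (hχ : χ.bdN ≤ c)
    (h : Provable T (θ ⟹ χ.instN (v c))) : Provable T (θ ⟹ allN χ) := by
  have h1 := substN h (fun i => if i = c then v 0 else v (i + 1))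
  have e1 : θ.subst (fun i => if i = c then v 0 else v (i + 1)) id = θ.liftN :=
    Fm.subst_congr (fun i hi => by simp [show i ≠ c by omega]) (fun _ _ => rfl)
  have e2 : (χ.instN (v c)).subst (fun i => if i = c then v 0 else v (i + 1)) id = χ := by
    rw [Fm.instN, Fm.subst_subst]
    conv_rhs => rw [← Fm.subst_var χ]
    refine Fm.subst_congr (fun i hi => ?_) (fun _ _ => rfl)
    cases i with
    | zero => simp [Tm.subst]
    | succ i => simp [Tm.subst, show i ≠ c by omega]
  rw [Fm.subst, e1, e2] at h1
  exact mp (allN_intro _ _) (genN h1)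

theorem fresh_allS {θ χ : Fm} {c : ℕ} (hθ : θ.bdS ≤ c) (hχ : χ.bdS ≤ c)
    (h : Provable T (θ ⟹ χ.instS c)) : Provable T (θ ⟹ allS χ) := by
  have h1 := substS h (fun i => if i = c then 0 else i + 1)
  have e1 : θ.subst Tm.var (fun i => if i = c then 0 else i + 1) = θ.liftS :=
    Fm.subst_congr (fun _ _ => rfl) (fun i hi => by simp [show i ≠ c by omega])
  have e2 : (χ.instS c).subst Tm.var (fun i => if i = c then 0 else i + 1) = χ := by
    rw [Fm.instS, Fm.subst_subst]
    conv_rhs => rw [← Fm.subst_var χ]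
    refine Fm.subst_congr (fun _ _ => rfl) (fun i hi => ?_)
    cases i with
    | zero => simp
    | succ i => simp [show i ≠ c by omega]
  rw [Fm.subst, e1, e2] at h1
  exact mp (allS_intro _ _) (genS h1)

end Provable

/-! ### The completeness theorem -/

/-- An injective numbering of terms. -/
def Tm.code : Tm → ℕ
  | .var i => Nat.pair 0 i
  | .zero => Nat.pair 1 0
  | .one => Nat.pair 2 0
  | .add s t => Nat.pair 3 (Nat.pair s.code t.code)
  | .mul s t => Nat.pair 4 (Nat.pair s.code t.code)

/-- An injective numbering of formulas. -/
def Fm.code : Fm → ℕ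
  | .bot => Nat.pair 0 0
  | .eq s t => Nat.pair 1 (Nat.pair s.code t.code)
  | .lt s t => Nat.pair 2 (Nat.pair s.code t.code)
  | .mem t X => Nat.pair 3 (Nat.pair t.code X)
  | .imp φ ψ => Nat.pair 4 (Nat.pair φ.code ψ.code)
  | .allN φ => Nat.pair 5 φ.code
  | .allS φ => Nat.pair 6 φ.code

theorem Tm.code_inj : Function.Injective Tm.code := by
  intro s
  induction s <;> intro t h <;> cases t <;> simp_all [Tm.code, Nat.pair_eq_pair] <;> grind

theorem Fm.code_inj : Function.Injective Fm.code := by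
  intro s
  induction s <;> intro t h <;> cases t <;> simp_all [Fm.code, Nat.pair_eq_pair] <;>
    grind [Tm.code_inj.eq_iff]

/-- `θ` is consistent with the theory `T`. -/
def Cons (T : Set Fm) (θ : Fm) : Prop := ¬ Provable T (neg θ)

theorem Cons.conj_neg {θ ψ : Fm} (h : ¬ Provable T (θ ⟹ ψ)) : Cons T (θ ⋏ neg ψ) :=
  fun h' => h (Provable.byContra (Provable.curry h'))

/-- One step of the Henkin construction: decide `ψ`, and if a universal statement is refuted, choose
a fresh variable as a counterexample. -/
theorem Cons.step {θ : Fm} (h : Cons T θ) (ψ : Fm) : ∃ θ', Cons T θ' ∧ Provable T (θ' ⟹ θ) ∧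
    (Provable T (θ' ⟹ ψ) ∨ (Provable T (θ' ⟹ neg ψ) ∧
      (∀ χ, ψ = allN χ → ∃ t, Provable T (θ' ⟹ neg (χ.instN t))) ∧
      (∀ χ, ψ = allS χ → ∃ Y, Provable T (θ' ⟹ neg (χ.instS Y))))) := by
  by_cases hc : Cons T (θ ⋏ ψ)
  · exact ⟨_, hc, Provable.conjLeft _ _, .inl (Provable.conjRight _ _)⟩
  have hn : Provable T (θ ⟹ neg ψ) := Provable.curry (not_not.mp hc)
  have key : ∀ η, ¬ Provable T (θ ⟹ η) → Cons T (θ ⋏ neg η) ∧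
      Provable T (θ ⋏ neg η ⟹ θ) ∧ Provable T (θ ⋏ neg η ⟹ neg ψ) ∧
      Provable T (θ ⋏ neg η ⟹ neg η) := fun η hη =>
    ⟨Cons.conj_neg hη, Provable.conjLeft _ _, (Provable.conjLeft _ _).trans hn,
      Provable.conjRight _ _⟩
  have nall : ¬ Provable T (θ ⟹ ψ) := fun h' => h (Provable.app hn h')
  cases ψ with
  | allN χ =>
    obtain ⟨h1, h2, h3, h4⟩ := key (χ.instN (v (max θ.bdN χ.bdN))) fun h' =>
      nall (Provable.fresh_allN (le_max_left _ _) (le_max_right _ _) h')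
    exact ⟨_, h1, h2, .inr ⟨h3, fun _ e => by cases e; exact ⟨_, h4⟩, fun _ e => by cases e⟩⟩
  | allS χ =>
    obtain ⟨h1, h2, h3, h4⟩ := key (χ.instS (max θ.bdS χ.bdS)) fun h' =>
      nall (Provable.fresh_allS (le_max_left _ _) (le_max_right _ _) h')
    exact ⟨_, h1, h2, .inr ⟨h3, fun _ e => (by cases e), fun _ e => by cases e; exact ⟨_, h4⟩⟩⟩
  | _ => exact ⟨θ, h, Provable.refl _, .inr ⟨hn, fun _ e => (by cases e), fun _ e => by cases e⟩⟩

/-- A maximal consistent set with term witnesses for number quantifiers and variable witnesses for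
set quantifiers. -/
structure Henkin (T : Set Fm) (G : Set Fm) : Prop where
  thm : ∀ φ, Provable T φ → φ ∈ G
  mp : ∀ φ ψ, (φ ⟹ ψ) ∈ G → φ ∈ G → ψ ∈ G
  bot : Fm.bot ∉ G
  total : ∀ φ, φ ∈ G ∨ neg φ ∈ G
  allN : ∀ χ, (∀ t, χ.instN t ∈ G) → allN χ ∈ G
  allS : ∀ χ, (∀ Y, χ.instS Y ∈ G) → allS χ ∈ G

theorem exists_henkin {φ : Fm} (h : ¬ Provable T φ) : ∃ G, Henkin T G ∧ neg φ ∈ G := by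
  have h0 : Cons T (neg φ) := fun h' => h (Provable.mp (Provable.dne _) h')
  have : Nonempty Fm := ⟨Fm.bot⟩
  let enum : ℕ → Fm := Function.invFun Fm.code
  have henum : ∀ ψ, ∃ n, enum n = ψ := fun ψ => ⟨ψ.code, Function.leftInverse_invFun Fm.code_inj ψ⟩
  let stage : ℕ → {θ // Cons T θ} := fun n => Nat.rec ⟨neg φ, h0⟩
    (fun n θ => ⟨(θ.2.step (enum n)).choose, (θ.2.step (enum n)).choose_spec.1⟩) n
  have hs : ∀ n ψ, enum n = ψ → Provable T ((stage (n + 1)).1 ⟹ (stage n).1) ∧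
      (Provable T ((stage (n + 1)).1 ⟹ ψ) ∨ (Provable T ((stage (n + 1)).1 ⟹ neg ψ) ∧
      (∀ χ, ψ = allN χ → ∃ t, Provable T ((stage (n + 1)).1 ⟹ neg (χ.instN t))) ∧
      (∀ χ, ψ = allS χ → ∃ Y, Provable T ((stage (n + 1)).1 ⟹ neg (χ.instS Y))))) := by
    rintro n ψ rfl
    exact ((stage n).2.step (enum n)).choose_spec.2
  have mono : ∀ n m, n ≤ m → Provable T ((stage m).1 ⟹ (stage n).1) := by
    intro n m hnm
    induction m, hnm using Nat.le_induction with
    | base => exact Provable.refl _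
    | succ m _ ih => exact (hs m _ rfl).1.trans ih
  refine ⟨{ψ | ∃ n, Provable T ((stage n).1 ⟹ ψ)}, ?_, 0, Provable.refl _⟩
  have nbot : ¬ ∃ n, Provable T ((stage n).1 ⟹ Fm.bot) := fun ⟨n, hn⟩ => (stage n).2 hn
  have cmp : ∀ φ ψ, (∃ n, Provable T ((stage n).1 ⟹ φ ⟹ ψ)) → (∃ n, Provable T ((stage n).1 ⟹ φ)) →
      ∃ n, Provable T ((stage n).1 ⟹ ψ) := fun φ ψ ⟨n, hn⟩ ⟨m, hm⟩ => ⟨max n m,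
    Provable.app ((mono _ _ (le_max_left _ _)).trans hn) ((mono _ _ (le_max_right _ _)).trans hm)⟩
  refine ⟨fun ψ hψ => ⟨0, Provable.lift hψ⟩, cmp, nbot, fun ψ => ?_, fun χ hχ => ?_, fun χ hχ => ?_⟩
  · obtain ⟨n, rfl⟩ := henum ψ
    rcases (hs n _ rfl).2 with h1 | h1
    · exact .inl ⟨n + 1, h1⟩
    · exact .inr ⟨n + 1, h1.1⟩
  · obtain ⟨n, hn⟩ := henum (allN χ)
    rcases (hs n _ hn).2 with h1 | h1
    · exact ⟨n + 1, h1⟩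
    · obtain ⟨t, ht⟩ := h1.2.1 χ rfl
      exact absurd (cmp _ _ ⟨n + 1, ht⟩ (hχ t)) nbot
  · obtain ⟨n, hn⟩ := henum (allS χ)
    rcases (hs n _ hn).2 with h1 | h1
    · exact ⟨n + 1, h1⟩
    · obtain ⟨t, ht⟩ := h1.2.2 χ rfl
      exact absurd (cmp _ _ ⟨n + 1, ht⟩ (hχ t)) nbot

theorem Fm.instN_eq (φ : Fm) (t : Tm) : φ.instN t = φ.subst (econs t Tm.var) id := by
  rw [Fm.instN]; congr 1; funext i; cases i <;> rfl

theorem Tm.lift_inst (s t : Tm) : (s ⤒ 1).subst (econs t Tm.var) = s := by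
  rw [Tm.lift, Tm.subst_subst]; exact Tm.subst_var s

namespace Henkin

variable {G : Set Fm}

theorem imp_iff (hG : Henkin T G) {φ ψ : Fm} : (φ ⟹ ψ) ∈ G ↔ (φ ∈ G → ψ ∈ G) := by
  refine ⟨hG.mp _ _, fun h => ?_⟩
  rcases hG.total φ with h1 | h1
  · exact hG.mp _ _ (hG.thm _ (Provable.implyK _ _)) (h h1)
  · exact hG.mp _ _ (hG.thm _ (Provable.absurd _ (Provable.refl _))) h1

theorem allN_iff (hG : Henkin T G) {φ : Fm} : Fm.allN φ ∈ G ↔ ∀ t, φ.instN t ∈ G :=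
  ⟨fun h _ => hG.mp _ _ (hG.thm _ (Provable.allN_elim _ _)) h, hG.allN _⟩

theorem allS_iff (hG : Henkin T G) {φ : Fm} : Fm.allS φ ∈ G ↔ ∀ Y, φ.instS Y ∈ G :=
  ⟨fun h _ => hG.mp _ _ (hG.thm _ (Provable.allS_elim _ _)) h, hG.allS _⟩

theorem rewrite (hG : Henkin T G) (φ : Fm) {s t : Tm} (h : (s ≐ t) ∈ G) (h' : φ.instN s ∈ G) :
    φ.instN t ∈ G :=
  hG.mp _ _ (hG.mp _ _ (hG.thm _ (Provable.eq_subst φ s t)) h) h'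

theorem eq_refl (hG : Henkin T G) (t : Tm) : (t ≐ t) ∈ G := hG.thm _ (Provable.eq_refl t)

theorem eq_symm (hG : Henkin T G) {s t : Tm} (h : (s ≐ t) ∈ G) : (t ≐ s) ∈ G := by
  have := hG.rewrite (v 0 ≐ s ⤒ 1) h (by
    simpa [Fm.instN_eq, Fm.subst, Tm.subst, Tm.lift_inst] using hG.eq_refl s)
  simpa [Fm.instN_eq, Fm.subst, Tm.subst, Tm.lift_inst] using this

theorem eq_trans (hG : Henkin T G) {s t u : Tm} (h : (s ≐ t) ∈ G) (h' : (t ≐ u) ∈ G) :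
    (s ≐ u) ∈ G := by
  have := hG.rewrite (s ⤒ 1 ≐ v 0) h' (by
    simpa [Fm.instN_eq, Fm.subst, Tm.subst, Tm.lift_inst] using h)
  simpa [Fm.instN_eq, Fm.subst, Tm.subst, Tm.lift_inst] using this

/-- A binary operation on terms that is built from substitution respects provable equality. -/
theorem congr₂ (hG : Henkin T G) (op : Tm → Tm → Tm)
    (hop : ∀ s t σ, (op s t).subst σ = op (s.subst σ) (t.subst σ)) {s s' t t' : Tm}
    (h : (s ≐ s') ∈ G) (h' : (t ≐ t') ∈ G) : (op s t ≐ op s' t') ∈ G := by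
  have h1 := hG.rewrite ((op s t) ⤒ 1 ≐ op (v 0) (t ⤒ 1)) h (by
    simpa [Fm.instN_eq, Fm.subst, Tm.subst, Tm.lift_inst, hop] using hG.eq_refl (op s t))
  have h2 := hG.rewrite ((op s t) ⤒ 1 ≐ op (s' ⤒ 1) (v 0)) h' (by
    simpa [Fm.instN_eq, Fm.subst, Tm.subst, Tm.lift_inst, hop] using h1)
  simpa [Fm.instN_eq, Fm.subst, Tm.subst, Tm.lift_inst, hop] using h2

theorem lt_congr (hG : Henkin T G) {s s' t t' : Tm}
    (h : (s ≐ s') ∈ G) (h' : (t ≐ t') ∈ G) (hl : (s ≺ t) ∈ G) : (s' ≺ t') ∈ G := by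
  have h1 := hG.rewrite (v 0 ≺ t ⤒ 1) h (by
    simpa [Fm.instN_eq, Fm.subst, Tm.subst, Tm.lift_inst] using hl)
  have h2 := hG.rewrite (s' ⤒ 1 ≺ v 0) h' (by
    simpa [Fm.instN_eq, Fm.subst, Tm.subst, Tm.lift_inst] using h1)
  simpa [Fm.instN_eq, Fm.subst, Tm.subst, Tm.lift_inst] using h2

theorem mem_congr (hG : Henkin T G) {s s' : Tm} {X : ℕ}
    (h : (s ≐ s') ∈ G) (hl : Fm.mem s X ∈ G) : Fm.mem s' X ∈ G := by
  have h1 := hG.rewrite (Fm.mem (v 0) X) h (by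
    simpa [Fm.instN_eq, Fm.subst, Tm.subst] using hl)
  simpa [Fm.instN_eq, Fm.subst, Tm.subst] using h1

/-- Provable equality of terms. -/
def setoid (hG : Henkin T G) : Setoid Tm where
  r s t := (s ≐ t) ∈ G
  iseqv := ⟨hG.eq_refl, hG.eq_symm, hG.eq_trans⟩

/-- The term model: numbers are terms modulo provable equality, sets are set variables. -/
def model (hG : Henkin T G) : Str where
  N := Quotient hG.setoid
  S := ℕ
  zero := Quotient.mk _ Tm.zero
  one := Quotient.mk _ Tm.one
  add := Quotient.map₂ Tm.add fun _ _ h _ _ h' => hG.congr₂ Tm.add (fun _ _ _ => rfl) h h'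
  mul := Quotient.map₂ Tm.mul fun _ _ h _ _ h' => hG.congr₂ Tm.mul (fun _ _ _ => rfl) h h'
  lt := Quotient.lift₂ (fun s t => (s ≺ t) ∈ G) fun _ _ _ _ h h' => propext
    ⟨hG.lt_congr h h', hG.lt_congr (hG.eq_symm h) (hG.eq_symm h')⟩
  mem x X := Quotient.lift (fun s => Fm.mem s X ∈ G) (fun _ _ h => propext
    ⟨hG.mem_congr h, hG.mem_congr (hG.eq_symm h)⟩) x

theorem ev_model (hG : Henkin T G) (σ : ℕ → Tm) (t : Tm) :
    t.ev hG.model (fun i => Quotient.mk hG.setoid (σ i)) = Quotient.mk hG.setoid (t.subst σ) := by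
  induction t with
  | var i => rfl
  | zero => rfl
  | one => rfl
  | add s t h1 h2 => simp only [Tm.ev, h1, h2]; rfl
  | mul s t h1 h2 => simp only [Tm.ev, h1, h2]; rfl

/-- The truth lemma. -/
theorem truth (hG : Henkin T G) (φ : Fm) : ∀ (σ : ℕ → Tm) (ρ : ℕ → ℕ),
    φ.eval hG.model (fun i => Quotient.mk hG.setoid (σ i)) ρ ↔ φ.subst σ ρ ∈ G := by
  induction φ with
  | bot => exact fun _ _ => ⟨False.elim, hG.bot⟩
  | eq s t =>
    intro σ ρ
    simp only [Fm.eval, ev_model]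
    exact Quotient.eq (r := hG.setoid)
  | lt s t =>
    intro σ ρ
    simp only [Fm.eval, ev_model]
    exact Iff.rfl
  | mem t X =>
    intro σ ρ
    simp only [Fm.eval, ev_model]
    exact Iff.rfl
  | imp φ ψ h1 h2 => intro σ ρ; simp only [Fm.eval, Fm.subst, h1, h2, hG.imp_iff]
  | allN φ ih =>
    intro σ ρ
    have e : ∀ t, (fun i => Quotient.mk hG.setoid (econs t σ i)) =
        econs (Quotient.mk hG.setoid t) (fun i => Quotient.mk hG.setoid (σ i)) := fun t => by
      funext i; cases i <;> rfl
    simp only [Fm.eval, Fm.subst, hG.allN_iff, instN_upN, ← ih, e]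
    exact ⟨fun h _ => h _, fun h x => Quotient.inductionOn x h⟩
  | allS φ ih =>
    intro σ ρ
    simp only [Fm.eval, Fm.subst, hG.allS_iff, instS_upS, ← ih]
    exact Iff.rfl

end Henkin

theorem eval_allNs (M : Str) (k : ℕ) : ∀ (φ : Fm) (e : ℕ → M.N) (r : ℕ → M.S),
    (allN^[k] φ).eval M e r → ∀ e' : ℕ → M.N, (∀ i, e' (i + k) = e i) → φ.eval M e' r := by
  induction k with
  | zero => intro φ e r h e' he; rwa [show e' = e from funext he]
  | succ k ih =>
    intro φ e r h e' he
    have := ih (allN φ) e r h (fun i => e' (i + 1)) he (e' 0)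
    rwa [econs_eta] at this

theorem eval_allSs (M : Str) (k : ℕ) : ∀ (φ : Fm) (e : ℕ → M.N) (r : ℕ → M.S),
    (allS^[k] φ).eval M e r → ∀ r' : ℕ → M.S, (∀ i, r' (i + k) = r i) → φ.eval M e r' := by
  induction k with
  | zero => intro φ e r h e' he; rwa [show e' = r from funext he]
  | succ k ih =>
    intro φ e r h e' he
    have := ih (allS φ) e r h (fun i => e' (i + 1)) he (e' 0)
    rwa [econs_eta] at this

/-- Completeness: what holds in all models of the theory, under all assignments, is provable. -/
theorem Provable.complete {φ : Fm} (h : ∀ M : Str, (∀ ψ ∈ T, ∀ e r, ψ.eval M e r) →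
    ∀ e r, φ.eval M e r) : Provable T φ := by
  by_contra hn
  obtain ⟨G, hG, hφ⟩ := exists_henkin hn
  refine hG.bot (hG.mp _ _ hφ ?_)
  rw [← Fm.subst_var φ, ← hG.truth]
  refine h _ (fun ψ hψ e r => ?_) _ _
  -- the universal closure of an axiom is a theorem, hence true in the term model
  have h1 : (allN^[ψ.bdN] (allS^[ψ.bdS] ψ)) ∈ G := hG.thm _ (genNs (genSs (.ax hψ) _) _)
  rw [← Fm.subst_var (allN^[ψ.bdN] (allS^[ψ.bdS] ψ)), ← hG.truth] at h1
  have h2 := eval_allNs _ _ _ _ _ h1 (fun i => if i < ψ.bdN then e i else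
    Quotient.mk hG.setoid (Tm.var (i - ψ.bdN))) (fun i => by simp; rfl)
  have h3 := eval_allSs _ _ _ _ _ h2 (fun i => if i < ψ.bdS then r i else i - ψ.bdS)
    (fun i => by simp; rfl)
  exact (Fm.eval_congr _ ψ (fun i hi => by simp [hi]) (fun i hi => by simp [hi])).1 h3

end Calculus

/-! ### Models of `RCA₀` -/

namespace Str

variable {M : Str}

instance : Zero M.N := ⟨M.zero⟩
instance : One M.N := ⟨M.one⟩
instance : Add M.N := ⟨M.add⟩
instance : Mul M.N := ⟨M.mul⟩
instance : LT M.N := ⟨M.lt⟩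
instance : LE M.N := ⟨fun a b => a < b ∨ a = b⟩

end Str

section Eval

variable {M : Str} (e : ℕ → M.N) (r : ℕ → M.S)

@[simp] theorem ev_var (i : ℕ) : (v i).ev M e = e i := rfl
@[simp] theorem ev_zero : (0 : Tm).ev M e = 0 := rfl
@[simp] theorem ev_one : (1 : Tm).ev M e = 1 := rfl
@[simp] theorem ev_add (s t : Tm) : (s + t).ev M e = s.ev M e + t.ev M e := rfl
@[simp] theorem ev_mul (s t : Tm) : (s * t).ev M e = s.ev M e * t.ev M e := rfl
theorem ev_lift (t : Tm) (k : ℕ) : (t ⤒ k).ev M e = t.ev M (fun i => e (i + k)) :=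
  Tm.ev_subst M e _ t
@[simp] theorem ev_lift_one (t : Tm) (a : M.N) : (t ⤒ 1).ev M (econs a e) = t.ev M e :=
  ev_lift _ t 1
@[simp] theorem ev_lift_two (t : Tm) (a b : M.N) :
    (t ⤒ 2).ev M (econs a (econs b e)) = t.ev M e := ev_lift _ t 2
@[simp] theorem ev_lift_three (t : Tm) (a b c : M.N) :
    (t ⤒ 3).ev M (econs a (econs b (econs c e))) = t.ev M e := ev_lift _ t 3
@[simp] theorem ev_lift_four (t : Tm) (a b c d : M.N) :
    (t ⤒ 4).ev M (econs a (econs b (econs c (econs d e)))) = t.ev M e := ev_lift _ t 4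
@[simp] theorem ev_lift_five (t : Tm) (a b c d f : M.N) :
    (t ⤒ 5).ev M (econs a (econs b (econs c (econs d (econs f e))))) = t.ev M e := ev_lift _ t 5

@[simp] theorem eval_bot : Fm.bot.eval M e r ↔ False := Iff.rfl
@[simp] theorem eval_eq (s t : Tm) : (s ≐ t).eval M e r ↔ s.ev M e = t.ev M e := Iff.rfl
@[simp] theorem eval_lt (s t : Tm) : (s ≺ t).eval M e r ↔ s.ev M e < t.ev M e := Iff.rfl
@[simp] theorem eval_mem (t : Tm) (X : ℕ) :
    (Fm.mem t X).eval M e r ↔ M.mem (t.ev M e) (r X) := Iff.rfl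
@[simp] theorem eval_imp (φ ψ : Fm) :
    (φ ⟹ ψ).eval M e r ↔ (φ.eval M e r → ψ.eval M e r) := Iff.rfl
@[simp] theorem eval_allN (φ : Fm) :
    (allN φ).eval M e r ↔ ∀ x, φ.eval M (econs x e) r := Iff.rfl
@[simp] theorem eval_allS (φ : Fm) :
    (allS φ).eval M e r ↔ ∀ X, φ.eval M e (econs X r) := Iff.rfl
@[simp] theorem eval_neg (φ : Fm) : (neg φ).eval M e r ↔ ¬ φ.eval M e r := Iff.rfl
@[simp] theorem eval_conj (φ ψ : Fm) :
    (φ ⋏ ψ).eval M e r ↔ (φ.eval M e r ∧ ψ.eval M e r) := by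
  simp [conj]
@[simp] theorem eval_disj (φ ψ : Fm) :
    (φ ⋎ ψ).eval M e r ↔ (φ.eval M e r ∨ ψ.eval M e r) := by
  simp [disj, or_iff_not_imp_left]
@[simp] theorem eval_bicond (φ ψ : Fm) :
    (φ ⟺ ψ).eval M e r ↔ (φ.eval M e r ↔ ψ.eval M e r) := by
  simp [bicond, iff_def]
@[simp] theorem eval_exN (φ : Fm) : (exN φ).eval M e r ↔ ∃ x, φ.eval M (econs x e) r := by
  simp [exN]
@[simp] theorem eval_exS (φ : Fm) : (exS φ).eval M e r ↔ ∃ X, φ.eval M e (econs X r) := by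
  simp [exS]
@[simp] theorem eval_ball (t : Tm) (φ : Fm) :
    (ball t φ).eval M e r ↔ ∀ x < t.ev M e, φ.eval M (econs x e) r := by
  simp [ball]

end Eval

/-- `M` is a model of `RCA₀`. -/
class IsRCA (M : Str) : Prop where
  ax : ∀ ψ ∈ RCA0, ∀ e r, ψ.eval M e r
  /-- a structure that admits an assignment has a set -/
  ne : Nonempty M.S

section Algebra

variable {M : Str} [hM : IsRCA M]

theorem IsRCA.pa (ψ : Fm) (x y z : M.N) (h : ψ ∈ PAminus := by
      simp only [PAminus, Set.mem_insert_iff, Set.mem_singleton_iff, true_or, or_true]) :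
    ψ.eval M (econs x (econs y (econs z fun _ => 0))) (fun _ => hM.ne.some) :=
  hM.ax ψ (.inl (.inl h)) _ _

namespace Str

noncomputable instance : CommSemiring M.N where
  add_assoc a b c := by simpa using hM.pa ((v 0 + v 1) + v 2 ≐ v 0 + (v 1 + v 2)) a b c
  zero_add a := by
    have h1 := hM.pa (v 0 + 0 ≐ v 0) a 0 0
    have h2 := hM.pa (v 0 + v 1 ≐ v 1 + v 0) a 0 0
    simp at h1 h2
    rw [← h2, h1]
  add_zero a := by simpa using hM.pa (v 0 + 0 ≐ v 0) a 0 0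
  add_comm a b := by simpa using hM.pa (v 0 + v 1 ≐ v 1 + v 0) a b 0
  mul_assoc a b c := by simpa using hM.pa ((v 0 * v 1) * v 2 ≐ v 0 * (v 1 * v 2)) a b c
  mul_comm a b := by simpa using hM.pa (v 0 * v 1 ≐ v 1 * v 0) a b 0
  one_mul a := by
    have h1 := hM.pa (v 0 * 1 ≐ v 0) a 0 0
    have h2 := hM.pa (v 0 * v 1 ≐ v 1 * v 0) a 1 0
    simp at h1 h2
    rw [← h2, h1]
  mul_one a := by simpa using hM.pa (v 0 * 1 ≐ v 0) a 0 0
  left_distrib a b c := by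
    simpa using hM.pa (v 0 * (v 1 + v 2) ≐ v 0 * v 1 + v 0 * v 2) a b c
  right_distrib a b c := by
    have h1 := hM.pa (v 0 * (v 1 + v 2) ≐ v 0 * v 1 + v 0 * v 2) c a b
    have h2 := fun x y => hM.pa (v 0 * v 1 ≐ v 1 * v 0) x y 0
    simp at h1 h2
    rw [h2 (a + b) c, h1, h2 c a, h2 c b]
  zero_mul a := by
    have h1 := hM.pa (v 0 * 0 ≐ 0) a 0 0
    have h2 := hM.pa (v 0 * v 1 ≐ v 1 * v 0) a 0 0
    simp at h1 h2
    rw [← h2, h1]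
  mul_zero a := by simpa using hM.pa (v 0 * 0 ≐ 0) a 0 0
  nsmul := nsmulRec

theorem lt_trans' {a b c : M.N} : a < b → b < c → a < c := by
  have h := hM.pa ((v 0 ≺ v 1 ⋏ v 1 ≺ v 2) ⟹ v 0 ≺ v 2) a b c
  simpa using h

theorem lt_irrefl' (a : M.N) : ¬ a < a := by
  simpa using hM.pa (neg (v 0 ≺ v 0)) a 0 0

theorem lt_tri (a b : M.N) : a < b ∨ a = b ∨ b < a := by
  simpa using hM.pa (v 0 ≺ v 1 ⋎ v 0 ≐ v 1 ⋎ v 1 ≺ v 0) a b 0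

noncomputable instance : LinearOrder M.N where
  le_refl a := .inr rfl
  le_trans a b c := by
    rintro (h | rfl) (h' | rfl)
    · exact .inl (lt_trans' h h')
    · exact .inl h
    · exact .inl h'
    · exact .inr rfl
  lt_iff_le_not_ge a b := by
    constructor
    · intro h
      refine ⟨.inl h, ?_⟩
      rintro (h' | rfl)
      · exact lt_irrefl' _ (lt_trans' h h')
      · exact lt_irrefl' _ h
    · rintro ⟨h | rfl, h'⟩
      · exact h
      · exact absurd (.inr rfl) h'
  le_antisymm a b := by
    rintro (h | rfl) (h' | h')
    · exact absurd (lt_trans' h h') (lt_irrefl' _)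
    · exact h'.symm
    · rfl
    · rfl
  le_total a b := by
    rcases lt_tri a b with h | rfl | h
    · exact .inl (.inl h)
    · exact .inl (.inr rfl)
    · exact .inr (.inl h)
  toDecidableLE := Classical.decRel _

theorem zero_or_pos (a : M.N) : 0 = a ∨ 0 < a := by
  simpa using hM.pa (0 ≐ v 0 ⋎ 0 ≺ v 0) a 0 0

theorem add_lt' {a b : M.N} (c : M.N) (h : a < b) : a + c < b + c := by
  have h' := hM.pa (v 0 ≺ v 1 ⟹ v 0 + v 2 ≺ v 1 + v 2) a b c
  simp at h'; exact h' h

theorem mul_lt' {a b c : M.N} (hc : 0 < c) (h : a < b) : a * c < b * c := by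
  have h' := hM.pa ((0 ≺ v 2 ⋏ v 0 ≺ v 1) ⟹ v 0 * v 2 ≺ v 1 * v 2) a b c
  simp at h'; exact h' hc h

instance : IsStrictOrderedRing M.N where
  add_le_add_left a b h c := by
    rcases h with h | rfl
    · exact .inl (add_lt' _ h)
    · exact le_rfl
  le_of_add_le_add_left a b c h := by
    by_contra hn
    have := add_lt' a (not_le.1 hn)
    rw [add_comm c, add_comm b] at this
    exact absurd h (not_le.2 this)
  zero_le_one := by
    have h := hM.pa (0 ≺ 1) 0 0 0
    simp at h; exact .inl h
  exists_pair_ne := by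
    have h := hM.pa (0 ≺ 1) 0 0 0
    simp at h; exact ⟨0, 1, ne_of_lt h⟩
  mul_lt_mul_of_pos_left a ha b c h := by
    show a * b < a * c
    rw [mul_comm a b, mul_comm a c]; exact mul_lt' ha h
  mul_lt_mul_of_pos_right a ha b c h := mul_lt' ha h

instance : CanonicallyOrderedAdd M.N where
  exists_add_of_le {a b} h := by
    rcases h with h | rfl
    · have h' := hM.pa (v 0 ≺ v 1 ⟹ exN (v 1 + v 0 ≐ v 2)) a b 0
      simp at h'
      obtain ⟨c, hc⟩ := h' h
      exact ⟨c, hc.symm⟩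
    · exact ⟨0, (add_zero _).symm⟩
  le_self_add a b := by
    rcases zero_or_pos b with rfl | h
    · rw [add_zero]
    · have := add_lt' a h
      rw [zero_add, add_comm] at this; exact this.le
  le_add_self a b := by
    rcases zero_or_pos b with rfl | h
    · rw [zero_add]
    · have := add_lt' a h
      rw [zero_add] at this; exact this.le

theorem one_le_of_pos {a : M.N} (h : 0 < a) : 1 ≤ a := by
  have h' := hM.pa (0 ≺ v 0 ⟹ (1 ≐ v 0 ⋎ 1 ≺ v 0)) a 0 0
  simp at h'
  rcases h' h with h | h
  · exact h.le
  · exact h.le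

theorem lt_succ {a b : M.N} : a < b + 1 ↔ a ≤ b := by
  constructor
  · intro h
    by_contra hn
    obtain ⟨c, rfl⟩ := exists_add_of_le (not_le.1 hn).le
    have hc : 0 < c := by
      rcases zero_or_pos c with rfl | h
      · simp at hn
      · exact h
    have := one_le_of_pos hc
    exact absurd h (not_lt.2 (by gcongr))
  · intro h
    calc a ≤ b := h
      _ = b + 0 := (add_zero b).symm
      _ < b + 1 := by gcongr; exact zero_lt_one

theorem succ_le {a b : M.N} : a + 1 ≤ b ↔ a < b := by
  rw [← not_lt, lt_succ, not_le]

end Str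
end Algebra

/-! ### Definable predicates -/

section Definability

variable {M : Str}

/-- Functions of an assignment given by a term with number parameters. -/
inductive TmDef : ((ℕ → M.N) → M.N) → Prop
  | var (i) : TmDef fun e => e i
  | const (c) : TmDef fun _ => c
  | add {s t} : TmDef s → TmDef t → TmDef fun e => s e + t e
  | mul {s t} : TmDef s → TmDef t → TmDef fun e => s e * t e

/-- Predicates of an assignment given by a bounded formula with number and set parameters. -/
inductive Bd : ((ℕ → M.N) → Prop) → Prop
  | bot : Bd fun _ => False
  | eq {s t} : TmDef s → TmDef t → Bd fun e => s e = t e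
  | lt {s t} : TmDef s → TmDef t → Bd fun e => s e < t e
  | mem {t} (X) : TmDef t → Bd fun e => M.mem (t e) X
  | imp {P Q} : Bd P → Bd Q → Bd fun e => P e → Q e
  | ball {t P} : TmDef t → Bd P → Bd fun e => ∀ x < t e, P (econs x e)

/-- Interleave two assignments: the variables proper at even places, the parameters at odd ones. -/
def mix {α : Type} (e p : ℕ → α) (i : ℕ) : α := if i % 2 = 0 then e (i / 2) else p (i / 2)

theorem mix_even {α : Type} (e p : ℕ → α) (i : ℕ) : mix e p (2 * i) = e i := by
  simp [mix]

theorem mix_odd {α : Type} (e p : ℕ → α) (i : ℕ) : mix e p (2 * i + 1) = p i := by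
  simp [mix, Nat.add_mod]; congr 1; omega

theorem mix_econs {α : Type} (x : α) (e p : ℕ → α) : mix (econs x e) p = econs x (mix p e) := by
  funext i
  rcases Nat.even_or_odd' i with ⟨k, rfl | rfl⟩
  · rw [mix_even]
    cases k with
    | zero => rfl
    | succ k => exact (mix_odd p e k).symm
  · rw [mix_odd]; exact (mix_even _ _ _).symm

/-- Exchange even and odd places. -/
def swp (i : ℕ) : ℕ := if i % 2 = 0 then i + 1 else i - 1

theorem mix_swp {α : Type} (e p : ℕ → α) (i : ℕ) : mix e p (swp i) = mix p e i := by
  rcases Nat.even_or_odd' i with ⟨k, rfl | rfl⟩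
  · rw [mix_even, swp, if_pos (by omega), mix_odd]
  · rw [mix_odd, swp, if_neg (by omega)]; exact mix_even _ _ _

theorem IsBounded.subst {φ : Fm} (h : IsBounded φ) :
    ∀ (σ : ℕ → Tm) (ρ : ℕ → ℕ), IsBounded (φ.subst σ ρ) := by
  induction h with
  | bot => exact fun _ _ => .bot
  | eq s t => exact fun _ _ => .eq _ _
  | lt s t => exact fun _ _ => .lt _ _
  | mem t X => exact fun _ _ => .mem _ _
  | imp _ _ h1 h2 => exact fun _ _ => .imp (h1 _ _) (h2 _ _)
  | ball t _ ih =>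
    intro σ ρ
    have := IsBounded.ball (t.subst σ) (ih (upN σ) ρ)
    convert this using 1
    simp only [SOA.ball, Fm.subst, Tm.lift, Tm.subst_subst]
    rfl

/-- Two formulas are brought to a common parameter list by interleaving their lists: this renaming
moves the first parameter list to the even places of the common one. -/
def mergeL (i : ℕ) : ℕ := if i % 2 = 0 then i else 2 * (2 * (i / 2)) + 1
/-- The renaming that moves the second parameter list to the odd places of the common one. -/
def mergeR (i : ℕ) : ℕ := if i % 2 = 0 then i else 2 * (2 * (i / 2) + 1) + 1

theorem mix_mergeL {α : Type} (e p q : ℕ → α) (i : ℕ) : mix e (mix p q) (mergeL i) = mix e p i := by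
  unfold mergeL
  split_ifs with hi
  · simp [mix, hi]
  · rw [mix_odd, mix_even]; simp [mix, hi]

theorem mix_mergeR {α : Type} (e p q : ℕ → α) (i : ℕ) : mix e (mix p q) (mergeR i) = mix e q i := by
  unfold mergeR
  split_ifs with hi
  · simp [mix, hi]
  · rw [mix_odd, mix_odd]; simp [mix, hi]

theorem ev_mergeL (τ : Tm) (e p q : ℕ → M.N) :
    (τ.subst fun i => v (mergeL i)).ev M (mix e (mix p q)) = τ.ev M (mix e p) := by
  simp [Tm.ev_subst, mix_mergeL]

theorem ev_mergeR (τ : Tm) (e p q : ℕ → M.N) :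
    (τ.subst fun i => v (mergeR i)).ev M (mix e (mix p q)) = τ.ev M (mix e q) := by
  simp [Tm.ev_subst, mix_mergeR]

theorem eval_mergeL (φ : Fm) (e p q : ℕ → M.N) (r s : ℕ → M.S) :
    (φ.subst (fun i => v (mergeL i)) (fun X => 2 * X)).eval M (mix e (mix p q)) (mix r s) ↔
      φ.eval M (mix e p) r := by
  simp [Fm.eval_subst, mix_mergeL, mix_even]

theorem eval_mergeR (φ : Fm) (e p q : ℕ → M.N) (r s : ℕ → M.S) :
    (φ.subst (fun i => v (mergeR i)) (fun X => 2 * X + 1)).eval M (mix e (mix p q)) (mix r s) ↔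
      φ.eval M (mix e q) s := by
  simp [Fm.eval_subst, mix_mergeR, mix_odd]

theorem TmDef.rep {t : (ℕ → M.N) → M.N} (h : TmDef t) :
    ∃ (τ : Tm) (p : ℕ → M.N), ∀ e, τ.ev M (mix e p) = t e := by
  induction h with
  | var i => exact ⟨v (2 * i), fun _ => 0, fun e => mix_even _ _ _⟩
  | const c => exact ⟨v 1, fun _ => c, fun e => mix_odd e (fun _ => c) 0⟩
  | add _ _ h1 h2 =>
    obtain ⟨τ, p, h⟩ := h1
    obtain ⟨τ', p', h'⟩ := h2
    exact ⟨(τ.subst fun i => v (mergeL i)) + (τ'.subst fun i => v (mergeR i)),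
      mix p p', fun e => by rw [ev_add, ev_mergeL τ, ev_mergeR τ', h, h']⟩
  | mul _ _ h1 h2 =>
    obtain ⟨τ, p, h⟩ := h1
    obtain ⟨τ', p', h'⟩ := h2
    exact ⟨(τ.subst fun i => v (mergeL i)) * (τ'.subst fun i => v (mergeR i)),
      mix p p', fun e => by rw [ev_mul, ev_mergeL τ, ev_mergeR τ', h, h']⟩

/-- In `mix (econs x e) p` the places of `e` and `p` are exchanged relative to `mix e p`, so that a
formula needs a renaming before its variable `0` can be quantified. -/
theorem eval_swp (φ : Fm) (x : M.N) (e p : ℕ → M.N) (r : ℕ → M.S) :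
    (φ.subst (upN fun i => v (swp i)) id).eval M (econs x (mix e p)) r ↔
      φ.eval M (mix (econs x e) p) r := by
  rw [Fm.eval_subst, mix_econs]
  have : (fun i => Tm.ev M (econs x (mix e p)) (upN (fun i => v (swp i)) i)) =
      econs x (mix p e) := by
    funext i
    cases i with
    | zero => rfl
    | succ i => simp [upN, mix_swp]
  rw [this]; rfl

theorem Bd.rep [Nonempty M.S] {P : (ℕ → M.N) → Prop} (h : Bd P) :
    ∃ φ : Fm, IsBounded φ ∧ ∃ p r, ∀ e, φ.eval M (mix e p) r ↔ P e := by
  induction h with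
  | bot => exact ⟨Fm.bot, .bot, fun _ => 0, fun _ => Classical.arbitrary _, fun e => Iff.rfl⟩
  | eq hs ht =>
    obtain ⟨τ, p, h⟩ := hs.rep
    obtain ⟨τ', p', h'⟩ := ht.rep
    exact ⟨(τ.subst fun i => v (mergeL i)) ≐ (τ'.subst fun i => v (mergeR i)),
      .eq _ _, mix p p', fun _ => Classical.arbitrary _, fun e => by
      rw [eval_eq, ev_mergeL τ, ev_mergeR τ', h, h']⟩
  | lt hs ht =>
    obtain ⟨τ, p, h⟩ := hs.rep
    obtain ⟨τ', p', h'⟩ := ht.rep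
    exact ⟨(τ.subst fun i => v (mergeL i)) ≺ (τ'.subst fun i => v (mergeR i)),
      .lt _ _, mix p p', fun _ => Classical.arbitrary _, fun e => by
      rw [eval_lt, ev_mergeL τ, ev_mergeR τ', h, h']⟩
  | mem X ht =>
    obtain ⟨τ, p, h⟩ := ht.rep
    exact ⟨Fm.mem τ 0, .mem _ _, p, fun _ => X, fun e => by rw [eval_mem, h]⟩
  | imp _ _ h1 h2 =>
    obtain ⟨φ, hφ, p, r, h⟩ := h1
    obtain ⟨ψ, hψ, q, s, h'⟩ := h2
    exact ⟨_ ⟹ _, .imp (hφ.subst _ _) (hψ.subst _ _), mix p q, mix r s, fun e => by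
      rw [eval_imp, eval_mergeL φ, eval_mergeR ψ, h, h']⟩
  | ball ht _ h2 =>
    obtain ⟨τ, p, h⟩ := ht.rep
    obtain ⟨ψ, hψ, q, s, h'⟩ := h2
    refine ⟨SOA.ball (τ.subst fun i => v (mergeL i))
      ((ψ.subst (fun i => v (mergeR i)) id).subst (upN fun i => v (swp i)) id),
      .ball _ ((hψ.subst _ _).subst _ _), mix p q, s, fun e => ?_⟩
    rw [eval_ball, ev_mergeL, h]
    refine forall₂_congr fun x _ => ?_
    rw [eval_swp, Fm.eval_subst]
    simp only [ev_var, mix_mergeR]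
    exact h' _

theorem TmDef.subst {t : (ℕ → M.N) → M.N} (h : TmDef t) {σ : ℕ → (ℕ → M.N) → M.N}
    (hσ : ∀ i, TmDef (σ i)) : TmDef fun e => t (fun i => σ i e) := by
  induction h with
  | var i => exact hσ i
  | const c => exact .const c
  | add _ _ h1 h2 => exact .add h1 h2
  | mul _ _ h1 h2 => exact .mul h1 h2

theorem TmDef.shift {t : (ℕ → M.N) → M.N} (h : TmDef t) : TmDef fun e => t (fun i => e (i + 1)) :=
  h.subst fun i => .var (i + 1)

theorem Bd.subst {P : (ℕ → M.N) → Prop} (h : Bd P) : ∀ {σ : ℕ → (ℕ → M.N) → M.N},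
    (∀ i, TmDef (σ i)) → Bd fun e => P (fun i => σ i e) := by
  induction h with
  | bot => exact fun _ => .bot
  | eq hs ht => exact fun h => .eq (hs.subst h) (ht.subst h)
  | lt hs ht => exact fun h => .lt (hs.subst h) (ht.subst h)
  | mem X ht => exact fun h => .mem X (ht.subst h)
  | imp _ _ h1 h2 => exact fun h => .imp (h1 h) (h2 h)
  | @ball t P ht _ h2 =>
    intro σ h
    have h3 := Bd.ball (ht.subst h) (h2 (σ := econs (fun e => e 0)
      fun i e => σ i (fun j => e (j + 1))) (fun i => by
        cases i with
        | zero => exact .var 0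
        | succ i => exact (h i).shift))
    convert h3 using 6 with e x hx i
    cases i <;> rfl

theorem Bd.not {P : (ℕ → M.N) → Prop} (h : Bd P) : Bd fun e => ¬ P e := h.imp .bot

theorem Bd.and {P Q : (ℕ → M.N) → Prop} (h : Bd P) (h' : Bd Q) : Bd fun e => P e ∧ Q e := by
  have := (h.imp h'.not).not
  simpa using this

theorem Bd.bex {t : (ℕ → M.N) → M.N} {P : (ℕ → M.N) → Prop} (ht : TmDef t) (h : Bd P) :
    Bd fun e => ∃ x < t e, P (econs x e) := by
  have := (Bd.ball ht h.not).not
  simpa using this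

/-- A predicate of assignments is `Σ⁰₁` in the model, with number and set parameters. This and the
three notions below are classes, so that definability is established by instance search. -/
class Sig (P : (ℕ → M.N) → Prop) : Prop where
  witness : ∃ Q, Bd Q ∧ ∀ e, P e ↔ ∃ x, Q (econs x e)

/-- A predicate is `Π⁰₁`. -/
class PiD (P : (ℕ → M.N) → Prop) : Prop where
  sig : Sig fun e => ¬ P e

/-- A predicate is `Δ⁰₁`. -/
class Del (P : (ℕ → M.N) → Prop) : Prop where
  sig : Sig P
  pi : PiD P

/-- A function of an assignment has a `Σ⁰₁` (hence `Δ⁰₁`) graph. -/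
class Fn (t : (ℕ → M.N) → M.N) : Prop where
  sig : Sig fun e => e 0 = t (fun i => e (i + 1))

theorem Sig.subst {P : (ℕ → M.N) → Prop} (h : Sig P) {σ : ℕ → (ℕ → M.N) → M.N}
    (hσ : ∀ i, TmDef (σ i)) : Sig fun e => P (fun i => σ i e) := by
  obtain ⟨Q, hQ, hP⟩ := h
  refine ⟨_, hQ.subst (σ := econs (fun e => e 0) fun i e => σ i (fun j => e (j + 1))) (fun i => by
        cases i with
        | zero => exact .var 0
        | succ i => exact (hσ i).shift), fun e => ?_⟩
  rw [hP]
  refine exists_congr fun x => ?_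
  have : (fun i => econs (fun e : ℕ → M.N => e 0) (fun i e => σ i (fun j => e (j + 1))) i
    (econs x e)) = econs x fun i => σ i e := by
    funext i; cases i <;> rfl
  rw [this]

/-- Two `Σ⁰₁` predicates are given by formulas with a common list of parameters, as is needed for
the two formulas in an instance of `Δ⁰₁` comprehension. -/
theorem Sig.rep2 [Nonempty M.S] {P P' : (ℕ → M.N) → Prop} (h : Sig P) (h' : Sig P') :
    ∃ φ φ' : Fm, IsBounded φ ∧ IsBounded φ' ∧ ∃ p r, ∀ e,
      ((exN φ).eval M (mix e p) r ↔ P e) ∧ ((exN φ').eval M (mix e p) r ↔ P' e) := by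
  obtain ⟨Q, hQ, hP⟩ := h
  obtain ⟨Q', hQ', hP'⟩ := h'
  obtain ⟨φ, hφ, p, r, h⟩ := hQ.rep
  obtain ⟨φ', hφ', p', r', h'⟩ := hQ'.rep
  refine ⟨_, _,
    (hφ.subst (fun i => v (mergeL i)) (fun X => 2 * X)).subst (upN fun i => v (swp i)) id,
    (hφ'.subst (fun i => v (mergeR i)) (fun X => 2 * X + 1)).subst (upN fun i => v (swp i)) id,
    mix p p', mix r r', fun e => ⟨?_, ?_⟩⟩
  · simp only [eval_exN, eval_swp, eval_mergeL, h, hP]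
  · simp only [eval_exN, eval_swp, eval_mergeR, h', hP']

/-! ### Induction and comprehension for definable predicates -/

theorem inductionAx_eval {φ : Fm} (e : ℕ → M.N) (r : ℕ → M.S) :
    (inductionAx φ).eval M e r ↔ (φ.eval M (econs 0 e) r →
      (∀ x, φ.eval M (econs x e) r → φ.eval M (econs (x + 1) e) r) →
      ∀ x, φ.eval M (econs x e) r) := by
  have h1 : ∀ t : Tm, (fun i => Tm.ev M e (Nat.casesOn i t Tm.var : Tm)) = econs (t.ev M e) e :=
    fun t => by funext i; cases i <;> rfl
  have h2 : ∀ x, (fun i => Tm.ev M (econs x e) (Nat.casesOn i (v 0 + 1) fun j => v (j + 1) : Tm)) =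
      econs (x + 1) e := fun x => by funext i; cases i <;> rfl
  simp only [inductionAx, eval_imp, eval_conj, eval_allN, Fm.instN, Fm.eval_subst, h1, h2, and_imp]
  rfl

variable [hM : IsRCA M]

theorem sig_induction {P : M.N → Prop} (hP : Sig fun e => P (e 0)) (h0 : P 0)
    (h : ∀ x, P x → P (x + 1)) (x : M.N) : P x := by
  have := hM.ne
  obtain ⟨φ, _, hφ, _, p, r, hr⟩ := hP.rep2 hP
  have h1 := hM.ax _ (.inl (.inr ⟨exN φ, ⟨φ, hφ, rfl⟩, rfl⟩)) (mix p fun _ => 0) r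
  rw [inductionAx_eval] at h1
  simp only [← mix_econs, (hr _).1, econs_zero] at h1
  exact h1 h0 h x

theorem del_comprehension {P : M.N → Prop} (hP : Del fun e => P (e 0)) :
    ∃ X, ∀ x, M.mem x X ↔ P x := by
  have := hM.ne
  obtain ⟨φ, ψ, hφ, hψ, p, r, hr⟩ := hP.sig.rep2 hP.pi.sig
  have h1 := hM.ax _ (.inr ⟨exN φ, allN (neg ψ), ⟨φ, hφ, rfl⟩, ⟨_, hψ.imp .bot, rfl⟩, rfl⟩)
    (mix p fun _ => 0) r
  have h2 := fun x => (hr (econs x fun _ => 0)).2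
  simp only [econs_zero, eval_exN, ← mix_econs] at h2
  simp only [eval_imp, eval_allN, eval_bicond, eval_exS, Fm.liftS, Fm.eval_subst,
    eval_mem, econs_succ, eval_neg, ev_var, econs_zero] at h1
  simp only [← mix_econs, (hr _).1, econs_zero] at h1
  refine h1 fun x => ?_
  rw [← not_exists, h2, not_not]

end Definability

/-! ### Closure properties of definable predicates -/

section Closure

variable {M : Str}

theorem Bd.del {P : (ℕ → M.N) → Prop} (h : Bd P) : Del P := by
  have key : ∀ {P : (ℕ → M.N) → Prop}, Bd P → Sig P := fun {P} h =>
    ⟨_, h.subst (σ := fun i e => e (i + 1)) fun i => .var _, fun e => by simp⟩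
  exact ⟨key h, ⟨key h.not⟩⟩

theorem Sig.congr {P Q : (ℕ → M.N) → Prop} (h : Sig P) (hPQ : ∀ e, Q e ↔ P e) : Sig Q := by
  rwa [show Q = P from funext fun e => propext (hPQ e)]

instance (priority := low) Del.toSig {P : (ℕ → M.N) → Prop} [h : Del P] : Sig P := h.sig
instance (priority := low) Del.toPi {P : (ℕ → M.N) → Prop} [h : Del P] : PiD P := h.pi

theorem TmDef.cons {t : (ℕ → M.N) → M.N} (ht : TmDef t) {σ : ℕ → (ℕ → M.N) → M.N}
    (h : ∀ i, TmDef (σ i)) (i : ℕ) : TmDef (econs t σ i) := by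
  cases i with
  | zero => exact ht
  | succ i => exact h i

theorem econs_apply {α β : Type} (f : (α → β)) (g : ℕ → α → β) (a : α) :
    (fun i => econs f g i a) = econs (f a) (fun i => g i a) := by
  funext i; cases i <;> rfl

variable [hM : IsRCA M]

instance Sig.ex {P : M.N → (ℕ → M.N) → Prop} [h : Sig fun e => P (e 0) (fun i => e (i + 1))] :
    Sig fun e => ∃ x, P x e := by
  obtain ⟨Q, hQ, h⟩ := h
  have h1 := hQ.subst (σ := econs (fun e => e 0) (econs (fun e => e 1) (fun i e => e (i + 3))))
    (TmDef.cons (.var 0) (TmDef.cons (.var 1) fun i => .var _))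
  refine ⟨_, Bd.bex (.var 0) (Bd.bex (.var 1) h1), fun e => ?_⟩
  simp only [econs_apply, econs_zero, econs_succ]
  constructor
  · rintro ⟨x, hx⟩
    obtain ⟨y, hy⟩ := (h (econs x e)).1 hx
    exact ⟨x + y + 1, x, Str.lt_succ.2 le_self_add, y, Str.lt_succ.2 le_add_self, hy⟩
  · rintro ⟨z, x, -, y, -, hy⟩
    exact ⟨x, (h (econs x e)).2 ⟨y, hy⟩⟩

instance Sig.and {P Q : (ℕ → M.N) → Prop} [h : Sig P] [h' : Sig Q] : Sig fun e => P e ∧ Q e := by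
  obtain ⟨R, hR, h⟩ := h
  obtain ⟨R', hR', h'⟩ := h'
  have h1 := hR.subst (σ := econs (fun e => e 0) (fun i e => e (i + 2)))
    (TmDef.cons (.var 0) fun i => .var _)
  have h2 := hR'.subst (σ := econs (fun e => e 0) (fun i e => e (i + 2)))
    (TmDef.cons (.var 0) fun i => .var _)
  refine ⟨_, (Bd.bex (.var 0) h1).and (Bd.bex (.var 0) h2), fun e => ?_⟩
  simp only [econs_apply, econs_zero, econs_succ]
  rw [h, h']
  constructor
  · rintro ⟨⟨x, hx⟩, y, hy⟩
    exact ⟨x + y + 1, ⟨x, Str.lt_succ.2 le_self_add, hx⟩, y, Str.lt_succ.2 le_add_self, hy⟩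
  · rintro ⟨z, ⟨x, -, hx⟩, y, -, hy⟩
    exact ⟨⟨x, hx⟩, y, hy⟩

instance Sig.or {P Q : (ℕ → M.N) → Prop} [h : Sig P] [h' : Sig Q] : Sig fun e => P e ∨ Q e := by
  obtain ⟨R, hR, h⟩ := h
  obtain ⟨R', hR', h'⟩ := h'
  refine ⟨_, (hR.not.and hR'.not).not, fun e => ?_⟩
  rw [h, h', ← exists_or]
  refine exists_congr fun x => ?_
  tauto

/-- `Σ⁰₁` predicates are closed under bounded universal quantification; this is where `Σ⁰₁`
induction enters, in the form of `Σ⁰₁` collection. -/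
theorem Sig.ball_var {P : M.N → (ℕ → M.N) → Prop}
    (h : Sig fun e => P (e 0) (fun i => e (i + 1))) :
    Sig fun e => ∀ x < e 0, P x (fun i => e (i + 1)) := by
  obtain ⟨Q, hQ, h⟩ := h
  have h1 := hQ.subst (σ := econs (fun e => e 0) (econs (fun e => e 1) (fun i e => e (i + 4))))
    (TmDef.cons (.var 0) (TmDef.cons (.var 1) fun i => .var _))
  refine ⟨_, Bd.ball (.var 1) (Bd.bex (.var 1) h1), fun e => ?_⟩
  simp only [econs_apply, econs_zero, econs_succ]
  constructor
  · intro he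
    have hc : Sig fun c : ℕ → M.N => ∃ z, ∀ x < c 0, ∃ y < z,
        e 0 ≤ x ∨ Q (econs y (econs x fun i => e (i + 1))) := by
      have h2 := hQ.subst (σ := econs (fun e => e 0) (econs (fun e => e 1) (fun i _ => e (i + 1))))
        (TmDef.cons (.var 0) (TmDef.cons (.var 1) fun i => .const _))
      refine ⟨_, Bd.ball (.var 1) (Bd.bex (.var 1) ((Bd.lt (.var 1) (.const (e 0))).imp h2)),
        fun c => ?_⟩
      simp only [econs_apply, econs_zero,
        show ∀ x (e : ℕ → M.N), econs x e 1 = e 0 from fun _ _ => rfl, ← not_lt, ← imp_iff_not_or]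
    have := sig_induction (P := fun c => ∃ z, ∀ x < c, ∃ y < z,
      e 0 ≤ x ∨ Q (econs y (econs x fun i => e (i + 1)))) hc
      ⟨0, fun x hx => absurd hx (not_lt.2 zero_le)⟩ ?_ (e 0)
    · obtain ⟨z, hz⟩ := this
      refine ⟨z, fun x hx => ?_⟩
      obtain ⟨y, hy, hy'⟩ := hz x hx
      exact ⟨y, hy, hy'.resolve_left (not_le.2 hx)⟩
    · rintro c ⟨z, hz⟩
      by_cases hce : c < e 0
      · obtain ⟨y, hy⟩ := (h (econs c fun i => e (i + 1))).1 (he c hce)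
        refine ⟨z + y + 1, fun x hx => ?_⟩
        rcases (Str.lt_succ.1 hx).lt_or_eq with hx | rfl
        · obtain ⟨y', hy', hQ'⟩ := hz x hx
          exact ⟨y', hy'.trans_le (le_self_add.trans le_self_add), hQ'⟩
        · exact ⟨y, Str.lt_succ.2 le_add_self, .inr hy⟩
      · refine ⟨z + 1, fun x hx => ?_⟩
        rcases (Str.lt_succ.1 hx).lt_or_eq with hx | rfl
        · obtain ⟨y', hy', hQ'⟩ := hz x hx
          exact ⟨y', hy'.trans_le le_self_add, hQ'⟩
        · exact ⟨z, Str.lt_succ.2 le_rfl, .inl (not_lt.1 hce)⟩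
  · rintro ⟨z, hz⟩ x hx
    obtain ⟨y, -, hy⟩ := hz x hx
    exact (h (econs x fun i => e (i + 1))).2 ⟨y, hy⟩

/-- Substitution of a definable function `t`, by `P (t e) ↔ ∃ x, x = t e ∧ P x`. -/
theorem Sig.comp {P : M.N → (ℕ → M.N) → Prop} {t : (ℕ → M.N) → M.N} (ht : Fn t)
    (h : Sig fun e => P (e 0) (fun i => e (i + 1))) : Sig fun e => P (t e) e := by
  have h1 := ht.sig
  have : Sig fun e => ∃ x, x = t e ∧ P x e := inferInstance
  exact this.congr fun e => by simp

theorem Fn.subst {t : (ℕ → M.N) → M.N} (h : Fn t) {σ : ℕ → (ℕ → M.N) → M.N}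
    (hσ : ∀ i, TmDef (σ i)) : Fn fun e => t (fun i => σ i e) := by
  have := h.sig.subst (σ := econs (fun e => e 0) fun i e => σ i fun j => e (j + 1))
    (TmDef.cons (.var 0) fun i => (hσ i).shift)
  exact ⟨this⟩

theorem Fn.shift {t : (ℕ → M.N) → M.N} (h : Fn t) : Fn fun e => t (fun i => e (i + 1)) :=
  h.subst fun _ => .var _

theorem TmDef.fn {t : (ℕ → M.N) → M.N} (h : TmDef t) : Fn t :=
  ⟨(Bd.eq (.var 0) h.shift).del.sig⟩

instance Fn.var (i : ℕ) : Fn fun e : ℕ → M.N => e i := (TmDef.var i).fn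
instance Fn.const (c : M.N) : Fn fun _ : ℕ → M.N => c := (TmDef.const c).fn

theorem Sig.comp₂ {R : M.N → M.N → Prop} {s t : (ℕ → M.N) → M.N} (hs : Fn s) (ht : Fn t)
    (h : Sig fun e => R (e 0) (e 1)) : Sig fun e => R (s e) (t e) := by
  refine Sig.comp (P := fun x e => R x (t e)) hs ?_
  refine Sig.comp (P := fun x e => R (e 0) x) ht.shift ?_
  exact h.subst (σ := econs (fun e => e 1) fun i e => e 0) (TmDef.cons (.var _) fun _ => .var _)

theorem Sig.comp₃ {R : M.N → M.N → M.N → Prop} {s t u : (ℕ → M.N) → M.N} (hs : Fn s) (ht : Fn t)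
    (hu : Fn u) (h : Sig fun e => R (e 0) (e 1) (e 2)) : Sig fun e => R (s e) (t e) (u e) := by
  refine Sig.comp (P := fun x e => R x (t e) (u e)) hs ?_
  refine Sig.comp (P := fun x e => R (e 0) x (u fun i => e (i + 1))) ht.shift ?_
  refine Sig.comp (P := fun x e => R (e 1) (e 0) x) hu.shift.shift ?_
  exact h.subst (σ := econs (fun e => e 2) (econs (fun e => e 1) fun i e => e 0))
    (TmDef.cons (.var _) (TmDef.cons (.var _) fun _ => .var _))

theorem Sig.comp₄ {R : M.N → M.N → M.N → M.N → Prop} {s t u w : (ℕ → M.N) → M.N} (hs : Fn s)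
    (ht : Fn t) (hu : Fn u) (hw : Fn w) (h : Sig fun e => R (e 0) (e 1) (e 2) (e 3)) :
    Sig fun e => R (s e) (t e) (u e) (w e) := by
  refine Sig.comp (P := fun x e => R x (t e) (u e) (w e)) hs ?_
  refine Sig.comp (P := fun x e => R (e 0) x (u fun i => e (i + 1)) (w fun i => e (i + 1)))
    ht.shift ?_
  refine Sig.comp (P := fun x e => R (e 1) (e 0) x (w fun i => e (i + 2))) hu.shift.shift ?_
  refine Sig.comp (P := fun x e => R (e 2) (e 1) (e 0) x) hw.shift.shift.shift ?_
  exact h.subst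
    (σ := econs (fun e => e 3) (econs (fun e => e 2) (econs (fun e => e 1) fun i e => e 0)))
    (TmDef.cons (.var _) (TmDef.cons (.var _) (TmDef.cons (.var _) fun _ => .var _)))

theorem Del.comp₁ {R : M.N → Prop} {s : (ℕ → M.N) → M.N} (hs : Fn s)
    (h : Del fun e => R (e 0)) : Del fun e => R (s e) :=
  ⟨Sig.comp₂ (R := fun x _ => R x) hs hs h.sig,
    ⟨Sig.comp₂ (R := fun x _ => ¬ R x) hs hs h.pi.sig⟩⟩

theorem Del.comp₂ {R : M.N → M.N → Prop} {s t : (ℕ → M.N) → M.N} (hs : Fn s) (ht : Fn t)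
    (h : Del fun e => R (e 0) (e 1)) : Del fun e => R (s e) (t e) :=
  ⟨Sig.comp₂ hs ht h.sig, ⟨Sig.comp₂ (R := fun x y => ¬ R x y) hs ht h.pi.sig⟩⟩

theorem Del.comp₃ {R : M.N → M.N → M.N → Prop} {s t u : (ℕ → M.N) → M.N} (hs : Fn s) (ht : Fn t)
    (hu : Fn u) (h : Del fun e => R (e 0) (e 1) (e 2)) : Del fun e => R (s e) (t e) (u e) :=
  ⟨Sig.comp₃ hs ht hu h.sig, ⟨Sig.comp₃ (R := fun x y z => ¬ R x y z) hs ht hu h.pi.sig⟩⟩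

theorem Fn.comp₁ {G : M.N → M.N} {s : (ℕ → M.N) → M.N} (hs : Fn s)
    (h : Fn fun e => G (e 0)) : Fn fun e => G (s e) :=
  ⟨Sig.comp₂ (R := fun z x => z = G x) (Fn.var 0) hs.shift h.sig⟩

theorem Fn.comp₂ {G : M.N → M.N → M.N} {s t : (ℕ → M.N) → M.N} (hs : Fn s) (ht : Fn t)
    (h : Fn fun e => G (e 0) (e 1)) : Fn fun e => G (s e) (t e) :=
  ⟨Sig.comp₃ (R := fun z x y => z = G x y) (Fn.var 0) hs.shift ht.shift h.sig⟩

theorem Fn.comp₃ {G : M.N → M.N → M.N → M.N} {s t u : (ℕ → M.N) → M.N} (hs : Fn s) (ht : Fn t)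
    (hu : Fn u) (h : Fn fun e => G (e 0) (e 1) (e 2)) : Fn fun e => G (s e) (t e) (u e) :=
  ⟨Sig.comp₄ (R := fun z x y w => z = G x y w) (Fn.var 0) hs.shift ht.shift hu.shift h.sig⟩

instance Fn.add {s t : (ℕ → M.N) → M.N} [hs : Fn s] [ht : Fn t] : Fn fun e => s e + t e :=
  Fn.comp₂ hs ht (TmDef.add (.var 0) (.var 1)).fn

instance Fn.mul {s t : (ℕ → M.N) → M.N} [hs : Fn s] [ht : Fn t] : Fn fun e => s e * t e :=
  Fn.comp₂ hs ht (TmDef.mul (.var 0) (.var 1)).fn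

instance Del.lt {s t : (ℕ → M.N) → M.N} [hs : Fn s] [ht : Fn t] : Del fun e => s e < t e :=
  Del.comp₂ hs ht (Bd.lt (.var 0) (.var 1)).del

instance Del.eq {s t : (ℕ → M.N) → M.N} [hs : Fn s] [ht : Fn t] : Del fun e => s e = t e :=
  Del.comp₂ hs ht (Bd.eq (.var 0) (.var 1)).del

instance Del.mem {s : (ℕ → M.N) → M.N} [hs : Fn s] {X : M.S} : Del fun e => M.mem (s e) X :=
  Del.comp₁ (R := fun x => M.mem x X) hs (Bd.mem X (.var 0)).del

instance Sig.not {P : (ℕ → M.N) → Prop} [h : PiD P] : Sig fun e => ¬ P e := h.sig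

instance PiD.not {P : (ℕ → M.N) → Prop} [h : Sig P] : PiD fun e => ¬ P e :=
  ⟨h.congr fun _ => not_not⟩

instance Del.not {P : (ℕ → M.N) → Prop} [h : Del P] : Del fun e => ¬ P e :=
  ⟨inferInstance, inferInstance⟩

instance Sig.imp {P Q : (ℕ → M.N) → Prop} [h : PiD P] [h' : Sig Q] : Sig fun e => P e → Q e := by
  have : Sig fun e => ¬ P e ∨ Q e := inferInstance
  simpa only [← imp_iff_not_or] using this

instance PiD.imp {P Q : (ℕ → M.N) → Prop} [h : Sig P] [h' : PiD Q] : PiD fun e => P e → Q e := by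
  have : Sig fun e => P e ∧ ¬ Q e := inferInstance
  exact ⟨this.congr fun e => Classical.not_imp⟩

instance PiD.and {P Q : (ℕ → M.N) → Prop} [h : PiD P] [h' : PiD Q] : PiD fun e => P e ∧ Q e := by
  have : Sig fun e => ¬ P e ∨ ¬ Q e := inferInstance
  exact ⟨this.congr fun e => Classical.not_and_iff_not_or_not⟩

instance PiD.or {P Q : (ℕ → M.N) → Prop} [h : PiD P] [h' : PiD Q] : PiD fun e => P e ∨ Q e := by
  have : Sig fun e => ¬ P e ∧ ¬ Q e := inferInstance
  exact ⟨this.congr fun e => not_or⟩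

instance PiD.all {P : M.N → (ℕ → M.N) → Prop} [h : PiD fun e => P (e 0) (fun i => e (i + 1))] :
    PiD fun e => ∀ x, P x e := by
  have := h.sig
  have : Sig fun e => ∃ x, ¬ P x e := inferInstance
  exact ⟨this.congr fun e => not_forall⟩

instance Sig.ball {P : M.N → (ℕ → M.N) → Prop} {t : (ℕ → M.N) → M.N} [ht : Fn t]
    [h : Sig fun e => P (e 0) (fun i => e (i + 1))] : Sig fun e => ∀ x < t e, P x e :=
  Sig.comp (P := fun b e => ∀ x < b, P x e) ht (Sig.ball_var h)

instance Sig.bex {P : M.N → (ℕ → M.N) → Prop} {t : (ℕ → M.N) → M.N} [ht : Fn t]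
    [h : Sig fun e => P (e 0) (fun i => e (i + 1))] : Sig fun e => ∃ x < t e, P x e :=
  Sig.comp (P := fun b e => ∃ x < b, P x e) ht (by
    have : Sig fun e : ℕ → M.N => P (e 0) (fun i => e (i + 2)) :=
      h.subst (σ := econs (fun e => e 0) fun i e => e (i + 2)) (TmDef.cons (.var 0) fun _ => .var _)
    infer_instance)

instance PiD.ball {P : M.N → (ℕ → M.N) → Prop} {t : (ℕ → M.N) → M.N} [ht : Fn t]
    [h : PiD fun e => P (e 0) (fun i => e (i + 1))] : PiD fun e => ∀ x < t e, P x e := by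
  have := h.sig
  have : Sig fun e => ∃ x < t e, ¬ P x e := inferInstance
  exact ⟨this.congr fun e => by simp⟩

instance PiD.bex {P : M.N → (ℕ → M.N) → Prop} {t : (ℕ → M.N) → M.N} [ht : Fn t]
    [h : PiD fun e => P (e 0) (fun i => e (i + 1))] : PiD fun e => ∃ x < t e, P x e := by
  have := h.sig
  have : Sig fun e => ∀ x < t e, ¬ P x e := inferInstance
  exact ⟨this.congr fun e => by simp⟩

instance Del.imp {P Q : (ℕ → M.N) → Prop} [h : Del P] [h' : Del Q] : Del fun e => P e → Q e :=
  ⟨inferInstance, inferInstance⟩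
instance Del.and {P Q : (ℕ → M.N) → Prop} [h : Del P] [h' : Del Q] : Del fun e => P e ∧ Q e :=
  ⟨inferInstance, inferInstance⟩
instance Del.or {P Q : (ℕ → M.N) → Prop} [h : Del P] [h' : Del Q] : Del fun e => P e ∨ Q e :=
  ⟨inferInstance, inferInstance⟩
instance Del.ball {P : M.N → (ℕ → M.N) → Prop} {t : (ℕ → M.N) → M.N} [ht : Fn t]
    [h : Del fun e => P (e 0) (fun i => e (i + 1))] : Del fun e => ∀ x < t e, P x e :=
  ⟨inferInstance, inferInstance⟩
instance Del.bex {P : M.N → (ℕ → M.N) → Prop} {t : (ℕ → M.N) → M.N} [ht : Fn t]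
    [h : Del fun e => P (e 0) (fun i => e (i + 1))] : Del fun e => ∃ x < t e, P x e :=
  ⟨inferInstance, inferInstance⟩

theorem Fn.of_graph {R : M.N → (ℕ → M.N) → Prop} {t : (ℕ → M.N) → M.N}
    [h : Sig fun e => R (e 0) (fun i => e (i + 1))] (hR : ∀ e x, x = t e ↔ R x e) : Fn t :=
  ⟨h.congr fun _ => hR _ _⟩

/-! ### Induction and least elements -/

theorem pi_induction {P : M.N → Prop} (hP : PiD fun e => P (e 0)) (h0 : P 0)
    (h : ∀ x, P x → P (x + 1)) (a : M.N) : P a := by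
  by_contra ha
  have h1 := hP.sig.subst (σ := econs (fun e => e 0) fun _ e => e 0)
    (TmDef.cons (.var 0) fun _ => .var 0)
  have h2 : Sig fun e : ℕ → M.N => ¬ P (e 0) := h1
  -- descend from `a`
  have key : ∀ y, y ≤ a → ∃ x, x + y = a ∧ ¬ P x := by
    refine sig_induction (P := fun y => y ≤ a → ∃ x, x + y = a ∧ ¬ P x) ?_ ?_ ?_
    · have h3 : Sig fun e : ℕ → M.N => ¬ P (e 0) := h1
      infer_instance
    · exact fun _ => ⟨a, add_zero a, ha⟩
    · intro y ih hy
      obtain ⟨x, hx, hPx⟩ := ih (le_self_add.trans hy)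
      rcases Str.zero_or_pos x with rfl | hx0
      · rw [zero_add] at hx; subst hx
        exact absurd (Str.succ_le.1 hy) (lt_irrefl _)
      · obtain ⟨z, rfl⟩ := exists_add_of_le (Str.one_le_of_pos hx0)
        exact ⟨z, by rw [← hx]; ring, fun hz => hPx (by rw [add_comm]; exact h z hz)⟩
  obtain ⟨x, hx, hPx⟩ := key a le_rfl
  have : x = 0 := by simpa using hx
  exact hPx (this ▸ h0)

theorem exists_least {P : M.N → Prop} (hP : PiD fun e => P (e 0)) {a : M.N} (ha : P a) :
    ∃ x, P x ∧ ∀ y < x, ¬ P y := by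
  by_contra hn
  push Not at hn
  have h1 := hP.sig
  have key : ∀ x, ∀ y < x, ¬ P y := by
    refine sig_induction (P := fun x => ∀ y < x, ¬ P y) ?_ (fun y hy => absurd hy (by simp)) ?_
    · infer_instance
    · intro x ih y hy hPy
      rcases (Str.lt_succ.1 hy).lt_or_eq with hy | rfl
      · exact ih y hy hPy
      · obtain ⟨z, hz, hPz⟩ := hn y hPy
        exact ih z hz hPz
  exact key (a + 1) a (Str.lt_succ.2 le_rfl) ha

/-- `Δ⁰₁` choice: a total `Σ⁰₁` relation is uniformized by a function with `Σ⁰₁` graph. -/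
theorem exists_fn {C : M.N → M.N → Prop} (hC : Sig fun e => C (e 0) (e 1)) (h : ∀ p, ∃ y, C p y) :
    ∃ G : M.N → M.N, Fn (fun e => G (e 0)) ∧ ∀ p, C p (G p) := by
  obtain ⟨Q, hQ, hCQ⟩ := hC
  let D : M.N → M.N → M.N → Prop := fun u p y => Q (econs u (econs p (econs y fun _ => 0)))
  have hD : ∀ p y, C p y ↔ ∃ u, D u p y := fun p y => hCQ (econs p (econs y fun _ => 0))
  have hdel : Del fun e => D (e 0) (e 1) (e 2) := by
    have := hQ.subst (σ := econs (fun e => e 0) (econs (fun e => e 1) (econs (fun e => e 2)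
      fun _ _ => 0))) (TmDef.cons (.var 0) (TmDef.cons (.var 1) (TmDef.cons (.var 2)
        fun _ => .const 0)))
    simp only [econs_apply] at this
    exact this.del
  have hD' : ∀ s t u : (ℕ → M.N) → M.N, [Fn s] → [Fn t] → [Fn u] → Del fun e =>
    D (s e) (t e) (u e) := fun s t u hs ht hu => Del.comp₃ hs ht hu hdel
  have h1 : ∀ p, ∃ z, (∃ y < z, ∃ u < z, D u p y) ∧ ∀ z' < z, ¬ ∃ y < z', ∃ u < z', D u p y := by
    intro p
    obtain ⟨y, hy⟩ := h p
    obtain ⟨u, hu⟩ := (hD p y).1 hy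
    refine exists_least (P := fun z => ∃ y < z, ∃ u < z, D u p y) inferInstance (a := y + u + 1)
      ⟨y, Str.lt_succ.2 le_self_add, u, Str.lt_succ.2 le_add_self, hu⟩
  choose Z hZ hZ' using h1
  have h2 : ∀ p, ∃ y, (∃ u < Z p, D u p y) ∧ ∀ y' < y, ¬ ∃ u < Z p, D u p y' := by
    intro p
    obtain ⟨y, hy, hu⟩ := hZ p
    exact exists_least (P := fun y => ∃ u < Z p, D u p y) inferInstance hu
  choose Y hY hY' using h2
  refine ⟨Y, ?_, fun p => (hD _ _).2 ?_⟩
  · refine Fn.of_graph (R := fun y e => ∃ z, ((∃ y < z, ∃ u < z, D u (e 0) y) ∧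
      (∀ z' < z, ¬ ∃ y < z', ∃ u < z', D u (e 0) y)) ∧ (∃ u < z, D u (e 0) y) ∧
      ∀ y' < y, ¬ ∃ u < z, D u (e 0) y') fun e y => ?_
    constructor
    · rintro rfl
      exact ⟨Z (e 0), ⟨hZ _, hZ' _⟩, hY _, hY' _⟩
    · rintro ⟨z, ⟨hz, hz'⟩, hy, hy'⟩
      have : z = Z (e 0) := by
        rcases lt_trichotomy z (Z (e 0)) with h | h | h
        · exact absurd hz (hZ' _ _ h)
        · exact h
        · exact absurd (hZ _) (hz' _ h)
      subst this
      rcases lt_trichotomy y (Y (e 0)) with h | h | h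
      · exact absurd hy (hY' _ _ h)
      · exact h
      · exact absurd (hY _) (hy' _ h)
  · obtain ⟨u, -, hu⟩ := hY p
    exact ⟨u, hu⟩

end Closure

/-! ### Pairs and remainders -/

section Arithmetic

variable {M : Str} [hM : IsRCA M]

/-- The pairing function of the formal language. -/
def pr (a b : M.N) : M.N := (a + b) * (a + b) + a

theorem pr_def (a b : M.N) : pr a b = (a + b) * (a + b) + a := rfl

theorem le_mul_self' (a : M.N) : a ≤ a * a := by
  rcases Str.zero_or_pos a with rfl | h
  · simp
  · exact le_mul_of_one_le_left zero_le (Str.one_le_of_pos h)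

theorem add_le_pr (a b : M.N) : a + b ≤ pr a b := (le_mul_self' _).trans le_self_add
theorem left_le_pr (a b : M.N) : a ≤ pr a b := le_self_add.trans (add_le_pr a b)
theorem right_le_pr (a b : M.N) : b ≤ pr a b := le_add_self.trans (add_le_pr a b)

theorem pr_lt {a b a' b' : M.N} (h : a + b < a' + b') : pr a b < pr a' b' := by
  obtain ⟨c, hc⟩ := exists_add_of_le (Str.succ_le.2 h)
  rw [pr_def, pr_def, hc]
  have h1 : (a + b) * (a + b) + a < (a + b + 1) * (a + b + 1) := by
    have : (a + b + 1) * (a + b + 1) = (a + b) * (a + b) + a + (a + b + b + 1) := by ring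
    rw [this]
    exact lt_add_of_pos_right _ (by positivity)
  refine h1.trans_le (le_trans ?_ le_self_add)
  exact mul_le_mul' le_self_add le_self_add

theorem pr_inj {a b a' b' : M.N} : pr a b = pr a' b' ↔ a = a' ∧ b = b' := by
  constructor
  · intro h
    rcases lt_trichotomy (a + b) (a' + b') with h1 | h1 | h1
    · exact absurd h (pr_lt h1).ne
    · rw [pr_def, pr_def, h1] at h
      have h2 := add_left_cancel h
      subst h2
      exact ⟨rfl, add_left_cancel h1⟩
    · exact absurd h (pr_lt h1).ne'
  · rintro ⟨rfl, rfl⟩; rfl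

instance Fn.pr {s t : (ℕ → M.N) → M.N} [hs : Fn s] [ht : Fn t] : Fn fun e => pr (s e) (t e) := by
  unfold SOA.pr; infer_instance

/-- `z` is a pair. -/
def IsPair (z : M.N) : Prop := ∃ a b, z = pr a b

theorem isPair_iff (z : M.N) : IsPair z ↔ ∃ a < z + 1, ∃ b < z + 1, z = pr a b := by
  constructor
  · rintro ⟨a, b, rfl⟩
    exact ⟨a, Str.lt_succ.2 (left_le_pr _ _), b, Str.lt_succ.2 (right_le_pr _ _), rfl⟩
  · rintro ⟨a, -, b, -, h⟩
    exact ⟨a, b, h⟩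

instance Del.isPair {s : (ℕ → M.N) → M.N} [hs : Fn s] : Del fun e => IsPair (s e) :=
  Del.comp₁ hs (by simp only [isPair_iff]; infer_instance)

open Classical in
/-- The first component of a pair, and `0` for numbers that are not pairs. -/
noncomputable def fs (z : M.N) : M.N := if h : IsPair z then h.choose else 0

open Classical in
/-- The second component of a pair, and `0` for numbers that are not pairs. -/
noncomputable def sn (z : M.N) : M.N := if h : IsPair z then h.choose_spec.choose else 0

theorem IsPair.eq {z : M.N} (h : IsPair z) : z = pr (fs z) (sn z) := by
  rw [fs, dif_pos h, sn, dif_pos h]; exact h.choose_spec.choose_spec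

theorem isPair_pr (a b : M.N) : IsPair (pr a b) := ⟨a, b, rfl⟩

@[simp] theorem fs_pr (a b : M.N) : fs (pr a b) = a := (pr_inj.1 (isPair_pr a b).eq).1.symm
@[simp] theorem sn_pr (a b : M.N) : sn (pr a b) = b := (pr_inj.1 (isPair_pr a b).eq).2.symm

theorem fs_fn : Fn fun e : ℕ → M.N => fs (e 0) := by
  refine Fn.of_graph (R := fun x e => (∃ b, e 0 = pr x b) ∨ (¬ IsPair (e 0) ∧ x = 0)) fun e x => ?_
  by_cases h : IsPair (e 0)
  · simp only [h, not_true, false_and, or_false]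
    obtain ⟨a, b, h⟩ := h
    simp [h, pr_inj, eq_comm]
  · have : ¬ ∃ b, e 0 = pr x b := fun ⟨b, hb⟩ => h ⟨_, _, hb⟩
    simp [h, this, fs]

theorem sn_fn : Fn fun e : ℕ → M.N => sn (e 0) := by
  refine Fn.of_graph (R := fun x e => (∃ b, e 0 = pr b x) ∨ (¬ IsPair (e 0) ∧ x = 0)) fun e x => ?_
  by_cases h : IsPair (e 0)
  · simp only [h, not_true, false_and, or_false]
    obtain ⟨a, b, h⟩ := h
    simp [h, pr_inj, eq_comm]
  · have : ¬ ∃ b, e 0 = pr b x := fun ⟨b, hb⟩ => h ⟨_, _, hb⟩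
    simp [h, this, sn]

instance Fn.fs {s : (ℕ → M.N) → M.N} [hs : Fn s] : Fn fun e => fs (s e) := Fn.comp₁ hs fs_fn
instance Fn.sn {s : (ℕ → M.N) → M.N} [hs : Fn s] : Fn fun e => sn (s e) := Fn.comp₁ hs sn_fn

theorem fs_le (z : M.N) : fs z ≤ z := by
  by_cases h : IsPair z
  · conv_rhs => rw [h.eq]
    exact left_le_pr _ _
  · simp [SOA.fs, h]

theorem exists_rem {m : M.N} (hm : 0 < m) (c : M.N) : ∃ q r, c = q * m + r ∧ r < m := by
  refine sig_induction (P := fun c => ∃ q r, c = q * m + r ∧ r < m) inferInstance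
    ⟨0, 0, by simp, hm⟩ ?_ c
  rintro c ⟨q, r, rfl, hr⟩
  rcases (Str.succ_le.2 hr).lt_or_eq with h | h
  · exact ⟨q, r + 1, by ring, h⟩
  · exact ⟨q + 1, 0, by rw [add_assoc, h]; ring, hm⟩

theorem rem_unique {m q r q' r' : M.N} (h : q * m + r = q' * m + r') (hr : r < m) (hr' : r' < m) :
    r = r' := by
  have key : ∀ {q r q' r' : M.N}, q * m + r = q' * m + r' → r < m → ¬ q < q' := by
    intro q r q' r' h hr hq
    obtain ⟨k, rfl⟩ := exists_add_of_le (Str.succ_le.2 hq)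
    have : r = m + (k * m + r') := by
      apply add_left_cancel (a := q * m); rw [h]; ring
    exact absurd hr (not_lt.2 (this ▸ le_self_add))
  have : q = q' := le_antisymm (not_lt.1 (key h.symm hr')) (not_lt.1 (key h hr))
  subst this
  exact add_left_cancel h

/-- The modulus for the place `i` in Gödel's function. -/
def md (d i : M.N) : M.N := 1 + (i + 1) * d

theorem md_pos (d i : M.N) : 0 < md d i := by
  unfold md; exact lt_of_lt_of_le zero_lt_one le_self_add

instance Fn.md {s t : (ℕ → M.N) → M.N} [hs : Fn s] [ht : Fn t] : Fn fun e => md (s e) (t e) := by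
  unfold SOA.md; infer_instance

/-- Gödel's function: the remainder of `c` modulo `1 + (i + 1) d`. -/
noncomputable def bet (c d i : M.N) : M.N := (exists_rem (md_pos d i) c).choose_spec.choose

theorem bet_iff {c d i x : M.N} : x = bet c d i ↔ ∃ q, c = q * md d i + x ∧ x < md d i := by
  have h := (exists_rem (md_pos d i) c).choose_spec.choose_spec
  constructor
  · rintro rfl; exact ⟨_, h⟩
  · rintro ⟨q, hq, hx⟩
    exact rem_unique (hq.symm.trans h.1) hx h.2

instance Fn.bet {s t u : (ℕ → M.N) → M.N} [hs : Fn s] [ht : Fn t] [hu : Fn u] :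
    Fn fun e => bet (s e) (t e) (u e) :=
  Fn.comp₃ hs ht hu (Fn.of_graph (R := fun x e => ∃ q, e 0 = q * SOA.md (e 1) (e 2) + x ∧
    x < SOA.md (e 1) (e 2)) fun _ _ => bet_iff)

/-! ### Congruences and the sequence lemma -/

/-- Congruence modulo `m`, without subtraction. -/
def Cg (m a b : M.N) : Prop := ∃ u w, a + u * m = b + w * m

theorem Cg.refl (m a : M.N) : Cg m a a := ⟨0, 0, rfl⟩
theorem Cg.symm {m a b : M.N} : Cg m a b → Cg m b a := fun ⟨u, w, h⟩ => ⟨w, u, h.symm⟩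
theorem Cg.trans {m a b c : M.N} : Cg m a b → Cg m b c → Cg m a c := fun ⟨u, w, h⟩ ⟨u', w', h'⟩ =>
  ⟨u + u', w + w', by grind⟩
theorem Cg.add {m a b c d : M.N} : Cg m a b → Cg m c d → Cg m (a + c) (b + d) :=
  fun ⟨u, w, h⟩ ⟨u', w', h'⟩ => ⟨u + u', w + w', by grind⟩
theorem Cg.mul_left {m a b : M.N} (c : M.N) : Cg m a b → Cg m (c * a) (c * b) :=
  fun ⟨u, w, h⟩ => ⟨c * u, c * w, by grind⟩
theorem Cg.mul {m a b c d : M.N} (h : Cg m a b) (h' : Cg m c d) : Cg m (a * c) (b * d) :=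
  (h'.mul_left a).trans (by rw [mul_comm a, mul_comm b]; exact h.mul_left d)
theorem Cg.cancel {m a b c : M.N} : Cg m (a + c) (b + c) → Cg m a b := fun ⟨u, w, h⟩ =>
  ⟨u, w, by grind⟩
theorem Cg.of_eq {m a b : M.N} (h : a = b) : Cg m a b := h ▸ Cg.refl _ _
theorem Cg.mul_self (m a : M.N) : Cg m (a * m) 0 := ⟨0, a, by ring⟩
theorem Cg.of_dvd {m n a b : M.N} (h : m ∣ n) : Cg n a b → Cg m a b := fun ⟨u, w, h'⟩ => by
  obtain ⟨k, rfl⟩ := h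
  exact ⟨u * k, w * k, by grind⟩

instance Sig.cg {s t u : (ℕ → M.N) → M.N} [hs : Fn s] [ht : Fn t] [hu : Fn u] :
    Sig fun e => Cg (s e) (t e) (u e) :=
  Sig.comp₃ hs ht hu (by unfold Cg; infer_instance)

theorem bet_of_cg {c d i x : M.N} (h : Cg (md d i) c x) (hx : x < md d i) : bet c d i = x := by
  obtain ⟨u, w, h⟩ := h
  refine (bet_iff.2 ?_).symm
  rcases le_total u w with huw | huw
  · obtain ⟨k, rfl⟩ := exists_add_of_le huw
    exact ⟨k, by grind, hx⟩
  · obtain ⟨k, rfl⟩ := exists_add_of_le huw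
    have h1 : c + k * md d i = x := by grind
    rcases Str.zero_or_pos k with rfl | hk
    · exact ⟨0, by grind, hx⟩
    · have : md d i ≤ x := by
        rw [← h1]
        exact (le_mul_of_one_le_left zero_le (Str.one_le_of_pos hk)).trans le_add_self
      exact absurd hx (not_lt.2 this)

theorem cg_bet (c d i : M.N) : Cg (md d i) c (bet c d i) := by
  obtain ⟨q, h, -⟩ := bet_iff.1 (rfl : bet c d i = bet c d i)
  exact ⟨0, q, by grind⟩

theorem bet_lt (c d i : M.N) : bet c d i < md d i := by
  obtain ⟨q, -, h⟩ := bet_iff.1 (rfl : bet c d i = bet c d i)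
  exact h

instance Sig.dvd {s t : (ℕ → M.N) → M.N} [hs : Fn s] [ht : Fn t] : Sig fun e => s e ∣ t e :=
  Sig.comp₂ hs ht (by unfold Dvd.dvd semigroupDvd; infer_instance)

/-- The moduli `1 + (i + 1) d` for `i < n` are invertible modulo each other if all numbers `≤ n`
divide `d`. -/
theorem md_inv {d n i j : M.N} (hd : 0 < d) (hn : ∀ q < n, q + 1 ∣ d) (hi : i < n) (hj : j < n)
    (hij : i ≠ j) : ∃ w, Cg (md d i) (w * md d j) 1 := by
  obtain ⟨D, hD⟩ : ∃ D, (i + 1) * d = D + 1 := by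
    obtain ⟨D, hD⟩ := exists_add_of_le (Str.one_le_of_pos (a := (i + 1) * d) (by positivity))
    exact ⟨D, by rw [hD]; ring⟩
  have hm : md d i = D + 2 := by rw [md, hD]; ring
  have hsq : Cg (md d i) ((D + 1) * (D + 1)) 1 := ⟨0, D, by rw [hm]; ring⟩
  rcases lt_or_gt_of_ne hij with h | h
  · obtain ⟨δ, rfl⟩ := exists_add_of_le (Str.succ_le.2 h)
    obtain ⟨q, hq⟩ := hn δ (lt_of_le_of_lt le_add_self hj)
    refine ⟨q * (i + 1) * (i + 1), Cg.trans ?_ hsq⟩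
    have e1 : md d (i + 1 + δ) = md d i + (δ + 1) * d := by unfold md; ring
    have e2 : (δ + 1) * q * ((i + 1) * ((i + 1) * d)) = (D + 1) * (D + 1) := by
      rw [← hq, ← hD]; ring
    refine ⟨0, q * (i + 1) * (i + 1), ?_⟩
    rw [e1, ← e2]; ring
  · obtain ⟨δ, rfl⟩ := exists_add_of_le (Str.succ_le.2 h)
    obtain ⟨q, hq⟩ := hn δ (lt_of_le_of_lt le_add_self hi)
    set A := q * (j + 1 + δ + 1) * (j + 1 + δ + 1) with hA
    have e1 : md d (j + 1 + δ) = md d j + (δ + 1) * d := by unfold md; ring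
    have e2 : A * ((δ + 1) * d) = (D + 1) * (D + 1) := by
      rw [← hD, hA]; conv_rhs => rw [hq]
      conv_lhs => rw [hq]
      ring
    -- `A * md d j` is congruent to `-1`, so its square is congruent to `1`
    have h1 : Cg (md d (j + 1 + δ)) (A * md d j + 1) 0 := by
      refine Cg.trans (Cg.add (Cg.refl _ _) hsq.symm) ?_
      refine Cg.trans (Cg.of_eq ?_) (Cg.mul_self _ A)
      rw [← e2, e1]; ring
    refine ⟨A * A * md d j, ?_⟩
    refine Cg.cancel (c := A * md d j) ?_
    refine Cg.trans (Cg.of_eq (b := (A * md d j) * (A * md d j + 1)) (by ring)) ?_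
    refine Cg.trans (h1.mul_left _) ?_
    rw [mul_zero, add_comm 1]
    exact h1.symm

theorem exists_dvd_all (n : M.N) : ∃ d, 0 < d ∧ ∀ q < n, q + 1 ∣ d := by
  refine sig_induction (P := fun n => ∃ d, 0 < d ∧ ∀ q < n, q + 1 ∣ d) inferInstance
    ⟨1, zero_lt_one, fun q hq => absurd hq (by simp)⟩ ?_ n
  rintro n ⟨d, hd, h⟩
  refine ⟨d * (n + 1), by positivity, fun q hq => ?_⟩
  rcases (Str.lt_succ.1 hq).lt_or_eq with hq | rfl
  · exact (h q hq).mul_right _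
  · exact Dvd.intro_left _ rfl

/-- There is a product of the first `j` moduli: a common multiple of them that is invertible modulo
the others. -/
theorem exists_prod {d n : M.N} (hd : 0 < d) (hn : ∀ q < n, q + 1 ∣ d) (j : M.N) (hj : j ≤ n) :
    ∃ P, 0 < P ∧ (∀ i < j, md d i ∣ P) ∧ ∀ i < n, j ≤ i → ∃ u, Cg (md d i) (u * P) 1 := by
  refine sig_induction (P := fun j => j ≤ n → ∃ P, 0 < P ∧ (∀ i < j, md d i ∣ P) ∧ ∀ i < n, j ≤ i →
    ∃ u, Cg (md d i) (u * P) 1) inferInstance ?_ ?_ j hj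
  · exact fun _ => ⟨1, zero_lt_one, fun q hq => absurd hq (by simp),
      fun i _ _ => ⟨1, by simpa using Cg.refl _ _⟩⟩
  · intro j ih hj
    obtain ⟨P, hP, h1, h2⟩ := ih (le_self_add.trans hj)
    refine ⟨P * md d j, mul_pos hP (md_pos _ _), fun i hi => ?_, fun i hi hji => ?_⟩
    · rcases (Str.lt_succ.1 hi).lt_or_eq with hi | rfl
      · exact (h1 i hi).mul_right _
      · exact Dvd.intro_left _ rfl
    · obtain ⟨u, hu⟩ := h2 i hi (le_self_add.trans hji)
      obtain ⟨w, hw⟩ := md_inv hd hn hi (Str.succ_le.1 hj) (Str.succ_le.1 hji).ne'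
      refine ⟨u * w, Cg.trans (Cg.of_eq ?_) ((hu.mul hw).trans (Cg.of_eq (one_mul 1)))⟩
      ring

/-- The sequence lemma: if all numbers `≤ n` divide `d`, every definable function with small values
on the numbers below `n` is coded with the parameter `d`. -/
theorem exists_bet {d n : M.N} (hd : 0 < d) (hn : ∀ q < n, q + 1 ∣ d) {G : M.N → M.N}
    (hG : Fn fun e => G (e 0)) (hGd : ∀ i < n, G i ≤ d) : ∃ c, ∀ i < n, bet c d i = G i := by
  have hG' : ∀ t : (ℕ → M.N) → M.N, [Fn t] → Fn fun e => G (t e) := fun t ht => Fn.comp₁ ht hG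
  suffices h : ∀ j, j ≤ n → ∃ c, ∀ i < j, bet c d i = G i from h n le_rfl
  refine sig_induction (P := fun j => j ≤ n → ∃ c, ∀ i < j, bet c d i = G i) inferInstance ?_ ?_
  · exact fun _ => ⟨0, fun q hq => absurd hq (by simp)⟩
  · intro j ih hj
    obtain ⟨c, hc⟩ := ih (le_self_add.trans hj)
    obtain ⟨P, -, h1, h2⟩ := exists_prod hd hn j (le_self_add.trans hj)
    obtain ⟨u, hu⟩ := h2 j (Str.succ_le.1 hj) le_rfl
    have lt_md : ∀ i < n, G i < md d i := fun i hi => (hGd i hi).trans_lt (by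
      rw [md, add_comm, Str.lt_succ]
      exact le_mul_of_one_le_left zero_le le_add_self)
    refine ⟨c + P * (u * (G j + (j + 1) * d * c)), fun i hi => ?_⟩
    rcases (Str.lt_succ.1 hi).lt_or_eq with hij | rfl
    · refine bet_of_cg ?_ (lt_md i (hi.trans_le hj))
      obtain ⟨k, hk⟩ := h1 i hij
      refine Cg.trans ?_ ((cg_bet c d i).trans (Cg.of_eq (hc i hij)))
      refine ⟨0, k * (u * (G j + (j + 1) * d * c)), ?_⟩
      rw [hk]; ring
    · refine bet_of_cg ?_ (lt_md i (Str.succ_le.1 hj))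
      have h3 := hu.mul_left (G i + (i + 1) * d * c)
      refine Cg.trans (Cg.add (Cg.refl _ c) (Cg.trans (Cg.of_eq (by ring)) h3)) ?_
      exact ⟨0, c, by unfold md; ring⟩

end Arithmetic

/-! ### Coded sequences -/

section Sequences

variable {M : Str} [hM : IsRCA M]

instance Fn.ite {c : (ℕ → M.N) → Prop} [∀ e, Decidable (c e)] {s t : (ℕ → M.N) → M.N}
    [hc : Del c] [hs : Fn s] [ht : Fn t] : Fn fun e => if c e then s e else t e := by
  have h1 := hs.sig
  have h2 := ht.sig
  have h3 : Sig fun e : ℕ → M.N => c fun i => e (i + 1) := hc.sig.subst fun i => .var (i + 1)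
  have h4 : Sig fun e : ℕ → M.N => ¬ c fun i => e (i + 1) := hc.pi.sig.subst fun i => .var (i + 1)
  have h5 : Sig fun e : ℕ → M.N => (c (fun i => e (i + 1)) ∧ e 0 = s fun i => e (i + 1)) ∨
    (¬ c (fun i => e (i + 1)) ∧ e 0 = t fun i => e (i + 1)) :=
    Sig.or (h := Sig.and) (h' := Sig.and (h := h4))
  exact ⟨h5.congr fun e => by split_ifs with h <;> simp [h]⟩

/-- `s` codes a finite sequence. -/
def IsSq (s : M.N) : Prop := IsPair s ∧ IsPair (sn s)

/-- The length of a coded sequence. -/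
noncomputable def len (s : M.N) : M.N := fs s

/-- The entries of a coded sequence; beyond its length the values are meaningless. -/
noncomputable def ent (s i : M.N) : M.N := bet (fs (sn s)) (sn (sn s)) i

instance Del.isSq {s : (ℕ → M.N) → M.N} [hs : Fn s] : Del fun e => IsSq (s e) := by
  unfold IsSq; infer_instance
instance Fn.len {s : (ℕ → M.N) → M.N} [hs : Fn s] : Fn fun e => len (s e) := by
  unfold SOA.len; infer_instance
instance Fn.ent {s t : (ℕ → M.N) → M.N} [hs : Fn s] [ht : Fn t] : Fn fun e => ent (s e) (t e) := by
  unfold SOA.ent; infer_instance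

theorem len_le (s : M.N) : len s ≤ s := fs_le s

theorem isSq_code (l c d : M.N) : IsSq (pr l (pr c d)) := ⟨isPair_pr _ _, by simp [isPair_pr]⟩
@[simp] theorem len_code (l c d : M.N) : len (pr l (pr c d)) = l := by simp [SOA.len]
@[simp] theorem ent_code (l c d i : M.N) : ent (pr l (pr c d)) i = bet c d i := by simp [SOA.ent]

theorem IsSq.eq {s : M.N} (h : IsSq s) : s = pr (len s) (pr (fs (sn s)) (sn (sn s))) := by
  rw [← h.2.eq]; exact h.1.eq

theorem exists_bound {G : M.N → M.N} (hG : Fn fun e => G (e 0)) (n : M.N) :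
    ∃ b, ∀ i < n, G i ≤ b := by
  have hG' : ∀ t : (ℕ → M.N) → M.N, [Fn t] → Fn fun e => G (t e) := fun t ht => Fn.comp₁ ht hG
  refine sig_induction (P := fun n => ∃ b, ∀ i < n, G i ≤ b) inferInstance
    ⟨0, fun q hq => absurd hq (by simp)⟩ ?_ n
  rintro n ⟨b, hb⟩
  refine ⟨b + G n, fun i hi => ?_⟩
  rcases (Str.lt_succ.1 hi).lt_or_eq with hi | rfl
  · exact (hb i hi).trans le_self_add
  · exact le_add_self

theorem exists_seq {G : M.N → M.N} (hG : Fn fun e => G (e 0)) (n : M.N) :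
    ∃ s, IsSq s ∧ len s = n ∧ ∀ i < n, ent s i = G i := by
  obtain ⟨b, hb⟩ := exists_bound hG n
  obtain ⟨d, hd, hn⟩ := exists_dvd_all n
  obtain ⟨c, hc⟩ := exists_bet (d := d * (b + 1)) (by positivity)
    (fun q hq => (hn q hq).mul_right _) hG (fun i hi => (hb i hi).trans
      (le_self_add.trans (le_mul_of_one_le_left zero_le (Str.one_le_of_pos hd))))
  exact ⟨_, isSq_code n c _, by simp, by simpa using hc⟩

/-- A bound, as a function of the length, for suitable codes of sequences of zeros and ones: the
parameter `d` can be chosen to depend on the length alone, and `c` can be reduced modulo the product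
of the moduli. -/
theorem exists_code_bound : ∃ B : M.N → M.N, Fn (fun e => B (e 0)) ∧
    ∀ n, ∀ G : M.N → M.N, Fn (fun e => G (e 0)) → (∀ i < n, G i ≤ 1) →
      ∃ s < B n, IsSq s ∧ len s = n ∧ ∀ i < n, ent s i = G i := by
  obtain ⟨B, hB, h⟩ := exists_fn (M := M) (C := fun n y => ∃ d P, y = pr n (pr P d) ∧ 0 < d ∧
    (∀ q < n, q + 1 ∣ d) ∧ 0 < P ∧ ∀ i < n, md d i ∣ P) inferInstance fun n => by
      obtain ⟨d, hd, hn⟩ := exists_dvd_all n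
      obtain ⟨P, hP, h, -⟩ := exists_prod hd hn n le_rfl
      exact ⟨_, d, P, rfl, hd, hn, hP, h⟩
  refine ⟨B, hB, fun n G hG hG1 => ?_⟩
  obtain ⟨d, P, hy, hd, hn, hP, hdv⟩ := h n
  obtain ⟨c, hc⟩ := exists_bet hd hn hG (fun i hi => (hG1 i hi).trans (Str.one_le_of_pos hd))
  obtain ⟨q, c', hq, hc'⟩ := exists_rem hP c
  refine ⟨pr n (pr c' d), ?_, isSq_code _ _ _, by simp, fun i hi => ?_⟩
  · rw [hy]
    exact pr_lt (by gcongr; exact pr_lt (by gcongr))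
  · rw [ent_code, ← hc i hi]
    refine bet_of_cg ?_ (bet_lt _ _ _)
    refine Cg.trans (Cg.of_dvd (hdv i hi) ?_) (cg_bet c d i)
    exact ⟨q, 0, by rw [hq]; ring⟩

/-- `s` and `t` code the same sequence. -/
def Same (s t : M.N) : Prop := IsSq s ∧ IsSq t ∧ len s = len t ∧ ∀ i < len s, ent s i = ent t i

/-- `s` is the least code of a sequence. -/
def IsStr (s : M.N) : Prop := IsSq s ∧ ∀ t < s, ¬ Same t s

/-- The sequence coded by `s` is an initial segment of the sequence coded by `t`. -/
def Pre (s t : M.N) : Prop := IsSq s ∧ IsSq t ∧ len s ≤ len t ∧ ∀ i < len s, ent s i = ent t i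

instance Del.same {s t : (ℕ → M.N) → M.N} [hs : Fn s] [ht : Fn t] : Del fun e => Same (s e) (t e) :=
  Del.comp₂ hs ht (by unfold Same; infer_instance)
instance Del.isStr {s : (ℕ → M.N) → M.N} [hs : Fn s] : Del fun e => IsStr (s e) :=
  Del.comp₁ hs (by unfold IsStr; infer_instance)
instance Del.pre {s t : (ℕ → M.N) → M.N} [hs : Fn s] [ht : Fn t] : Del fun e => Pre (s e) (t e) :=
  Del.comp₂ hs ht (by unfold Pre; infer_instance)

theorem Same.trans {s t u : M.N} (h : Same s t) (h' : Same t u) : Same s u :=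
  ⟨h.1, h'.2.1, h.2.2.1.trans h'.2.2.1, fun i hi =>
    (h.2.2.2 i hi).trans (h'.2.2.2 i (h.2.2.1 ▸ hi))⟩

theorem exists_isStr {s : M.N} (h : IsSq s) : ∃ t ≤ s, IsStr t ∧ Same t s := by
  have hs : Same s s := ⟨h, h, rfl, fun _ _ => rfl⟩
  obtain ⟨t, ht, ht'⟩ := exists_least (P := fun t => Same t s) inferInstance hs
  exact ⟨t, not_lt.1 fun h => ht' _ h hs, ⟨ht.1, fun u hu h => ht' u hu (h.trans ht)⟩, ht⟩

theorem exists_snoc (s n x : M.N) : ∃ s', IsSq s' ∧ len s' = n + 1 ∧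
    (∀ i < n, ent s' i = ent s i) ∧ ent s' n = x := by
  classical
  obtain ⟨s', h1, h2, h3⟩ := exists_seq (G := fun i => if i < n then ent s i else x)
    inferInstance (n + 1)
  exact ⟨s', h1, h2, fun i hi => by rw [h3 i (hi.trans (Str.lt_succ.2 le_rfl)), if_pos hi],
    by rw [h3 n (Str.lt_succ.2 le_rfl), if_neg (lt_irrefl _)]⟩

theorem exists_set (s n a x : M.N) : ∃ s', IsSq s' ∧ len s' = n ∧
    ∀ i < n, (i = a → ent s' i = x) ∧ (i ≠ a → ent s' i = ent s i) := by
  classical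
  obtain ⟨s', h1, h2, h3⟩ := exists_seq (G := fun i => if i = a then x else ent s i)
    inferInstance n
  exact ⟨s', h1, h2, fun i hi => ⟨fun h => by rw [h3 i hi, if_pos h],
    fun h => by rw [h3 i hi, if_neg h]⟩⟩

/-- Primitive recursion. -/
theorem exists_rec {H : M.N → M.N → M.N} (hH : Fn fun e => H (e 0) (e 1)) (a : M.N) :
    ∃ R : M.N → M.N, Fn (fun e => R (e 0)) ∧ R 0 = a ∧ ∀ n, R (n + 1) = H n (R n) := by
  have hH' : ∀ s t : (ℕ → M.N) → M.N, [Fn s] → [Fn t] → Fn fun e => H (s e) (t e) :=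
    fun s t hs ht => Fn.comp₂ hs ht hH
  obtain ⟨R, hR, h⟩ := exists_fn (M := M) (C := fun n y => ∃ s, ent s 0 = a ∧
    (∀ i < n, ent s (i + 1) = H i (ent s i)) ∧ ent s n = y) inferInstance fun n => by
      refine sig_induction (P := fun n => ∃ y, ∃ s, ent s 0 = a ∧
        (∀ i < n, ent s (i + 1) = H i (ent s i)) ∧ ent s n = y) inferInstance ?_ ?_ n
      · obtain ⟨s, -, -, -, h⟩ := exists_snoc 0 0 a
        exact ⟨_, s, h, fun q hq => absurd hq (by simp), rfl⟩
      · rintro n ⟨y, s, h0, h1, rfl⟩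
        obtain ⟨s', -, -, h2, h3⟩ := exists_snoc s (n + 1) (H n (ent s n))
        refine ⟨_, s', by rw [h2 0 (by positivity), h0], fun i hi => ?_, rfl⟩
        rw [h2 i hi]
        rcases (Str.lt_succ.1 hi).lt_or_eq with hi | rfl
        · rw [h2 _ (by gcongr), h1 i hi]
        · exact h3
  have uniq : ∀ n s s', ent s 0 = a → (∀ i < n, ent s (i + 1) = H i (ent s i)) → ent s' 0 = a →
      (∀ i < n, ent s' (i + 1) = H i (ent s' i)) → ∀ i, i ≤ n → ent s i = ent s' i := by
    intro n s s' h0 h1 h0' h1'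
    refine sig_induction (P := fun i => i ≤ n → ent s i = ent s' i) inferInstance
      (fun _ => h0.trans h0'.symm) fun i ih hi => ?_
    rw [h1 i (Str.succ_le.1 hi), h1' i (Str.succ_le.1 hi), ih (le_self_add.trans hi)]
  refine ⟨R, hR, ?_, fun n => ?_⟩
  · obtain ⟨s, h0, -, h2⟩ := h 0
    rw [← h2, h0]
  · obtain ⟨s, h0, h1, h2⟩ := h n
    obtain ⟨s', h0', h1', h2'⟩ := h (n + 1)
    rw [← h2', h1' n (Str.lt_succ.2 le_rfl), ← h2, uniq n s s' h0 h1 h0'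
      (fun i hi => h1' i (hi.trans (Str.lt_succ.2 le_rfl))) n le_rfl]

/-! ### The meaning of the formulas about sequences -/

variable (e : ℕ → M.N) (r : ℕ → M.S)

@[simp] theorem ev_pair (s t : Tm) : (pair s t).ev M e = pr (s.ev M e) (t.ev M e) := rfl

@[simp] theorem eval_app (X : ℕ) (s t : Tm) :
    (app X s t).eval M e r ↔ M.mem (pr (s.ev M e) (t.ev M e)) (r X) := Iff.rfl

@[simp] theorem eval_beta (c d i x : Tm) :
    (beta c d i x).eval M e r ↔ x.ev M e = bet (c.ev M e) (d.ev M e) (i.ev M e) := by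
  simp [beta, bet_iff, md]

@[simp] theorem eval_isLen (s l : Tm) :
    (isLen s l).eval M e r ↔ IsSq (s.ev M e) ∧ len (s.ev M e) = l.ev M e := by
  simp [isLen, exNs]
  constructor
  · rintro ⟨c, d, h⟩
    rw [h]; exact ⟨isSq_code _ _ _, by simp⟩
  · rintro ⟨h, h'⟩
    exact ⟨_, _, by rw [← h']; exact h.eq⟩

@[simp] theorem eval_entry (s i x : Tm) :
    (entry s i x).eval M e r ↔ IsSq (s.ev M e) ∧ i.ev M e < len (s.ev M e) ∧
      x.ev M e = ent (s.ev M e) (i.ev M e) := by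
  simp [entry, exNs]
  constructor
  · rintro ⟨l, c, d, h, h1, h2⟩
    rw [h]; exact ⟨isSq_code _ _ _, by simpa, by simpa⟩
  · rintro ⟨h, h1, h2⟩
    exact ⟨_, _, _, h.eq, h1, h2⟩

@[simp] theorem eval_sameSeq (s t : Tm) :
    (sameSeq s t).eval M e r ↔ Same (s.ev M e) (t.ev M e) := by
  simp [sameSeq, allNs, Same]
  constructor
  · rintro ⟨⟨⟨h1, h2⟩, h3⟩, h⟩
    exact ⟨h1, h3, h2, fun i hi => ((h i _).1 ⟨h1, hi, rfl⟩).2.2⟩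
  · rintro ⟨h1, h2, h3, h⟩
    refine ⟨⟨⟨h1, h3⟩, h2⟩, fun i x => ?_⟩
    constructor
    · rintro ⟨-, hi, rfl⟩
      exact ⟨h2, h3 ▸ hi, h i hi⟩
    · rintro ⟨-, hi, rfl⟩
      exact ⟨h1, h3 ▸ hi, (h i (h3 ▸ hi)).symm⟩

@[simp] theorem eval_isString (s : Tm) : (isString s).eval M e r ↔ IsStr (s.ev M e) := by
  simp [isString, IsStr]

@[simp] theorem eval_isBinString (s : Tm) : (isBinString s).eval M e r ↔
    IsStr (s.ev M e) ∧ ∀ i < len (s.ev M e), ent (s.ev M e) i < 1 + 1 := by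
  simp [isBinString, allNs]
  exact fun h => ⟨fun h' i hi => h' i _ h.1 hi rfl, fun h' i x _ hi hx => hx ▸ h' i hi⟩

@[simp] theorem eval_isPrefix (s t : Tm) :
    (isPrefix s t).eval M e r ↔ Pre (s.ev M e) (t.ev M e) := by
  simp [isPrefix, allNs, exNs, Pre]
  constructor
  · rintro ⟨⟨h1, h3, h5⟩, h⟩
    exact ⟨h1, h3, h5, fun i hi => (h i _ h1 hi rfl).2.2⟩
  · rintro ⟨h1, h2, h3, h⟩
    refine ⟨⟨h1, h2, h3⟩, fun i x _ hi hx => ?_⟩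
    exact ⟨h2, hi.trans_le h3, hx ▸ h i hi⟩

end Sequences

/-! ### Functions as sets, and separation -/

section Separation

variable {M : Str} [hM : IsRCA M]

/-- The set `X` is the graph of `G`. -/
def IsGr (X : M.S) (G : M.N → M.N) : Prop := ∀ z, M.mem z X ↔ ∃ a, z = pr a (G a)

theorem IsGr.mem {X : M.S} {G : M.N → M.N} (h : IsGr X G) {a b : M.N} :
    M.mem (pr a b) X ↔ b = G a := by
  rw [h]
  constructor
  · rintro ⟨c, hc⟩
    obtain ⟨rfl, h⟩ := pr_inj.1 hc
    exact h
  · rintro rfl; exact ⟨a, rfl⟩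

theorem exists_isGr {G : M.N → M.N} (hG : Fn fun e => G (e 0)) : ∃ X : M.S, IsGr X G := by
  have hG' : ∀ t : (ℕ → M.N) → M.N, [Fn t] → Fn fun e => G (t e) := fun t ht => Fn.comp₁ ht hG
  obtain ⟨X, hX⟩ := del_comprehension (M := M) (P := fun z => ∃ a < z + 1, z = pr a (G a))
    inferInstance
  refine ⟨X, fun z => (hX z).trans ⟨fun ⟨a, _, h⟩ => ⟨a, h⟩, fun ⟨a, h⟩ => ⟨a, ?_, h⟩⟩⟩
  rw [h]; exact Str.lt_succ.2 (left_le_pr _ _)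

theorem eval_isFun (X : ℕ) (e : ℕ → M.N) (r : ℕ → M.S) :
    (isFun X).eval M e r ↔ ∃ G : M.N → M.N, Fn (fun e => G (e 0)) ∧ IsGr (r X) G := by
  simp [isFun, exNs, allNs]
  constructor
  · rintro ⟨h1, h2, h3⟩
    obtain ⟨G, hG, h⟩ := exists_fn (C := fun a b => M.mem (pr a b) (r X)) inferInstance h2
    refine ⟨G, hG, fun z => ⟨fun hz => ?_, ?_⟩⟩
    · obtain ⟨a, b, rfl⟩ := h1 z hz
      exact ⟨a, by rw [h3 a b (G a) hz (h a)]⟩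
    · rintro ⟨a, rfl⟩; exact h a
  · rintro ⟨G, -, h⟩
    refine ⟨fun z hz => ?_, fun a => ⟨G a, h.mem.2 rfl⟩, fun a b c hb hc => ?_⟩
    · obtain ⟨a, ha⟩ := (h z).1 hz
      exact ⟨_, _, ha⟩
    · rw [h.mem.1 hb, h.mem.1 hc]

theorem Sig.exists_del {A : M.N → Prop} (h : Sig fun e => A (e 0)) :
    ∃ Q : M.N → M.N → Prop, Del (fun e => Q (e 0) (e 1)) ∧ ∀ p, A p ↔ ∃ u, Q u p := by
  obtain ⟨Q, hQ, h⟩ := h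
  refine ⟨fun u p => Q (econs u (econs p fun _ => 0)), ?_, fun p => h (econs p fun _ => 0)⟩
  have := hQ.subst (σ := econs (fun e => e 0) (econs (fun e => e 1) fun _ _ => 0))
    (TmDef.cons (.var 0) (TmDef.cons (.var 1) fun _ => .const 0))
  simp only [econs_apply] at this
  exact this.del

theorem Sig.exists_del₂ {A : M.N → M.N → Prop} (h : Sig fun e => A (e 0) (e 1)) :
    ∃ Q : M.N → M.N → M.N → Prop, Del (fun e => Q (e 0) (e 1) (e 2)) ∧
      ∀ p q, A p q ↔ ∃ u, Q u p q := by
  obtain ⟨Q, hQ, h⟩ := h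
  refine ⟨fun u p q => Q (econs u (econs p (econs q fun _ => 0))), ?_,
    fun p q => h (econs p (econs q fun _ => 0))⟩
  have := hQ.subst (σ := econs (fun e => e 0) (econs (fun e => e 1) (econs (fun e => e 2)
    fun _ _ => 0))) (TmDef.cons (.var 0) (TmDef.cons (.var 1) (TmDef.cons (.var 2)
      fun _ => .const 0)))
  simp only [econs_apply] at this
  exact this.del

/-- `Σ⁰₁` separation: disjoint `Σ⁰₁` predicates are separated by a `Δ⁰₁` predicate. -/
def Separation (M : Str) : Prop := ∀ A B : M.N → Prop, Sig (fun e => A (e 0)) →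
  Sig (fun e => B (e 0)) → (∀ p, A p → ¬ B p) →
    ∃ D : M.N → Prop, Del (fun e => D (e 0)) ∧ ∀ p, (A p → D p) ∧ (B p → ¬ D p)

theorem lt_two {x : M.N} : x < 1 + 1 ↔ x = 0 ∨ x = 1 := by
  rw [Str.lt_succ]
  constructor
  · intro h
    rcases Str.zero_or_pos x with h0 | h0
    · exact .inl h0.symm
    · exact .inr (le_antisymm h (Str.one_le_of_pos h0))
  · rintro (rfl | rfl)
    · exact zero_le
    · exact le_rfl

/-- The semantic form of weak König's lemma. -/
theorem eval_WKL (e : ℕ → M.N) (r : ℕ → M.S) : WKL.eval M e r ↔ ∀ T : M.S,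
    (∀ z, M.mem z T → IsStr z ∧ ∀ i < len z, ent z i < 1 + 1) →
    (∀ z w, M.mem z T → IsStr w → Pre w z → M.mem w T) → (∀ n, ∃ m, n < m ∧ M.mem m T) →
    ∃ F : M.N → M.N, Fn (fun e => F (e 0)) ∧
      ∀ n, ∃ s, M.mem s T ∧ IsSq s ∧ len s = n ∧ ∀ i < n, ent s i = F i := by
  simp only [WKL, eval_allS, eval_imp, eval_conj, eval_exS, eval_isFun, isBinTree, isInfinite,
    isPath, allNs, Function.iterate_succ, Function.iterate_zero, Function.comp, id, eval_allN,
    eval_exN, eval_mem, eval_isBinString, eval_isString, eval_isPrefix, eval_lt, ev_var, eval_app,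
    eval_isLen, eval_entry, econs_zero, econs_succ, and_imp]
  refine forall_congr' fun T => ⟨fun h h1 h2 h3 => ?_, fun h h1 h2 h3 => ?_⟩
  · obtain ⟨f, ⟨F, hF, hf⟩, h⟩ := h h1 (fun z w hz hw hp => h2 z w hz hw hp) h3
    refine ⟨F, hF, fun n => ?_⟩
    obtain ⟨s, hs, ⟨h4, h5⟩, h⟩ := h n
    exact ⟨s, hs, h4, h5, fun i hi => hf.mem.1 (h i _ h4 (h5.symm ▸ hi) rfl)⟩
  · obtain ⟨F, hF, h⟩ := h h1 (fun z w hz hw hp => h2 z w hz hw hp) h3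
    obtain ⟨f, hf⟩ := exists_isGr hF
    refine ⟨f, ⟨F, hF, hf⟩, fun n => ?_⟩
    obtain ⟨s, hs, h4, h5, h⟩ := h n
    refine ⟨s, hs, ⟨h4, h5⟩, fun i x _ hi hx => hf.mem.2 ?_⟩
    simpa [hx] using h i (h5 ▸ hi)

/-- Weak König's lemma yields `Σ⁰₁` separation: a path through the tree of the strings that separate
`A` and `B` as far as witnesses below their length show is a separating set. -/
theorem separation_of_WKL {e : ℕ → M.N} {r : ℕ → M.S} (h : WKL.eval M e r) : Separation M := by
  classical
  rw [eval_WKL] at h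
  intro A B hA hB hAB
  obtain ⟨Q, hQ, hAQ⟩ := hA.exists_del
  obtain ⟨R, hR, hBR⟩ := hB.exists_del
  have hQ' : ∀ s t : (ℕ → M.N) → M.N, [Fn s] → [Fn t] → Del fun e => Q (s e) (t e) :=
    fun s t hs ht => Del.comp₂ hs ht hQ
  have hR' : ∀ s t : (ℕ → M.N) → M.N, [Fn s] → [Fn t] → Del fun e => R (s e) (t e) :=
    fun s t hs ht => Del.comp₂ hs ht hR
  obtain ⟨T, hT⟩ := del_comprehension (M := M) (P := fun z => IsStr z ∧
    (∀ i < len z, ent z i < 1 + 1) ∧ ∀ p < len z, ∀ u < len z,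
      (Q u p → ent z p = 1) ∧ (R u p → ent z p = 0)) inferInstance
  obtain ⟨F, hF, hP⟩ := h T (fun z hz => ⟨((hT z).1 hz).1, ((hT z).1 hz).2.1⟩)
    (fun z w hz hw hp => by
      obtain ⟨h1, h2, h3⟩ := (hT z).1 hz
      refine (hT w).2 ⟨hw, fun i hi => ?_, fun p hp' u hu => ?_⟩
      · rw [hp.2.2.2 i hi]; exact h2 i (hi.trans_le hp.2.2.1)
      · rw [hp.2.2.2 p hp']; exact h3 p (hp'.trans_le hp.2.2.1) u (hu.trans_le hp.2.2.1))
    (fun n => by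
      obtain ⟨s, h1, h2, h3⟩ := exists_seq
        (G := fun i => if ∃ u < n + 1, Q u i then (1 : M.N) else 0) inferInstance (n + 1)
      obtain ⟨t, -, h4, -, -, h5, h6⟩ := exists_isStr h1
      rw [h2] at h5
      have h7 : ∀ i < n + 1, ent t i = if ∃ u < n + 1, Q u i then (1 : M.N) else 0 := fun i hi => by
        rw [h6 i (h5 ▸ hi), h3 i hi]
      refine ⟨t, (Str.lt_succ.2 le_rfl).trans_le (h5 ▸ len_le t), (hT t).2 ⟨h4, ?_, ?_⟩⟩
      · intro i hi
        rw [h7 i (h5 ▸ hi), lt_two]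
        split_ifs <;> simp
      · intro p hp u hu
        rw [h5] at hp hu
        rw [h7 p hp]
        constructor
        · exact fun h => if_pos ⟨u, hu, h⟩
        · refine fun h => if_neg ?_
          rintro ⟨u', -, h'⟩
          exact hAB p ((hAQ p).2 ⟨u', h'⟩) ((hBR p).2 ⟨u, h⟩))
  have hF' : ∀ t : (ℕ → M.N) → M.N, [Fn t] → Fn fun e => F (t e) := fun t ht => Fn.comp₁ ht hF
  refine ⟨fun p => F p = 1, inferInstance, fun p => ⟨fun hp => ?_, fun hp => ?_⟩⟩
  · obtain ⟨u, hu⟩ := (hAQ p).1 hp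
    obtain ⟨s, hs, h1, h2, h3⟩ := hP (p + u + 1)
    have hp : p < p + u + 1 := Str.lt_succ.2 le_self_add
    rw [← h3 p hp]
    exact (((hT s).1 hs).2.2 p (h2.symm ▸ hp) u (h2.symm ▸ Str.lt_succ.2 le_add_self)).1 hu
  · obtain ⟨u, hu⟩ := (hBR p).1 hp
    obtain ⟨s, hs, h1, h2, h3⟩ := hP (p + u + 1)
    have hp : p < p + u + 1 := Str.lt_succ.2 le_self_add
    show ¬ F p = 1
    rw [← h3 p hp,
      (((hT s).1 hs).2.2 p (h2.symm ▸ hp) u (h2.symm ▸ Str.lt_succ.2 le_add_self)).2 hu]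
    exact zero_ne_one

/-- `Σ⁰₁` separation yields a path through an infinite binary tree: at a string with extensions of
all lengths, separate the case that the extensions to the left die out first from the case that
those to the right do. -/
theorem WKL_of_separation (h : Separation M) (e : ℕ → M.N) (r : ℕ → M.S) : WKL.eval M e r := by
  classical
  rw [eval_WKL]
  intro T hT hpre hinf
  obtain ⟨B, hB, hBs⟩ := exists_code_bound (M := M)
  have hB' : ∀ t : (ℕ → M.N) → M.N, [Fn t] → Fn fun e => B (t e) := fun t ht => Fn.comp₁ ht hB
  have hTB : ∀ z, M.mem z T → z < B (len z) := by
    intro z hz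
    obtain ⟨s, hs, h1, h2, h3⟩ := hBs (len z) (fun i => ent z i) inferInstance
      (fun i hi => Str.lt_succ.1 ((hT z hz).2 i hi))
    refine lt_of_le_of_lt (not_lt.1 fun hsz => ?_) hs
    exact (hT z hz).1.2 s hsz ⟨h1, (hT z hz).1.1, h2, fun i hi => h3 i (h2 ▸ hi)⟩
  have restrict : ∀ z, M.mem z T → ∀ n, n ≤ len z → ∃ w, M.mem w T ∧ len w = n ∧
      ∀ i < n, ent w i = ent z i := by
    intro z hz n hn
    obtain ⟨s, h1, h2, h3⟩ := exists_seq (G := fun i => ent z i) inferInstance n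
    obtain ⟨w, -, h4, h5, -, h6, h7⟩ := exists_isStr h1
    have h8 : ∀ i < n, ent w i = ent z i := fun i hi => by
      rw [h7 i (by rwa [h6, h2]), h3 i hi]
    exact ⟨w, hpre z w hz h4 ⟨h5, (hT z hz).1.1, by rwa [h6, h2], fun i hi => h8 i (by
      rwa [h6, h2] at hi)⟩, by rw [h6, h2], h8⟩
  have all_len : ∀ n, ∃ z, M.mem z T ∧ len z = n := by
    intro n
    obtain ⟨b, hb⟩ := exists_bound hB n
    obtain ⟨m, hm, hmT⟩ := hinf b
    by_cases hn : len m < n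
    · exact absurd ((hTB m hmT).trans_le (hb _ hn)) (not_lt.2 hm.le)
    · obtain ⟨w, hw, hw', -⟩ := restrict m hmT n (not_lt.1 hn)
      exact ⟨w, hw, hw'⟩
  -- `s` has an extension of length `n` in the tree
  let Ext : M.N → M.N → Prop := fun s n => ∃ z < B n, M.mem z T ∧ len z = n ∧ Pre s z
  have hExt : ∀ s t : (ℕ → M.N) → M.N, [Fn s] → [Fn t] → Del fun e => Ext (s e) (t e) :=
    fun s t hs ht => Del.comp₂ hs ht inferInstance
  have ext_iff : ∀ s n, Ext s n ↔ ∃ z, M.mem z T ∧ len z = n ∧ Pre s z := fun s n =>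
    ⟨fun ⟨z, _, h⟩ => ⟨z, h⟩, fun ⟨z, h1, h2, h3⟩ => ⟨z, h2 ▸ hTB z h1, h1, h2, h3⟩⟩
  have ext_mono : ∀ s n m, n ≤ m → len s ≤ n → Ext s m → Ext s n := by
    intro s n m hnm hs h
    obtain ⟨z, h1, rfl, h3⟩ := (ext_iff s m).1 h
    obtain ⟨w, hw, rfl, hw'⟩ := restrict z h1 n hnm
    exact (ext_iff _ _).2 ⟨w, hw, rfl, h3.1, (hT w hw).1.1, hs, fun i hi => by
      rw [hw' i (hi.trans_le hs), h3.2.2.2 i hi]⟩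
  obtain ⟨K, hK, hKs⟩ := exists_fn (M := M) (C := fun p y => IsSq y ∧ len y = len (fs p) + 1 ∧
    (∀ j < len (fs p), ent y j = ent (fs p) j) ∧ ent y (len (fs p)) = sn p) inferInstance
    fun p => exists_snoc _ _ _
  have hK' : ∀ t : (ℕ → M.N) → M.N, [Fn t] → Fn fun e => K (t e) := fun t ht => Fn.comp₁ ht hK
  -- the sequence `s` with the value `i` appended
  let sc : M.N → M.N → M.N := fun s i => K (pr s i)
  have hsc : ∀ s i, IsSq (sc s i) ∧ len (sc s i) = len s + 1 ∧
      (∀ j < len s, ent (sc s i) j = ent s j) ∧ ent (sc s i) (len s) = i := fun s i => by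
    simpa using hKs (pr s i)
  obtain ⟨D, hD, hDs⟩ := h
    (fun s => ∃ n, len s < n ∧ Ext (sc s 1) n ∧ ¬ Ext (sc s 0) n)
    (fun s => ∃ n, len s < n ∧ Ext (sc s 0) n ∧ ¬ Ext (sc s 1) n) inferInstance inferInstance (by
      rintro s ⟨n, hn, h1, h2⟩ ⟨m, hm, h3, h4⟩
      rcases le_total n m with h | h
      · exact h2 (ext_mono _ n m h (by rw [(hsc s 0).2.1]; exact Str.succ_le.2 hn) h3)
      · exact h4 (ext_mono _ m n h (by rw [(hsc s 1).2.1]; exact Str.succ_le.2 hm) h1))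
  have hD' : ∀ t : (ℕ → M.N) → M.N, [Fn t] → Del fun e => D (t e) := fun t ht => Del.comp₁ ht hD
  let g : M.N → M.N := fun s => if D s then 1 else 0
  have hg : ∀ t : (ℕ → M.N) → M.N, [Fn t] → Fn fun e => g (t e) := fun t ht =>
    inferInstanceAs (Fn fun e => if D (t e) then 1 else 0)
  obtain ⟨S, hS, hS0, hS1⟩ := exists_rec (M := M) (H := fun _ s => sc s (g s)) inferInstance
    (pr 0 (pr 0 0))
  have hS' : ∀ t : (ℕ → M.N) → M.N, [Fn t] → Fn fun e => S (t e) := fun t ht => Fn.comp₁ ht hS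
  have len_S : ∀ n, IsSq (S n) ∧ len (S n) = n := by
    refine sig_induction inferInstance ?_ ?_
    · rw [hS0]; exact ⟨isSq_code _ _ _, by simp⟩
    · rintro n ⟨-, h2⟩
      rw [hS1, (hsc _ _).2.1, h2]
      exact ⟨(hsc _ _).1, rfl⟩
  have ext_S : ∀ n, ∀ m, n ≤ m → Ext (S n) m := by
    refine pi_induction inferInstance ?_ ?_
    · intro m _
      obtain ⟨z, hz, rfl⟩ := all_len m
      refine (ext_iff _ _).2 ⟨z, hz, rfl, (len_S 0).1, (hT z hz).1.1, ?_, ?_⟩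
      · rw [(len_S 0).2]; exact zero_le
      · rw [(len_S 0).2]; exact fun i hi => absurd hi (by simp)
    · intro n ih m hm
      obtain ⟨z, hz, rfl, hpz⟩ := (ext_iff _ _).1 (ih m (le_self_add.trans hm))
      have hlt : n < len z := Str.succ_le.1 hm
      -- the extension continues with one of the two values
      have key : ∀ i, ent z n = i → Ext (sc (S n) i) (len z) := by
        intro i hi
        refine (ext_iff _ _).2 ⟨z, hz, rfl, (hsc _ _).1, (hT z hz).1.1, ?_, fun j hj => ?_⟩
        · rw [(hsc _ _).2.1, (len_S n).2]; exact hm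
        · rw [(hsc _ _).2.1] at hj
          rcases (Str.lt_succ.1 hj).lt_or_eq with hj | rfl
          · rw [(hsc _ _).2.2.1 j hj, hpz.2.2.2 j hj]
          · rw [(hsc _ _).2.2.2, (len_S n).2, hi]
      have hln : len (S n) < len z := by rwa [(len_S n).2]
      rw [hS1]
      show Ext (sc (S n) (if D (S n) then 1 else 0)) (len z)
      rcases lt_two.1 ((hT z hz).2 n hlt) with h0 | h0
      · split_ifs with hDn
        · by_contra hne
          exact (hDs (S n)).2 ⟨_, hln, key 0 h0, hne⟩ hDn
        · exact key 0 h0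
      · split_ifs with hDn
        · exact key 1 h0
        · by_contra hne
          exact hDn ((hDs (S n)).1 ⟨_, hln, key 1 h0, hne⟩)
  have ent_S : ∀ n, ∀ i < n, ent (S n) i = g (S i) := by
    refine sig_induction inferInstance (fun q hq => absurd hq (by simp)) fun n ih i hi => ?_
    rw [hS1]
    rcases (Str.lt_succ.1 hi).lt_or_eq with hi | rfl
    · rw [(hsc _ _).2.2.1 i (by rwa [(len_S n).2]), ih i hi]
    · conv_lhs => rw [← (len_S i).2]
      rw [(len_S i).2]
      have := (hsc (S i) (g (S i))).2.2.2
      rwa [(len_S i).2] at this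
  refine ⟨fun i => g (S i), inferInstance, fun n => ?_⟩
  obtain ⟨z, hz, hn, hp⟩ := (ext_iff _ _).1 (ext_S n n le_rfl)
  exact ⟨z, hz, (hT z hz).1.1, hn, fun i hi => by
    rw [← hp.2.2.2 i (by rwa [(len_S n).2]), ent_S n i hi]⟩

end Separation

/-! ### Oracle machines in a model -/

section Machines

variable {M : Str} [hM : IsRCA M]

/-- The meaning of `update`. -/
def Upd (R a x R' : M.N) : Prop := IsSq R ∧ IsSq R' ∧ len R' = len R ∧ a < len R ∧
  ∀ i < len R, (i = a → ent R' i = x) ∧ (i ≠ a → ent R' i = ent R i)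

instance Del.upd {s t u w : (ℕ → M.N) → M.N} [hs : Fn s] [ht : Fn t] [hu : Fn u] [hw : Fn w] :
    Del fun e => Upd (s e) (t e) (u e) (w e) := by
  have h : Del fun e : ℕ → M.N => Upd (e 0) (e 1) (e 2) (e 3) := by unfold Upd; infer_instance
  exact ⟨Sig.comp₄ hs ht hu hw h.sig,
    ⟨Sig.comp₄ (R := fun a b c d => ¬ Upd a b c d) hs ht hu hw h.pi.sig⟩⟩

variable (e : ℕ → M.N) (r : ℕ → M.S)

@[simp] theorem eval_update (R a x R' : Tm) : (update R a x R').eval M e r ↔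
    Upd (R.ev M e) (a.ev M e) (x.ev M e) (R'.ev M e) := by
  simp only [update, eval_conj, eval_exN, eval_isLen, eval_lt, ev_lift_one, ev_var, econs_zero,
    allNs, Function.iterate_succ, Function.iterate_zero, Function.comp, id, eval_allN, eval_bicond,
    eval_disj, eval_neg, eval_eq, eval_entry, ev_lift_two, econs_succ, Upd]
  constructor
  · rintro ⟨⟨l, ⟨h1, rfl⟩, ⟨h2, h3⟩, h4⟩, h⟩
    refine ⟨h1, h2, h3, h4, fun i hi => ⟨?_, fun hia => ?_⟩⟩
    · rintro rfl
      exact (((h _ _).2 (.inl ⟨rfl, rfl⟩)).2.2).symm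
    · exact (((h i _).2 (.inr ⟨hia, h1, hi, rfl⟩)).2.2).symm
  · rintro ⟨h1, h2, h3, h4, h⟩
    refine ⟨⟨_, ⟨h1, rfl⟩, ⟨h2, h3⟩, h4⟩, fun i y => ⟨?_, ?_⟩⟩
    · rintro ⟨-, hi, rfl⟩
      rw [h3] at hi
      by_cases hia : i = a.ev M e
      · exact .inl ⟨hia, (h i hi).1 hia⟩
      · exact .inr ⟨hia, h1, hi, (h i hi).2 hia⟩
    · rintro (⟨rfl, rfl⟩ | ⟨hia, -, hi, rfl⟩)
      · exact ⟨h2, h3.symm ▸ h4, ((h _ h4).1 rfl).symm⟩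
      · exact ⟨h2, h3.symm ▸ hi, ((h i hi).2 hia).symm⟩

/-- The meaning of `exec`, for the oracle with graph `G`. -/
def Exec (G : M.N → M.N) (i p R p' R' : M.N) : Prop :=
  (∃ a b, i = pr 0 (pr a b) ∧ Upd R a b R' ∧ p' = p + 1) ∨
  (∃ a b c, i = pr 1 (pr a (pr b c)) ∧ b < len R ∧ c < len R ∧
    Upd R a (ent R b + ent R c) R' ∧ p' = p + 1) ∨
  (∃ a b c, i = pr (1 + 1) (pr a (pr b c)) ∧ b < len R ∧ c < len R ∧
    Upd R a (ent R b * ent R c) R' ∧ p' = p + 1) ∨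
  (∃ a b, i = pr (1 + 1 + 1) (pr a b) ∧ b < len R ∧ Upd R a (G (ent R b)) R' ∧ p' = p + 1) ∨
  (∃ a b c, i = pr (1 + 1 + 1 + 1) (pr a (pr b c)) ∧ IsSq R ∧ a < len R ∧ b < len R ∧ R' = R ∧
    ((ent R a < ent R b ∧ p' = c) ∨ (¬ ent R a < ent R b ∧ p' = p + 1)))

theorem eval_exec {f : ℕ} {G : M.N → M.N} (hG : IsGr (r f) G) (i p R p' R' : Tm) :
    (exec f i p R p' R').eval M e r ↔
      Exec G (i.ev M e) (p.ev M e) (R.ev M e) (p'.ev M e) (R'.ev M e) := by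
  simp only [exec, eval_disj, exNs, Function.iterate_succ, Function.iterate_zero, Function.comp, id,
    eval_exN, eval_conj, eval_eq, eval_lt, eval_neg, eval_entry, eval_update, eval_app, ev_lift_two,
    ev_lift_four, ev_lift_five, ev_pair, ev_var, ev_zero, ev_one, ev_add, ev_mul, econs_zero,
    econs_succ, hG.mem, Exec]
  refine or_congr Iff.rfl (or_congr ?_ (or_congr ?_ (or_congr ?_ ?_)))
  · constructor
    · rintro ⟨a, b, c, _, _, h, ⟨_, h1, rfl⟩, ⟨_, h2, rfl⟩, h3⟩
      exact ⟨a, b, c, h, h1, h2, h3⟩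
    · rintro ⟨a, b, c, h, h1, h2, h3⟩
      exact ⟨a, b, c, _, _, h, ⟨h3.1.1, h1, rfl⟩, ⟨h3.1.1, h2, rfl⟩, h3⟩
  · constructor
    · rintro ⟨a, b, c, _, _, h, ⟨_, h1, rfl⟩, ⟨_, h2, rfl⟩, h3⟩
      exact ⟨a, b, c, h, h1, h2, h3⟩
    · rintro ⟨a, b, c, h, h1, h2, h3⟩
      exact ⟨a, b, c, _, _, h, ⟨h3.1.1, h1, rfl⟩, ⟨h3.1.1, h2, rfl⟩, h3⟩
  · constructor
    · rintro ⟨a, b, _, _, h, ⟨_, h1, rfl⟩, rfl, h3⟩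
      exact ⟨a, b, h, h1, h3⟩
    · rintro ⟨a, b, h, h1, h3⟩
      exact ⟨a, b, _, _, h, ⟨h3.1.1, h1, rfl⟩, rfl, h3⟩
  · constructor
    · rintro ⟨a, b, c, _, _, h, ⟨h0, h1, rfl⟩, ⟨_, h2, rfl⟩, h3⟩
      exact ⟨a, b, c, h, h0, h1, h2, h3⟩
    · rintro ⟨a, b, c, h, h0, h1, h2, h3⟩
      exact ⟨a, b, c, _, _, h, ⟨h0, h1, rfl⟩, ⟨h0, h2, rfl⟩, h3⟩

/-- The meaning of `step`. -/
def Step (G : M.N → M.N) (e C C' : M.N) : Prop := ∃ p R p' R', C = pr p R ∧ C' = pr p' R' ∧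
  IsSq e ∧ p < len e ∧ Exec G (ent e p) p R p' R'

theorem eval_step {f : ℕ} {G : M.N → M.N} (hG : IsGr (r f) G) (c C C' : Tm) :
    (step f c C C').eval M e r ↔ Step G (c.ev M e) (C.ev M e) (C'.ev M e) := by
  simp only [step, exNs, Function.iterate_succ, Function.iterate_zero, Function.comp, id,
    eval_exN, eval_conj, eval_eq, eval_entry, eval_exec _ _ hG, ev_lift_five, ev_pair, ev_var,
    econs_zero, econs_succ, Step]
  constructor
  · rintro ⟨_, p, R, p', R', h1, h2, ⟨h3, h4, rfl⟩, h5⟩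
    exact ⟨p, R, p', R', h1, h2, h3, h4, h5⟩
  · rintro ⟨p, R, p', R', h1, h2, h3, h4, h5⟩
    exact ⟨_, p, R, p', R', h1, h2, ⟨h3, h4, rfl⟩, h5⟩

/-- The meaning of `initial`. -/
def Init (C n : M.N) : Prop := ∃ R, C = pr 0 R ∧ IsSq R ∧ 0 < len R ∧ ent R 0 = n ∧
  ∀ i < len R, i ≠ 0 → ent R i = 0

@[simp] theorem eval_initial (C n : Tm) :
    (initial C n).eval M e r ↔ Init (C.ev M e) (n.ev M e) := by
  simp only [initial, eval_exN, eval_conj, eval_eq, eval_entry, ev_lift_one, ev_pair, ev_var,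
    ev_zero, econs_zero, allNs, Function.iterate_succ, Function.iterate_zero, Function.comp, id,
    eval_allN, eval_imp, eval_neg, econs_succ, Init]
  constructor
  · rintro ⟨R, h1, ⟨h2, h3, h4⟩, h⟩
    exact ⟨R, h1, h2, h3, h4.symm, fun i hi h0 => h i _ ⟨h2, hi, rfl⟩ h0⟩
  · rintro ⟨R, h1, h2, h3, h4, h⟩
    exact ⟨R, h1, ⟨h2, h3, h4.symm⟩, fun i x hx h0 => hx.2.2.trans (h i hx.2.1 h0)⟩

/-- The meaning of `halting`. -/
def Halt (e C m : M.N) : Prop := ∃ p R, C = pr p R ∧ IsSq e ∧ ¬ p < len e ∧ IsSq R ∧ 0 < len R ∧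
  ent R 0 = m

@[simp] theorem eval_halting (c C m : Tm) :
    (halting c C m).eval M e r ↔ Halt (c.ev M e) (C.ev M e) (m.ev M e) := by
  simp only [halting, exNs, Function.iterate_succ, Function.iterate_zero, Function.comp, id,
    eval_exN, eval_conj, eval_eq, eval_entry, eval_isLen, eval_neg, eval_lt, ev_lift_three, ev_pair,
    ev_var, ev_zero, econs_zero, econs_succ, Halt]
  constructor
  · rintro ⟨p, R, l, h1, ⟨h2, rfl⟩, h3, h4, h5, h6⟩
    exact ⟨p, R, h1, h2, h3, h4, h5, h6.symm⟩
  · rintro ⟨p, R, h1, h2, h3, h4, h5, h6⟩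
    exact ⟨p, R, _, h1, ⟨h2, rfl⟩, h3, h4, h5, h6.symm⟩

/-- The meaning of `phi`. -/
def Phi (G : M.N → M.N) (e n m : M.N) : Prop := ∃ s l, IsSq s ∧ len s = l + 1 ∧
  Init (ent s 0) n ∧ (∀ t < l, Step G e (ent s t) (ent s (t + 1))) ∧ Halt e (ent s l) m

theorem eval_phi {f : ℕ} {G : M.N → M.N} (hG : IsGr (r f) G) (c n m : Tm) :
    (phi f c n m).eval M e r ↔ Phi G (c.ev M e) (n.ev M e) (m.ev M e) := by
  simp only [phi, exNs, Function.iterate_succ, Function.iterate_zero, Function.comp, id,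
    eval_exN, eval_conj, eval_entry, eval_isLen, eval_ball, eval_step _ _ hG, eval_initial,
    eval_halting, ev_lift_five, ev_lift_three, ev_var, ev_add, ev_one, ev_zero, econs_zero,
    econs_succ, Phi]
  constructor
  · rintro ⟨s, l, ⟨h1, h2⟩, ⟨_, ⟨_, _, rfl⟩, h3⟩, h4, ⟨_, ⟨_, _, rfl⟩, h5⟩⟩
    refine ⟨s, l, h1, h2, h3, fun t ht => ?_, h5⟩
    obtain ⟨_, _, ⟨_, _, rfl⟩, ⟨_, _, rfl⟩, h⟩ := h4 t ht
    exact h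
  · rintro ⟨s, l, h1, h2, h3, h4, h5⟩
    have hl : ∀ t, t < l → t < len s ∧ t + 1 < len s := fun t ht => by
      rw [h2]; exact ⟨ht.trans (Str.lt_succ.2 le_rfl), by gcongr⟩
    refine ⟨s, l, ⟨h1, h2⟩, ⟨_, ⟨h1, ?_, rfl⟩, h3⟩, fun t ht => ?_, ⟨_, ⟨h1, ?_, rfl⟩, h5⟩⟩
    · rw [h2]; positivity
    · exact ⟨_, _, ⟨h1, (hl t ht).1, rfl⟩, ⟨h1, (hl t ht).2, rfl⟩, h4 t ht⟩
    · rw [h2]; exact Str.lt_succ.2 le_rfl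

set_option synthInstance.maxHeartbeats 400000 in
set_option synthInstance.maxSize 2000 in
theorem Phi.sig {G : M.N → M.N} (hG : Fn fun e => G (e 0)) :
    Sig fun e => Phi G (e 0) (e 1) (e 2) := by
  have hG' : ∀ t : (ℕ → M.N) → M.N, [Fn t] → Fn fun e => G (t e) := fun t ht => Fn.comp₁ ht hG
  unfold Phi Init Step Halt Exec
  infer_instance

/-- Two register contents agree where both are defined. Configurations of the same computation may
have register sequences of different lengths. -/
def Agree (R Q : M.N) : Prop := IsSq R ∧ IsSq Q ∧ ∀ i < len R, i < len Q → ent R i = ent Q i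

theorem Agree.upd {R Q a x R' Q' : M.N} (h : Agree R Q) (hR : Upd R a x R') (hQ : Upd Q a x Q') :
    Agree R' Q' := by
  refine ⟨hR.2.1, hQ.2.1, fun i hi hi' => ?_⟩
  rw [hR.2.2.1] at hi
  rw [hQ.2.2.1] at hi'
  by_cases hia : i = a
  · rw [(hR.2.2.2.2 i hi).1 hia, (hQ.2.2.2.2 i hi').1 hia]
  · rw [(hR.2.2.2.2 i hi).2 hia, (hQ.2.2.2.2 i hi').2 hia, h.2.2 i hi hi']

theorem Exec.det {G : M.N → M.N} {i p R Q p' q' R' Q' : M.N} (h : Agree R Q)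
    (hR : Exec G i p R p' R') (hQ : Exec G i p Q q' Q') : p' = q' ∧ Agree R' Q' := by
  rcases hR with ⟨a, b, rfl, h1, rfl⟩ | ⟨a, b, c, rfl, hb, hc, h1, rfl⟩ |
    ⟨a, b, c, rfl, hb, hc, h1, rfl⟩ | ⟨a, b, rfl, hb, h1, rfl⟩ |
    ⟨a, b, c, rfl, -, ha, hb, rfl, h1⟩ <;>
  rcases hQ with ⟨a', b', hi, h1', rfl⟩ | ⟨a', b', c', hi, hb', hc', h1', rfl⟩ |
    ⟨a', b', c', hi, hb', hc', h1', rfl⟩ | ⟨a', b', hi, hb', h1', rfl⟩ |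
    ⟨a', b', c', hi, -, ha', hb', rfl, h1'⟩ <;>
  rw [pr_inj] at hi <;> first
    | (have h0 := hi.1; norm_num at h0; done)
    | skip
  · obtain ⟨rfl, rfl⟩ := pr_inj.1 hi.2
    exact ⟨rfl, h.upd h1 h1'⟩
  · obtain ⟨rfl, h2⟩ := pr_inj.1 hi.2
    obtain ⟨rfl, rfl⟩ := pr_inj.1 h2
    rw [h.2.2 _ hb hb', h.2.2 _ hc hc'] at h1
    exact ⟨rfl, h.upd h1 h1'⟩
  · obtain ⟨rfl, h2⟩ := pr_inj.1 hi.2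
    obtain ⟨rfl, rfl⟩ := pr_inj.1 h2
    rw [h.2.2 _ hb hb', h.2.2 _ hc hc'] at h1
    exact ⟨rfl, h.upd h1 h1'⟩
  · obtain ⟨rfl, rfl⟩ := pr_inj.1 hi.2
    rw [h.2.2 _ hb hb'] at h1
    exact ⟨rfl, h.upd h1 h1'⟩
  · obtain ⟨rfl, h2⟩ := pr_inj.1 hi.2
    obtain ⟨rfl, rfl⟩ := pr_inj.1 h2
    rw [h.2.2 _ ha ha', h.2.2 _ hb hb'] at h1
    refine ⟨?_, h⟩
    rcases h1 with ⟨h1, rfl⟩ | ⟨h1, rfl⟩ <;> rcases h1' with ⟨h1', rfl⟩ | ⟨h1', rfl⟩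
    · rfl
    · exact absurd h1 h1'
    · exact absurd h1' h1
    · rfl

/-- The machines are deterministic. -/
theorem Phi.det {G : M.N → M.N} {e n m m' : M.N} (h : Phi G e n m) (h' : Phi G e n m') :
    m = m' := by
  obtain ⟨s, l, -, -, hi, hs, hh⟩ := h
  obtain ⟨s', l', -, -, hi', hs', hh'⟩ := h'
  have key : ∀ t, t ≤ l → t ≤ l' → ∃ p R Q, ent s t = pr p R ∧ ent s' t = pr p Q ∧ Agree R Q := by
    refine sig_induction (by unfold Agree; infer_instance) ?_ ?_
    · intro _ _
      obtain ⟨R, hR, h1, h2, h3, h4⟩ := hi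
      obtain ⟨Q, hQ, h1', h2', h3', h4'⟩ := hi'
      refine ⟨0, R, Q, hR, hQ, h1, h1', fun i hi hi' => ?_⟩
      by_cases h0 : i = 0
      · rw [h0, h3, h3']
      · rw [h4 i hi h0, h4' i hi' h0]
    · intro t ih ht ht'
      obtain ⟨p, R, Q, hR, hQ, hA⟩ := ih (le_self_add.trans ht) (le_self_add.trans ht')
      obtain ⟨p1, R1, p1', R1', h1, h2, -, -, h3⟩ := hs t (Str.succ_le.1 ht)
      obtain ⟨p2, R2, p2', R2', h1', h2', -, -, h3'⟩ := hs' t (Str.succ_le.1 ht')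
      obtain ⟨rfl, rfl⟩ := pr_inj.1 (hR.symm.trans h1)
      obtain ⟨rfl, rfl⟩ := pr_inj.1 (hQ.symm.trans h1')
      obtain ⟨rfl, h4⟩ := Exec.det hA h3 h3'
      exact ⟨_, _, _, h2, h2', h4⟩
  obtain ⟨p, R, hR, -, hp, -, h0, rfl⟩ := hh
  obtain ⟨q, Q, hQ, -, hq, -, h0', rfl⟩ := hh'
  have hll : l = l' := by
    rcases lt_trichotomy l l' with h | h | h
    · obtain ⟨p1, R1, Q1, h1, h2, -⟩ := key l le_rfl h.le
      obtain ⟨p2, R2, _, _, h3, -, -, h4, -⟩ := hs' l h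
      rw [(pr_inj.1 (hR.symm.trans h1)).1] at hp
      rw [(pr_inj.1 (h3.symm.trans h2)).1] at h4
      exact absurd h4 hp
    · exact h
    · obtain ⟨p1, R1, Q1, h1, h2, -⟩ := key l' h.le le_rfl
      obtain ⟨p2, R2, _, _, h3, -, -, h4, -⟩ := hs l' h
      rw [(pr_inj.1 (hQ.symm.trans h2)).1] at hq
      rw [(pr_inj.1 (h3.symm.trans h1)).1] at h4
      exact absurd h4 hq
  subst hll
  obtain ⟨p1, R1, Q1, h1, h2, h3⟩ := key l le_rfl le_rfl
  obtain ⟨-, rfl⟩ := pr_inj.1 (hR.symm.trans h1)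
  obtain ⟨-, rfl⟩ := pr_inj.1 (hQ.symm.trans h2)
  exact h3.2.2 0 h0 h0'

/-- The meaning of `DNR`. -/
theorem eval_DNR {f : ℕ} {G : M.N → M.N} (hG : IsGr (r f) G) (k : Tm) : (DNR k f).eval M e r ↔
    ∃ g : M.N → M.N, Fn (fun e => g (e 0)) ∧ (∀ a, g a < k.ev M e) ∧ ∀ a, ¬ Phi G a a (g a) := by
  have hG' : ∀ X : M.S, IsGr (econs X r (f + 1)) G := fun _ => hG
  simp only [DNR, isBddBy, isDNR, eval_exS, eval_conj, eval_isFun, allNs, Function.iterate_succ,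
    Function.iterate_zero, Function.comp, id, eval_allN, eval_imp, eval_app, eval_lt, ev_lift_two,
    eval_neg, eval_phi _ _ (hG' _), ev_var, econs_zero, econs_succ]
  constructor
  · rintro ⟨X, ⟨g, hg, hX⟩, h1, h2⟩
    exact ⟨g, hg, fun a => h1 a _ (hX.mem.2 rfl), fun a => h2 a _ (hX.mem.2 rfl)⟩
  · rintro ⟨g, hg, h1, h2⟩
    obtain ⟨X, hX⟩ := exists_isGr hg
    refine ⟨X, ⟨g, hg, hX⟩, fun a b hb => ?_, fun a b hb => ?_⟩
    · rw [hX.mem.1 hb]; exact h1 a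
    · rw [hX.mem.1 hb]; exact h2 a

/-- A function that separates the programs with output `0` on themselves from those with output `1`
is diagonally non-recursive. -/
theorem DNR_two_of_separation (h : Separation M) {G : M.N → M.N} (hG : Fn fun e => G (e 0)) :
    ∃ g : M.N → M.N, Fn (fun e => g (e 0)) ∧ (∀ a, g a < 1 + 1) ∧ ∀ a, ¬ Phi G a a (g a) := by
  classical
  have hs : ∀ c : M.N, Sig fun e => Phi G (e 0) (e 0) c := fun c =>
    Sig.comp₃ (Fn.var 0) (Fn.var 0) (Fn.const c) (Phi.sig hG)
  obtain ⟨D, hD, h⟩ := h (fun a => Phi G a a 0) (fun a => Phi G a a 1) (hs 0) (hs 1)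
    fun a h h' => zero_ne_one (h.det h')
  refine ⟨fun a => if D a then 1 else 0, inferInstance, fun a => ?_, fun a ha => ?_⟩
  · dsimp only
    rw [lt_two]; split_ifs <;> simp
  · dsimp only at ha
    split_ifs at ha with hDa
    · exact (h a).2 ha hDa
    · exact hDa ((h a).1 ha)

end Machines

/-! ### Searching programs -/

section Search

variable {M : Str} [hM : IsRCA M]

/-- `e` is the program that applies the oracle repeatedly, starting from `⟨s, 0⟩`, until the value
is at most `s`: `R₀ := ⟨s, 0⟩`, `R₁ := s`, then `R₀ := f(R₀)`, repeated while
`R₁ < R₀`. -/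
def IsProg (e s : M.N) : Prop := IsSq e ∧ len e = 4 ∧ ent e 0 = pr 0 (pr 0 (pr s 0)) ∧
  ent e 1 = pr 0 (pr 1 s) ∧ ent e 2 = pr 3 (pr 0 0) ∧ ent e 3 = pr 4 (pr 1 (pr 0 2))

instance Del.isProg {s t : (ℕ → M.N) → M.N} [hs : Fn s] [ht : Fn t] :
    Del fun e => IsProg (s e) (t e) := by unfold IsProg; infer_instance

theorem exists_isProg (s : M.N) : ∃ e, IsProg e s := by
  classical
  obtain ⟨e, h1, h2, h3⟩ := exists_seq (M := M) (G := fun i =>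
    if i = 0 then pr 0 (pr 0 (pr s 0)) else if i = 1 then pr 0 (pr 1 s) else
      if i = 2 then pr 3 (pr 0 0) else pr 4 (pr 1 (pr 0 2))) inferInstance 4
  refine ⟨e, h1, h2, ?_, ?_, ?_, ?_⟩ <;> rw [h3 _ (by norm_num)] <;> norm_num

/-- There are two registers, with contents `a` and `b`. -/
def Regs (R a b : M.N) : Prop := IsSq R ∧ len R = 1 + 1 ∧ ent R 0 = a ∧ ent R 1 = b

instance Del.regs {s t u : (ℕ → M.N) → M.N} [hs : Fn s] [ht : Fn t] [hu : Fn u] :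
    Del fun e => Regs (s e) (t e) (u e) := by unfold Regs; infer_instance

theorem exists_regs (a b : M.N) : ∃ R, Regs R a b := by
  classical
  obtain ⟨R, h1, h2, h3⟩ := exists_seq (M := M) (G := fun i => if i = 0 then a else b)
    inferInstance (1 + 1)
  refine ⟨R, h1, h2, ?_, ?_⟩ <;> rw [h3 _ (by norm_num)] <;> norm_num

theorem Regs.upd_zero {R R' a b x : M.N} (h : Regs R a b) (h' : Regs R' x b) : Upd R 0 x R' := by
  refine ⟨h.1, h'.1, h'.2.1.trans h.2.1.symm, by rw [h.2.1]; norm_num,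
    fun i hi => ⟨?_, fun hi0 => ?_⟩⟩
  · rintro rfl; exact h'.2.2.1
  · rw [h.2.1, lt_two] at hi
    rw [hi.resolve_left hi0, h.2.2.2, h'.2.2.2]

theorem Regs.upd_one {R R' a b x : M.N} (h : Regs R a b) (h' : Regs R' a x) : Upd R 1 x R' := by
  refine ⟨h.1, h'.1, h'.2.1.trans h.2.1.symm, by rw [h.2.1]; norm_num,
    fun i hi => ⟨?_, fun hi0 => ?_⟩⟩
  · rintro rfl; exact h'.2.2.2
  · rw [h.2.1, lt_two] at hi
    rw [hi.resolve_right hi0, h.2.2.1, h'.2.2.1]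

/-- A coded computation of the program `e` leads from `C` to `C'`. -/
def Reach (F : M.N → M.N) (e C C' : M.N) : Prop := ∃ S l, IsSq S ∧ len S = l + 1 ∧ ent S 0 = C ∧
  (∀ t < l, Step F e (ent S t) (ent S (t + 1))) ∧ ent S l = C'

theorem Reach.refl (F : M.N → M.N) (e C : M.N) : Reach F e C C := by
  obtain ⟨S, h1, h2, h3⟩ := exists_seq (M := M) (G := fun _ => C) inferInstance (0 + 1)
  exact ⟨S, 0, h1, h2, h3 0 (by norm_num), fun t ht => absurd ht (by simp), h3 0 (by norm_num)⟩

theorem Reach.snoc {F : M.N → M.N} {e C C' C'' : M.N} (h : Reach F e C C') (h' : Step F e C' C'') :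
    Reach F e C C'' := by
  obtain ⟨S, l, h1, h2, h3, h4, h5⟩ := h
  obtain ⟨S', h1', h2', h3', h4'⟩ := exists_snoc S (l + 1) C''
  refine ⟨S', l + 1, h1', h2', by rw [h3' 0 (by positivity), h3], fun t ht => ?_, h4'⟩
  rw [h3' t ht]
  rcases (Str.lt_succ.1 ht).lt_or_eq with ht | rfl
  · rw [h3' _ (by gcongr)]; exact h4 t ht
  · rw [h4', h5]; exact h'

set_option synthInstance.maxHeartbeats 400000 in
set_option synthInstance.maxSize 2000 in
theorem Reach.sig {F : M.N → M.N} (hF : Fn fun e => F (e 0)) :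
    Sig fun e => Reach F (e 0) (e 1) (e 2) := by
  have hF' : ∀ t : (ℕ → M.N) → M.N, [Fn t] → Fn fun e => F (t e) := fun t ht => Fn.comp₁ ht hF
  unfold Reach Step Exec
  infer_instance

/-- If iterating the oracle `F` from `⟨s, 0⟩` runs through `⟨s, 1⟩, ⟨s, 2⟩, …` and ends with a value
`x ≤ s`, then the searching program outputs `x`. -/
theorem IsProg.phi {F : M.N → M.N} (hF : Fn fun e => F (e 0)) {e s w x : M.N} (he : IsProg e s)
    (h : ∀ u < w, F (pr s u) = pr s (u + 1)) (hw : F (pr s w) = x) (hx : x ≤ s) (n : M.N) :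
    Phi F e n x := by
  obtain ⟨he, hlen, he0, he1, he2, he3⟩ := he
  obtain ⟨R0, hR0⟩ := exists_regs n 0
  have loop : ∀ u, u ≤ w → ∃ R, Regs R (pr s u) s ∧ Reach F e (pr 0 R0) (pr 2 R) := by
    have hs : ∀ a b c : (ℕ → M.N) → M.N, [Fn a] → [Fn b] → [Fn c] →
        Sig fun t => Reach F (a t) (b t) (c t) :=
      fun a b c ha hb hc => Sig.comp₃ ha hb hc (Reach.sig hF)
    refine sig_induction inferInstance ?_ ?_
    · intro _
      obtain ⟨R1, hR1⟩ := exists_regs (pr s 0) 0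
      obtain ⟨R2, hR2⟩ := exists_regs (pr s 0) s
      refine ⟨R2, hR2, ((Reach.refl F e _).snoc (C'' := pr 1 R1) ?_).snoc ?_⟩
      · refine ⟨0, R0, 1, R1, rfl, rfl, he, by rw [hlen]; norm_num, .inl ?_⟩
        exact ⟨_, _, he0, hR0.upd_zero hR1, by norm_num⟩
      · refine ⟨1, R1, 2, R2, rfl, rfl, he, by rw [hlen]; norm_num, .inl ?_⟩
        exact ⟨_, _, he1, hR1.upd_one hR2, by norm_num⟩
    · intro u ih hu
      obtain ⟨R, hR, hreach⟩ := ih (le_self_add.trans hu)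
      obtain ⟨R', hR'⟩ := exists_regs (pr s (u + 1)) s
      refine ⟨R', hR', (hreach.snoc (C'' := pr 3 R') ?_).snoc ?_⟩
      · refine ⟨2, R, 3, R', rfl, rfl, he, by rw [hlen]; norm_num, .inr (.inr (.inr (.inl ?_)))⟩
        refine ⟨0, 0, by rw [he2]; norm_num, by rw [hR.2.1]; norm_num, ?_, by norm_num⟩
        rw [hR.2.2.1, h u (Str.succ_le.1 hu)]
        exact hR.upd_zero hR'
      · refine ⟨3, R', 2, R', rfl, rfl, he, by rw [hlen]; norm_num, .inr (.inr (.inr (.inr ?_)))⟩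
        refine ⟨1, 0, 2, by rw [he3]; norm_num, hR'.1, by rw [hR'.2.1]; norm_num,
          by rw [hR'.2.1]; norm_num, rfl, .inl ⟨?_, rfl⟩⟩
        rw [hR'.2.2.1, hR'.2.2.2]
        exact (lt_add_of_pos_right s (by positivity)).trans_le (add_le_pr _ _)
  obtain ⟨R, hR, hreach⟩ := loop w le_rfl
  obtain ⟨R', hR'⟩ := exists_regs x s
  have h1 : Reach F e (pr 0 R0) (pr 4 R') := by
    refine (hreach.snoc (C'' := pr 3 R') ?_).snoc ?_
    · refine ⟨2, R, 3, R', rfl, rfl, he, by rw [hlen]; norm_num, .inr (.inr (.inr (.inl ?_)))⟩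
      refine ⟨0, 0, by rw [he2]; norm_num, by rw [hR.2.1]; norm_num, ?_, by norm_num⟩
      rw [hR.2.2.1, hw]
      exact hR.upd_zero hR'
    · refine ⟨3, R', 4, R', rfl, rfl, he, by rw [hlen]; norm_num, .inr (.inr (.inr (.inr ?_)))⟩
      refine ⟨1, 0, 2, by rw [he3]; norm_num, hR'.1, by rw [hR'.2.1]; norm_num,
        by rw [hR'.2.1]; norm_num, rfl, .inr ⟨?_, by norm_num⟩⟩
      rw [hR'.2.2.1, hR'.2.2.2]
      exact not_lt.2 hx
  obtain ⟨S, l, h2, h3, h4, h5, h6⟩ := h1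
  refine ⟨S, l, h2, h3, ?_, h5, ?_⟩
  · rw [h4]
    refine ⟨R0, rfl, hR0.1, by rw [hR0.2.1]; norm_num, hR0.2.2.1, fun i hi hi0 => ?_⟩
    rw [hR0.2.1, lt_two] at hi
    rw [hi.resolve_left hi0, hR0.2.2.2]
  · rw [h6]
    exact ⟨4, R', rfl, he, by rw [hlen]; exact lt_irrefl _, hR'.1, by rw [hR'.2.1]; norm_num,
      hR'.2.2.1⟩

end Search

/-! ### From a bounded diagonally non-recursive function to separation -/

section Main

variable {M : Str} [hM : IsRCA M]

/-- `Σ⁰₂` induction for the predicate `∃ t, Q t j`, where `Q` is `Π⁰₁`. -/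
theorem sig_two_induction (h2 : ∀ ψ ∈ ISigma 2, ∀ e r, ψ.eval M e r) {Q : M.N → M.N → Prop}
    (hQ : PiD fun e => Q (e 0) (e 1)) (h0 : ∃ t, Q t 0)
    (h : ∀ j, (∃ t, Q t j) → ∃ t, Q t (j + 1)) (j : M.N) : ∃ t, Q t j := by
  have := hM.ne
  obtain ⟨R, hR, hQR⟩ := hQ.sig
  obtain ⟨φ, hφ, p, r, hr⟩ := hR.rep
  -- puts the variables into the order in which they are quantified: the witness for `¬ Q`, then `t`
  let σ : ℕ → Tm := fun i => v (if i % 2 = 0 then (if i = 0 then 0 else if i = 2 then 1 else i - 2)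
    else i + 2)
  have hσ : ∀ (u t : M.N) (w : ℕ → M.N), (φ.subst σ id).eval M (econs u (econs t (mix w p))) r ↔
      R (econs u (econs t w)) := by
    intro u t w
    rw [Fm.eval_subst, ← hr]
    have : (fun i => (σ i).ev M (econs u (econs t (mix w p)))) =
        mix (econs u (econs t w)) p := by
      funext i
      rcases Nat.even_or_odd' i with ⟨k, rfl | rfl⟩
      · rw [mix_even]
        match k with
        | 0 => rfl
        | 1 => rfl
        | k + 2 =>
          have : (if 2 * (k + 2) % 2 = 0 then (if 2 * (k + 2) = 0 then 0 else
              if 2 * (k + 2) = 2 then 1 else 2 * (k + 2) - 2) else 2 * (k + 2) + 2) =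
              2 * k + 1 + 1 := by
            rw [if_pos (by omega), if_neg (by omega), if_neg (by omega)]; omega
          simp only [σ, this, ev_var, econs_succ, mix_even]
      · rw [mix_odd]
        have : (if (2 * k + 1) % 2 = 0 then (if (2 * k + 1) = 0 then 0 else
              if (2 * k + 1) = 2 then 1 else (2 * k + 1) - 2) else (2 * k + 1) + 2) =
              2 * k + 1 + 1 + 1 := by
          rw [if_neg (by omega)]
        simp only [σ, this, ev_var, econs_succ, mix_odd]
    rw [this]; rfl
  have hψ : ∀ w : ℕ → M.N, (exN (allN (neg (φ.subst σ id)))).eval M (mix w p) r ↔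
      ∃ t, Q t (w 0) := by
    intro w
    simp only [eval_exN, eval_allN, eval_neg, hσ]
    refine exists_congr fun t => ?_
    have := hQR (econs t w)
    rw [← not_iff_not, not_forall_not, ← this]
    rfl
  have h1 := h2 _ ⟨exN (allN (neg (φ.subst σ id))),
    ⟨_, ⟨_, (hφ.subst _ _).imp .bot, rfl⟩, rfl⟩, rfl⟩
    (mix p fun _ => 0) r
  rw [inductionAx_eval] at h1
  simp only [← mix_econs, hψ, econs_zero] at h1
  exact h1 h0 h j

/-- The key step: with `Σ⁰₂` induction, bounded diagonally non-recursive functions, with a bound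
depending on the oracle, yield `Σ⁰₁` separation.

For a sequence `s` of length `k`, let the searching program for `s` output the `x < k` such that
`A (s x)` and `B (s i)` for all `i ≠ x`. The value `y < k` of `g` at this program is not the output,
so for some `i` the prediction that `A (s i)` if `i = y`, and `B (s i)` otherwise, is wrong. By
`Σ⁰₂` induction there is a `j` such that some initial segment of length `j` forces an error at a
place `≥ j`, but none of length `j + 1` forces one at a place `≥ j + 1`. Keeping the former segment
and putting `p` at place `j`, one can search for a continuation without errors after `j`, and then
the prediction for `p` is wrong. Thus `p` goes to the side of `A` if `y ≠ j`, and to that of `B` if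
`y = j`. -/
theorem separation_of_DNR (h2 : ∀ ψ ∈ ISigma 2, ∀ e r, ψ.eval M e r)
    (hD : ∀ G : M.N → M.N, Fn (fun e => G (e 0)) → ∃ (k : M.N) (g : M.N → M.N),
      Fn (fun e => g (e 0)) ∧ (∀ a, g a < k) ∧ ∀ a, ¬ Phi G a a (g a)) : Separation M := by
  intro A B hA hB hAB
  have hA' : ∀ t : (ℕ → M.N) → M.N, [Fn t] → Sig fun e => A (t e) := fun t ht =>
    Sig.comp₂ (R := fun x _ => A x) ht ht hA
  have hB' : ∀ t : (ℕ → M.N) → M.N, [Fn t] → Sig fun e => B (t e) := fun t ht =>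
    Sig.comp₂ (R := fun x _ => B x) ht ht hB
  -- the prediction, for the value `y`, about the entry `p` at the place `i`
  let V : M.N → M.N → M.N → Prop := fun y i p => (i = y → A p) ∧ (¬ i = y → B p)
  have hV : ∀ s t u : (ℕ → M.N) → M.N, [Fn s] → [Fn t] → [Fn u] → Sig fun e =>
      V (s e) (t e) (u e) := fun s t u hs ht hu =>
    inferInstanceAs (Sig fun e => (t e = s e → A (u e)) ∧ (¬ t e = s e → B (u e)))
  obtain ⟨Q, hQ, hRQ⟩ := Sig.exists_del₂ (A := fun s x : M.N =>
    x < len s ∧ ∀ i < len s, V x i (ent s i)) inferInstance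
  have hQ' : ∀ s t u : (ℕ → M.N) → M.N, [Fn s] → [Fn t] → [Fn u] → Del fun e =>
    Q (s e) (t e) (u e) := fun s t u hs ht hu => Del.comp₃ hs ht hu hQ
  have uniq : ∀ {s x y u w}, Q u s x → Q w s y → x = y := by
    intro s x y u w hx hy
    have h1 := (hRQ s x).2 ⟨u, hx⟩
    have h2 := (hRQ s y).2 ⟨w, hy⟩
    by_contra hxy
    exact hAB _ ((h1.2 x h1.1).1 rfl) ((h2.2 x h1.1).2 hxy)
  -- the oracle that carries out one step of the search
  obtain ⟨F, hF, hFs⟩ := exists_fn (M := M) (C := fun z y =>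
    (∃ x < len (fs z), (∃ u < sn z + 1, Q u (fs z) x) ∧ y = x) ∨
    ((∀ x < len (fs z), ∀ u < sn z + 1, ¬ Q u (fs z) x) ∧ y = pr (fs z) (sn z + 1)))
    inferInstance fun z => by
      by_cases h : ∃ x < len (fs z), ∃ u < sn z + 1, Q u (fs z) x
      · obtain ⟨x, h1, h2⟩ := h
        exact ⟨x, .inl ⟨x, h1, h2, rfl⟩⟩
      · push Not at h
        exact ⟨_, .inr ⟨h, rfl⟩⟩
  have search : ∀ {s x e}, IsProg e s → (x < len s ∧ ∀ i < len s, V x i (ent s i)) →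
      ∀ n, Phi F e n x := by
    intro s x e he hx n
    obtain ⟨u, hu⟩ := (hRQ s x).1 hx
    obtain ⟨w, ⟨u', hu', hw⟩, hw'⟩ := exists_least (P := fun w => ∃ u < w + 1, Q u s x)
      inferInstance (a := u) ⟨u, Str.lt_succ.2 le_rfl, hu⟩
    refine he.phi hF (w := w) (fun v hv => ?_) ?_ (hx.1.le.trans (len_le s)) n
    · have h1 := hFs (pr s v)
      rw [fs_pr, sn_pr] at h1
      rcases h1 with ⟨y, -, ⟨u, hu, hy⟩, -⟩ | ⟨-, h1⟩
      · exact absurd ⟨u, hu, uniq hw hy ▸ hy⟩ (hw' v hv)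
      · exact h1
    · have h1 := hFs (pr s w)
      rw [fs_pr, sn_pr] at h1
      rcases h1 with ⟨y, -, ⟨u, hu, hy⟩, h1⟩ | ⟨h1, -⟩
      · rw [h1, uniq hw hy]
      · exact absurd hw (h1 x hx.1 u' hu')
  obtain ⟨k, g, hg, hgk, hgd⟩ := hD F hF
  have hg' : ∀ t : (ℕ → M.N) → M.N, [Fn t] → Fn fun e => g (t e) := fun t ht => Fn.comp₁ ht hg
  have err : ∀ s e, len s = k → IsProg e s → ∃ i < k, ¬ V (g e) i (ent s i) := by
    intro s e hs he
    by_contra hn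
    push Not at hn
    exact hgd e (search he ⟨hs ▸ hgk e, hs ▸ hn⟩ e)
  -- the first `j` entries of `t` force an error at a place `≥ j`
  let Body : M.N → M.N → Prop := fun t j => ∀ s, ∀ e, len s = k →
    (∀ i < j, i < k → ent s i = ent t i) → IsProg e s → ∃ i < k, j ≤ i ∧ ¬ V (g e) i (ent s i)
  have hBody : PiD fun e => Body (e 0) (e 1) := inferInstance
  have place : ∀ t j, Body t j → j < k := by
    intro t j h
    obtain ⟨s, -, h1, h2⟩ := exists_seq (G := fun i => ent t i) inferInstance k
    obtain ⟨e, he⟩ := exists_isProg s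
    obtain ⟨i, hi, hji, -⟩ := h s e h1 (fun i _ hi => h2 i hi) he
    exact hji.trans_lt hi
  obtain ⟨j, t, hj, hj'⟩ : ∃ j t, Body t j ∧ ¬ ∃ t, Body t (j + 1) := by
    by_contra hn
    push Not at hn
    obtain ⟨t, ht⟩ := sig_two_induction h2 hBody ⟨0, fun s e hs _ he => by
      obtain ⟨i, hi, h⟩ := err s e hs he
      exact ⟨i, hi, zero_le, h⟩⟩ (fun j ⟨t, ht⟩ => hn j t ht) k
    exact lt_irrefl _ (place t k ht)
  have hjk := place t j hj
  obtain ⟨K, hK, hKs⟩ := exists_fn (M := M) (C := fun p y => len (fs y) = k ∧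
    (∀ i < j, ent (fs y) i = ent t i) ∧ ent (fs y) j = p ∧ IsProg (sn y) (fs y) ∧
    ∀ i < k, j < i → V (g (sn y)) i (ent (fs y) i)) inferInstance fun p => by
      obtain ⟨t', -, -, ht'⟩ := exists_set t k j p
      have h1 : ¬ Body t' (j + 1) := fun h => hj' ⟨t', h⟩
      simp only [Body] at h1
      push Not at h1
      obtain ⟨s, e, hs, hst, he, h1⟩ := h1
      refine ⟨pr s e, ?_⟩
      rw [fs_pr, sn_pr]
      refine ⟨hs, fun i hi => ?_, ?_, he, fun i hi hji => h1 i hi (Str.succ_le.2 hji)⟩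
      · rw [hst i (hi.trans (Str.lt_succ.2 le_rfl)) (hi.trans hjk), (ht' i (hi.trans hjk)).2 hi.ne]
      · rw [hst j (Str.lt_succ.2 le_rfl) hjk, (ht' j hjk).1 rfl]
  have hK' : ∀ t : (ℕ → M.N) → M.N, [Fn t] → Fn fun e => K (t e) := fun t ht => Fn.comp₁ ht hK
  refine ⟨fun p => ¬ j = g (sn (K p)), inferInstance, fun p => ?_⟩
  obtain ⟨h1, h2, h3, h4, h5⟩ := hKs p
  obtain ⟨i, hi, hji, hV⟩ := hj _ _ h1 (fun i hi _ => h2 i hi) h4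
  rcases hji.lt_or_eq with hlt | rfl
  · exact absurd (h5 i hi hlt) hV
  · rw [h3] at hV
    exact ⟨fun hA h => hV ⟨fun _ => hA, fun hn => absurd h hn⟩,
      fun hB hn => hV ⟨fun h => absurd h hn, fun _ => hB⟩⟩

end Main

/-! ### The sentences in a model -/

section Sentences

variable {M : Str} [hM : IsRCA M] (e : ℕ → M.N) (r : ℕ → M.S)

theorem separation_of_allExDNR (h2 : ∀ ψ ∈ ISigma 2, ∀ e r, ψ.eval M e r)
    (h : allExDNR.eval M e r) : Separation M := by
  refine separation_of_DNR h2 fun G hG => ?_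
  obtain ⟨X, hX⟩ := exists_isGr hG
  obtain ⟨k, hk⟩ := (eval_exN _ _ _).1 ((eval_allS _ _ _).1 h X ((eval_isFun _ _ _).2 ⟨G, hG, hX⟩))
  exact ⟨k, (eval_DNR _ _ (f := 0) hX (v 0)).1 hk⟩

theorem allDNR2_of_separation (h : Separation M) : allDNR2.eval M e r := by
  refine (eval_allS _ _ _).2 fun X hX => ?_
  obtain ⟨G, hG, hX⟩ := (eval_isFun _ _ _).1 hX
  exact (eval_DNR _ _ (f := 0) hX _).2 (DNR_two_of_separation h hG)

theorem exAllDNR_of_separation (h : Separation M) : exAllDNR.eval M e r := by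
  refine (eval_exN _ _ _).2 ⟨1 + 1, (eval_allS _ _ _).2 fun X hX => ?_⟩
  obtain ⟨G, hG, hX⟩ := (eval_isFun _ _ _).1 hX
  exact (eval_DNR _ _ (f := 0) hX _).2 (DNR_two_of_separation h hG)

theorem allExDNR_of_exAllDNR (h : exAllDNR.eval M e r) : allExDNR.eval M e r := by
  obtain ⟨k, hk⟩ := (eval_exN _ _ _).1 h
  refine (eval_allS _ _ _).2 fun X hX => (eval_exN _ _ _).2 ⟨k, ?_⟩
  obtain ⟨G, hG, hX'⟩ := (eval_isFun _ _ _).1 hX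
  exact (eval_allS _ _ _).1 hk X ((eval_isFun _ _ _).2 ⟨G, hG, hX'⟩)

end Sentences

/-- By completeness, what holds in all models of an extension of `RCA₀` is provable in it. -/
theorem provable_of_models {T : Set Fm} (hT : RCA0 ⊆ T) {φ : Fm} (h : ∀ M : Str, IsRCA M →
    (∀ ψ ∈ T, ∀ e r, ψ.eval M e r) → ∀ e r, φ.eval M e r) : Provable T φ :=
  Provable.complete fun M hM e r => h M ⟨fun ψ hψ => hM ψ (hT hψ), ⟨r 0⟩⟩ hM e r

end SOA

theorem mainTheorem5 :
    SOA.Provable (SOA.RCA0 ∪ SOA.ISigma 2 ∪ {SOA.allExDNR}) SOA.allDNR2 ∧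
    SOA.Provable (SOA.RCA0 ∪ SOA.ISigma 2) (SOA.bicond SOA.WKL SOA.exAllDNR) ∧
    SOA.Provable (SOA.RCA0 ∪ SOA.ISigma 2) (SOA.bicond SOA.WKL SOA.allExDNR) ∧
    SOA.Provable (SOA.RCA0 ∪ SOA.ISigma 2) (SOA.bicond SOA.exAllDNR SOA.allExDNR) := by
  refine ⟨SOA.provable_of_models (fun ψ h => .inl (.inl h)) fun M _ hT e r => ?_,
    SOA.provable_of_models (fun ψ h => .inl h) fun M _ hT e r => ?_,
    SOA.provable_of_models (fun ψ h => .inl h) fun M _ hT e r => ?_,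
    SOA.provable_of_models (fun ψ h => .inl h) fun M _ hT e r => ?_⟩
  · exact SOA.allDNR2_of_separation e r (SOA.separation_of_allExDNR e r
      (fun ψ h => hT ψ (.inl (.inr h))) (hT _ (.inr rfl) e r))
  all_goals
    have hs := SOA.separation_of_allExDNR e r fun ψ h => hT ψ (.inr h)
    rw [SOA.eval_bicond]
  · exact ⟨fun h => SOA.exAllDNR_of_separation e r (SOA.separation_of_WKL h),
      fun h => SOA.WKL_of_separation (hs (SOA.allExDNR_of_exAllDNR e r h)) e r⟩
  · exact ⟨fun h => SOA.allExDNR_of_exAllDNR e r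
        (SOA.exAllDNR_of_separation e r (SOA.separation_of_WKL h)),
      fun h => SOA.WKL_of_separation (hs h) e r⟩
  · exact ⟨SOA.allExDNR_of_exAllDNR e r, fun h => SOA.exAllDNR_of_separation e r (hs h)⟩
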